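/- Let $K$ be a field of characteristic $0$. Consider formal functions in one even variable $x$ (formal power series) and two odd (Grassmann) variables $T,X$, with left derivatives, function parity $p$, $E=x\,\partial_x+X\,\partial_X$, $\Delta=\partial_x\partial_X$, $\delta(f)=2f-E(f)$, and the bracket $$\{f,g\}=\delta(f)\,\partial_T g+(-1)^{p(f)}\,\partial_T f\;\delta(g)-\partial_x f\,\partial_X g-(-1)^{p(f)}\,\partial_X f\,\partial_x g .$$ The special odd contact superalgebra $SM(1)$ is the Lie superalgebra of all $f$ with $(1-E)\partial_T f-\Delta f=0$; even functions are its odd elements and odd functions its even elements. It is graded by $g(x)=1$, $g(X)=-1$, $g(T)=0$, and has the topological basis $E_i=ix^{i-1}T+(2-i)x^iX$ (even), $TX$ and $x^i$ (odd), $i\ge 0$. Let $C^k_g$ be the space of $k$-linear super skew-symmetric forms $SM(1)^k\to K$ that are continuous ($x$-adic topology on $SM(1)$, discrete topology on $K$) and have grade $g$, i.e. vanish on homogeneous arguments whose grades do not add up to $g$. The differential $d:C^k_g\to C^{k+1}_g$ (trivial coefficients) is given on homogeneous arguments of parities $p_0,\dots,p_k$ by $$dC(v_0,\dots,v_k)=\sum_{i<j}(-1)^{j+p_j(p_{i+1}+\dots+p_{j-1})}\,C(v_0,\dots,v_{i-1},[v_i,v_j],v_{i+1},\dots,\widehat{v_j},\dots,v_k).$$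 Let $Z^k_g$, $B^k_g$ be the cocycles and coboundaries, $H^k_g=Z^k_g/B^k_g$, and let $\wedge$ be the exterior (super shuffle) product of forms. A linear expression in the values $C(\dots)$ of a cochain $C\in C^k_g$ is said to represent a generator of $H^k_g$ if, as a function of $C$, it vanishes on $B^k_g$ and induces a linear isomorphism $H^k_g\to K$. Then the following hold. 1. For all integers $0\le k\le 10$ and $g\le 10$: $\dim H^k_g=1$ if $g=k-2$ with $k\ge 1$, $k\ne 2$, or if $g=-k$; in all other cases $H^k_g=0$. In particular $H^2_0=0$. 2. The classes $a^k_{k-2}$ are generators: if $k,m\ge 1$, $k+m\le 10$, $A\in Z^k_g$, $B\in Z^m_h$ and $g+h=k+m-2$, then $A\wedge B\in B^{k+m}_{k+m-2}$. 3. Let $a^1_{-1}$ be the $1$-form that reads off the coefficient of $TX$. For every $k\ge 1$ the $k$-fold wedge power $a^1_{-1}\wedge\dots\wedge a^1_{-1}$ lies in $Z^k_{-k}$ and is not in $B^k_{-k}$, and $C(TX,\dots,TX)$ ($k$ arguments) represents a generator of $H^k_{-k}$. 4. Each of the following three expressions represents a generator of $H^3_1$, and they agree for every $C\in Z^3_1$: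 $$\begin{aligned}a^3_1&=C(T+xX,2xT,1)-2C(TX,x,x)\\&=C(2X,T+xX,x^2)-2C(TX,x,x)\\&=-C(2X,2xT,x)+2C(TX,1,x^2)+2C(TX,x,x).\end{aligned}$$ 5. Each of the following three expressions represents a generator of $H^4_2$, and they agree for every $C\in Z^4_2$: $$\begin{aligned}a^4_2&=C(T+xX,2xT,1,x)-\tfrac16C(T+xX,3x^2T-x^3X,1,1)-\tfrac43C(TX,x,x,x)\\&=C(2X,T+xX,x,x^2)-\tfrac16C(T+xX,3x^2T-x^3X,1,1)-\tfrac43C(TX,x,x,x)\\&=-\tfrac12C(2X,2xT,x,x)-\tfrac16C(T+xX,3x^2T-x^3X,1,1)+2C(TX,1,x,x^2)+\tfrac23C(TX,x,x,x).\end{aligned}$$ -/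

import Mathlib

open scoped BigOperators

noncomputable section

namespace OddContact

variable (K : Type*) [Field K]

/-- Formal functions in one even variable `x` and two odd variables `T`, `X`: the power series
`f a b` in `x` is the coefficient of the Grassmann monomial `T ^ a * X ^ b`, for `a, b ∈ {0, 1}`. -/
abbrev SFun : Type _ := Fin 2 → Fin 2 → PowerSeries K

variable {K}

/-- The product of formal functions, with `T * X = - X * T` and `T * T = X * X = 0`. -/
def mul (f g : SFun K) : SFun K :=
  ![![f 0 0 * g 0 0, f 0 0 * g 0 1 + f 0 1 * g 0 0],
    ![f 0 0 * g 1 0 + f 1 0 * g 0 0,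
      f 0 0 * g 1 1 + f 1 1 * g 0 0 + f 1 0 * g 0 1 - f 0 1 * g 1 0]]

/-- The even coordinate function `x`. -/
def varx : SFun K := ![![PowerSeries.X, 0], ![0, 0]]

/-- The odd coordinate function `X`. -/
def varX : SFun K := ![![0, 1], ![0, 0]]

/-- `f ↦ (-1)^{p(f)} f`, extended linearly, where `p` is the parity of functions. -/
def sgn (f : SFun K) : SFun K := ![![f 0 0, -f 0 1], ![-f 1 0, f 1 1]]

/-- `∂/∂x`. -/
def dx (f : SFun K) : SFun K := fun a b => PowerSeries.derivative K (f a b)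

/-- The (left) derivative `∂/∂T`. -/
def dT (f : SFun K) : SFun K := ![![f 1 0, f 1 1], ![0, 0]]

/-- The (left) derivative `∂/∂X`; in particular `∂(T * X)/∂X = -T`. -/
def dX (f : SFun K) : SFun K := ![![f 0 1, 0], ![-f 1 1, 0]]

/-- The Euler operator `E = x ∂/∂x + X ∂/∂X`. -/
def euler (f : SFun K) : SFun K := mul varx (dx f) + mul varX (dX f)

/-- `Δ = ∂²/∂x∂X`. -/
def lapl (f : SFun K) : SFun K := dx (dX f)

/-- `δ(f) = 2 f - E(f)`. -/
def delt (f : SFun K) : SFun K := (2 : K) • f - euler f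

/-- The Buttin bracket
`{f,g} = ∂f/∂x ∂g/∂X + (-1)^{p(f)} ∂f/∂X ∂g/∂x`. -/
def buttin (f g : SFun K) : SFun K := mul (dx f) (dX g) + mul (dX (sgn f)) (dx g)

/-- The odd contact bracket
`{f,g} = δ(f) ∂g/∂T + (-1)^{p(f)} ∂f/∂T δ(g) - {f,g}_Buttin`. -/
def contact (f g : SFun K) : SFun K :=
  mul (delt f) (dT g) + mul (dT (sgn f)) (delt g) - buttin f g

/-- The operator `(1 - E) ∂/∂T - Δ`. -/
def special (f : SFun K) : SFun K := dT f - euler (dT f) - lapl f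

theorem special_eq (f : SFun K) : special f =
    ![![f 1 0 - PowerSeries.X * PowerSeries.derivative K (f 1 0)
          - PowerSeries.derivative K (f 0 1),
        -(PowerSeries.X * PowerSeries.derivative K (f 1 1))],
      ![PowerSeries.derivative K (f 1 1), 0]] := by
  funext a b
  fin_cases a <;> fin_cases b <;>
    simp [special, euler, lapl, mul, varx, varX, dT, dX, dx]

/-- The special odd contact superalgebra `SM(1)`, in terms of generating functions. -/
def SM (K : Type*) [Field K] : Submodule K (SFun K) where
  carrier := {f | special f = 0}
  zero_mem' := by
    rw [Set.mem_ofPred_eq, special_eq]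
    funext a b
    fin_cases a <;> fin_cases b <;> simp
  add_mem' := by
    intro f g hf hg
    rw [Set.mem_ofPred_eq] at *
    have h : special (f + g) = special f + special g := by
      simp only [special_eq]
      funext a b
      fin_cases a <;> fin_cases b <;> simp <;> ring
    rw [h, hf, hg, add_zero]
  smul_mem' := by
    intro c f hf
    rw [Set.mem_ofPred_eq] at *
    have h : special (c • f) = c • special f := by
      simp only [special_eq]
      funext a b
      fin_cases a <;> fin_cases b <;> simp [smul_sub]
    rw [h, hf, smul_zero]

theorem mem_SM (f : SFun K) : f ∈ SM K ↔
    f 1 0 - PowerSeries.X * PowerSeries.derivative K (f 1 0)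
      = PowerSeries.derivative K (f 0 1) ∧ PowerSeries.derivative K (f 1 1) = 0 := by
  change special f = 0 ↔ _
  rw [special_eq]
  constructor
  · intro h
    have h1 := congrFun (congrFun h 0) 0
    have h2 := congrFun (congrFun h 1) 0
    simp at h1 h2
    exact ⟨sub_eq_zero.mp h1, h2⟩
  · rintro ⟨h1, h2⟩
    funext a b
    fin_cases a <;> fin_cases b <;> simp [h1, h2]

theorem contact_mem {f g : SFun K} (hf : f ∈ SM K) (hg : g ∈ SM K) : contact f g ∈ SM K := by
  obtain ⟨h1, h2⟩ := (mem_SM f).mp hf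
  obtain ⟨h3, h4⟩ := (mem_SM g).mp hg
  have hC : PowerSeries.C (2 : K) = 2 := map_ofNat _ 2
  rw [mem_SM]
  constructor
  · simp [contact, delt, buttin, euler, mul, varx, varX, sgn, dT, dX, dx, ← h1, ← h3, h2, h4,
      Algebra.smul_def]
    rw [hC]
    ring
  · simp [contact, delt, buttin, euler, mul, varx, varX, sgn, dT, dX, dx, ← h1, ← h3, h2, h4,
      Algebra.smul_def]
    try rw [hC]
    ring

/-- The Lie superbracket of `SM(1)`. -/
def br (f g : SM K) : SM K := ⟨contact f.1 g.1, contact_mem f.2 g.2⟩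

/-- The basis elements `E_i = i x^{i-1} T + (2 - i) x^i X`, `i ≥ 0`. -/
def bE (i : ℕ) : SM K :=
  ⟨![![0, PowerSeries.monomial i (2 - (i : K))], ![PowerSeries.monomial (i - 1) (i : K), 0]], by
    rw [mem_SM]
    refine ⟨?_, by simp⟩
    change PowerSeries.monomial (i - 1) (i : K)
        - PowerSeries.X * PowerSeries.derivative K (PowerSeries.monomial (i - 1) (i : K))
      = PowerSeries.derivative K (PowerSeries.monomial i (2 - (i : K)))
    ext n
    rcases i with _ | i
    · cases n <;> simp [PowerSeries.coeff_derivative]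
    · rw [map_sub]
      rcases n with _ | n
      · simp only [PowerSeries.coeff_zero_X_mul, PowerSeries.coeff_derivative,
          PowerSeries.coeff_monomial, Nat.add_sub_cancel, Nat.add_right_cancel_iff]
        split_ifs with h
        · subst h
          push_cast
          ring
        · simp
      · simp only [PowerSeries.coeff_succ_X_mul, PowerSeries.coeff_derivative,
          PowerSeries.coeff_monomial, Nat.add_sub_cancel, Nat.add_right_cancel_iff]
        split_ifs with h
        · subst h
          push_cast
          ring
        · simp⟩

/-- The basis element `T X`. -/
def bTX : SM K := ⟨![![0, 0], ![0, 1]], by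
  rw [mem_SM]; simp⟩

/-- The basis elements `x^i`, `i ≥ 0`. -/
def bO (i : ℕ) : SM K := ⟨![![PowerSeries.monomial i 1, 0], ![0, 0]], by
  rw [mem_SM]; simp⟩

/-- `f` is homogeneous of parity `p` (`0` even, `1` odd) as an element of the Lie superalgebra:
odd generating functions are the even elements, and even generating functions the odd ones. -/
def HasParity (p : Fin 2) (f : SM K) : Prop := ∀ a b : Fin 2, a + b + 1 ≠ p → f.1 a b = 0

/-- `f` is homogeneous of grade `n` for the grading `g(x) = 1`, `g(X) = -1`, `g(T) = 0`. -/
def HasGrade (n : ℤ) (f : SM K) : Prop :=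
  ∀ (a b : Fin 2) (i : ℕ), (i : ℤ) - (b : ℕ) ≠ n → PowerSeries.coeff i (f.1 a b) = 0

/-- The sign `(-1)^{p q}` of two parities. -/
def psgn (K : Type*) [Field K] (p q : Fin 2) : K := (-1) ^ ((p : ℕ) * (q : ℕ))

/-- All `k`-linear forms on `SM(1)`. -/
abbrev Form (K : Type*) [Field K] (k : ℕ) : Type _ :=
  MultilinearMap K (fun _ : Fin k => SM K) K

/-- Super skew-symmetry: exchanging two adjacent homogeneous arguments `u`, `v` multiplies the
value by `-(-1)^{p(u)p(v)}`. -/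
def IsSkew {k : ℕ} (C : Form K k) : Prop :=
  ∀ (p : Fin k → Fin 2) (v : Fin k → SM K), (∀ l, HasParity (p l) (v l)) →
    ∀ i j : Fin k, (i : ℕ) + 1 = j →
      C (fun l => v (Equiv.swap i j l)) = -psgn K (p i) (p j) * C v

/-- Continuity for the `x`-adic topology on `SM(1)` and the discrete topology on `K`
(for multilinear forms this is the following uniform condition). -/
def IsCont {k : ℕ} (C : Form K k) : Prop :=
  ∃ N : ℕ, ∀ (v : Fin k → SM K) (l : Fin k),
    (∀ a b, (PowerSeries.X : PowerSeries K) ^ N ∣ (v l).1 a b) → C v = 0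

/-- `C` has grade `g`: it vanishes on homogeneous arguments whose grades do not add up to `g`. -/
def IsGraded {k : ℕ} (g : ℤ) (C : Form K k) : Prop :=
  ∀ (n : Fin k → ℤ) (v : Fin k → SM K), (∀ l, HasGrade (n l) (v l)) → ∑ l, n l ≠ g → C v = 0

/-- The space `C^k_g` of `k`-cochains of grade `g` with values in the trivial module `K`. -/
def cochains (K : Type*) [Field K] (k : ℕ) (g : ℤ) : Submodule K (Form K k) where
  carrier := {C | IsSkew C ∧ IsCont C ∧ IsGraded g C}
  zero_mem' := ⟨fun p v _ i j _ => by simp, ⟨0, fun v l _ => by simp⟩, fun n v _ _ => by simp⟩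
  add_mem' := by
    rintro C D ⟨h1, ⟨M, h2⟩, h3⟩ ⟨h1', ⟨N, h2'⟩, h3'⟩
    refine ⟨fun p v hv i j hij => ?_, ⟨max M N, fun v l hl => ?_⟩, fun n v hv hn => ?_⟩
    · simp only [add_apply, h1 p v hv i j hij, h1' p v hv i j hij]
      ring
    · simp only [add_apply]
      rw [h2 v l fun a b => (pow_dvd_pow _ (le_max_left M N)).trans (hl a b),
        h2' v l fun a b => (pow_dvd_pow _ (le_max_right M N)).trans (hl a b), add_zero]
    · simp only [add_apply, h3 n v hv hn, h3' n v hv hn, add_zero]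
  smul_mem' := by
    rintro c C ⟨h1, ⟨M, h2⟩, h3⟩
    refine ⟨fun p v hv i j hij => ?_, ⟨M, fun v l hl => ?_⟩, fun n v hv hn => ?_⟩
    · simp only [smul_apply, h1 p v hv i j hij, smul_eq_mul]
      ring
    · simp only [smul_apply, h2 v l hl, smul_zero]
    · simp only [smul_apply, h3 n v hv hn, smul_zero]

/-- The value `dC(v_0, …, v_k)` of the differential of a `k`-cochain on homogeneous arguments of
parities `p_0, …, p_k` (trivial coefficients):
`∑_{i < j} (-1)^{j + p_j (p_{i+1} + ⋯ + p_{j-1})} C(v_0, …, [v_i, v_j], …, v̂_j, …, v_k)`.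
For even arguments followed by odd ones the signs are `(-1)^j` (both even), `(-1)^{q+1}`
(even and odd, `q + 1` being the number of even arguments) and `(-1)^{i+1}` (both odd). -/
def dVal {k : ℕ} (C : Form K k) (p : Fin (k + 1) → Fin 2) (v : Fin (k + 1) → SM K) : K :=
  ∑ i : Fin (k + 1), ∑ j ∈ Finset.Ioi i,
    (-1) ^ ((j : ℕ) + (p j : ℕ) * ∑ l ∈ Finset.Ioo i j, (p l : ℕ)) *
      C (fun m => Function.update v i (br (v i) (v j)) (j.succAbove m))

theorem dVal_add {k : ℕ} (C D : Form K k) (p : Fin (k + 1) → Fin 2) (v : Fin (k + 1) → SM K) :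
    dVal (C + D) p v = dVal C p v + dVal D p v := by
  simp only [dVal, add_apply, mul_add, Finset.sum_add_distrib]

theorem dVal_smul {k : ℕ} (c : K) (C : Form K k) (p : Fin (k + 1) → Fin 2)
    (v : Fin (k + 1) → SM K) : dVal (c • C) p v = c * dVal C p v := by
  simp only [dVal, smul_apply, smul_eq_mul, Finset.mul_sum]
  refine Finset.sum_congr rfl fun i _ => Finset.sum_congr rfl fun j _ => ?_
  ring

theorem dVal_zero {k : ℕ} (p : Fin (k + 1) → Fin 2) (v : Fin (k + 1) → SM K) :
    dVal (0 : Form K k) p v = 0 := by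
  simp [dVal]

/-- `D = dC`: the form `D` takes the values of the differential of `C` on all homogeneous
arguments (by multilinearity it is determined by these). -/
def IsDiff {k : ℕ} (C : Form K k) (D : Form K (k + 1)) : Prop :=
  ∀ (p : Fin (k + 1) → Fin 2) (v : Fin (k + 1) → SM K),
    (∀ l, HasParity (p l) (v l)) → D v = dVal C p v

/-- The cocycles `Z^k_g = {C ∈ C^k_g | dC = 0}`. -/
def cocycles (K : Type*) [Field K] (k : ℕ) (g : ℤ) : Submodule K (Form K k) where
  carrier := {C | C ∈ cochains K k g ∧ IsDiff C 0}
  zero_mem' := ⟨zero_mem _, fun p v _ => by simp [dVal_zero]⟩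
  add_mem' := by
    rintro C D ⟨h1, h2⟩ ⟨h1', h2'⟩
    refine ⟨add_mem h1 h1', fun p v hv => ?_⟩
    rw [dVal_add, ← h2 p v hv, ← h2' p v hv]
    simp
  smul_mem' := by
    rintro c C ⟨h1, h2⟩
    refine ⟨Submodule.smul_mem _ c h1, fun p v hv => ?_⟩
    rw [dVal_smul, ← h2 p v hv]
    simp

/-- The coboundaries `B^k_g = d C^{k-1}_g`, with `B^0_g = 0`. -/
def coboundaries (K : Type*) [Field K] : (k : ℕ) → ℤ → Submodule K (Form K k)
  | 0, _ => ⊥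
  | k + 1, g =>
    { carrier := {D | ∃ C ∈ cochains K k g, IsDiff C D}
      zero_mem' := ⟨0, zero_mem _, fun p v _ => by simp [dVal_zero]⟩
      add_mem' := by
        rintro D D' ⟨C, h1, h2⟩ ⟨C', h1', h2'⟩
        refine ⟨C + C', add_mem h1 h1', fun p v hv => ?_⟩
        rw [dVal_add, ← h2 p v hv, ← h2' p v hv, add_apply]
      smul_mem' := by
        rintro c D ⟨C, h1, h2⟩
        refine ⟨c • C, Submodule.smul_mem _ c h1, fun p v hv => ?_⟩
        rw [dVal_smul, ← h2 p v hv, smul_apply, smul_eq_mul] }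

/-- The quotient `Z / (Z ∩ B)` of two subspaces; it is `Z / B` when `B ⊆ Z`. -/
abbrev Subquotient {K V : Type*} [Field K] [AddCommGroup V] [Module K V]
    (Z B : Submodule K V) : Type _ :=
  Z ⧸ B.comap Z.subtype

/-- The cohomology `H^k_g(SM(1)) = Z^k_g / B^k_g` with coefficients in the trivial module `K`. -/
abbrev Coh (K : Type*) [Field K] (k : ℕ) (g : ℤ) : Type _ :=
  Subquotient (cocycles K k g) (coboundaries K k g)

/-- `W = A ∧ B`: on homogeneous arguments `W` is given by the sum over all ways to distribute the
arguments, in order, to `A` and `B`. The sign is the one of the super skew-symmetric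
rearrangement: `-(-1)^{p(u)p(v)}` for every `v` given to `B` that precedes a `u` given to `A`. -/
def IsWedge {k m : ℕ} (A : Form K k) (B : Form K m) (W : Form K (k + m)) : Prop :=
  ∀ (p : Fin (k + m) → Fin 2) (v : Fin (k + m) → SM K), (∀ l, HasParity (p l) (v l)) →
    W v = ∑ S : {S : Finset (Fin (k + m)) // S.card = k},
      (∏ i ∈ S.1, ∏ j ∈ S.1ᶜ with j < i, -psgn K (p i) (p j)) *
        (A (fun l => v (S.1.orderEmbOfFin S.2 l)) *
          B (fun l => v (S.1ᶜ.orderEmbOfFin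
            (by rw [Finset.card_compl, S.2, Fintype.card_fin, Nat.add_sub_cancel_left]) l)))

/-- The `1`-form dual to the basis element `T X`: the constant term of the coefficient of `T X`
(an element of `SM(1)` has constant coefficient at `T X`). -/
def dualTX (K : Type*) [Field K] : Form K 1 where
  toFun v := PowerSeries.coeff 0 ((v 0).1 1 1)
  map_update_add' := by
    intro _ v i x y
    obtain rfl : i = 0 := Subsingleton.elim _ _
    simp
  map_update_smul' := by
    intro _ v i c x
    obtain rfl : i = 0 := Subsingleton.elim _ _
    simp

/-- A linear expression `y` in the values `C(…)` of a `k`-cochain `C` represents a generator of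
`H^k_g` when, read as a coordinate on cocycles, it induces a linear isomorphism `H^k_g → K`. -/
def IsCoordinate (k : ℕ) (g : ℤ) (y : Form K k → K) : Prop :=
  (∀ (c : K) (C D : Form K k), y (c • C + D) = c * y C + y D) ∧
  (∀ C ∈ coboundaries K k g, y C = 0) ∧
  (∀ C ∈ cocycles K k g, y C = 0 → C ∈ coboundaries K k g) ∧
  ∃ C ∈ cocycles K k g, y C ≠ 0

/-- The three given expressions for `a^3_1`, as functions of the cochain `C`. -/
def a31 (C : Form K 3) : Fin 3 → K :=
  ![C ![bE 1, bE 2, bO 0] - 2 * C ![bTX, bO 1, bO 1],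
    C ![bE 0, bE 1, bO 2] - 2 * C ![bTX, bO 1, bO 1],
    -C ![bE 0, bE 2, bO 1] + 2 * C ![bTX, bO 0, bO 2] + 2 * C ![bTX, bO 1, bO 1]]

/-- The three given expressions for `a^4_2`, as functions of the cochain `C`. -/
def a42 (C : Form K 4) : Fin 3 → K :=
  ![C ![bE 1, bE 2, bO 0, bO 1] - 1 / 6 * C ![bE 1, bE 3, bO 0, bO 0]
      - 4 / 3 * C ![bTX, bO 1, bO 1, bO 1],
    C ![bE 0, bE 1, bO 1, bO 2] - 1 / 6 * C ![bE 1, bE 3, bO 0, bO 0]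
      - 4 / 3 * C ![bTX, bO 1, bO 1, bO 1],
    -(1 / 2) * C ![bE 0, bE 2, bO 1, bO 1] - 1 / 6 * C ![bE 1, bE 3, bO 0, bO 0]
      + 2 * C ![bTX, bO 0, bO 1, bO 2] + 2 / 3 * C ![bTX, bO 1, bO 1, bO 1]]

end OddContact

end

set_option linter.unusedSectionVars false
set_option linter.unusedSimpArgs false

/-! Write `O i` for x^i and `T` for TX. The brackets are [E_i,E_j] = 2(j-i)E_{i+j-1}, [E_i,O_j] =
2(j-i)O_{i+j-1} and [T,O_j] = E_j, the others being zero. A cochain is the same as a skew function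
on words in the labels: every basis element has grade at least -1, so fixed degree and grade leave
only finitely many labels, apart from which the function vanishes, and continuity costs nothing
(`IsCoch.exists_form`). The differential becomes `dw`, defined by Cartan's formula (`isDiff_iff`).

Since E_1 acts diagonally, with eigenvalue twice the weight `wt`, cohomology lives in weight zero.
There one first computes the complex of basic cochains, those of weight zero that are killed by
inserting E_1. Its cohomology has one class for each pair (n, r) with n = 0 or r ≥ 1, in degree n +
r and grade n - r, detected by the value on the word T^r (O 1)^n.

That these values detect everything is `exists_dw_of_normal`. Filter words by `ex`, the number of
letters `O 0` minus the number of `T`. The leading part of the differential comes from the brackets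
[E_{i+1}, O_0], i ≥ 1, and is contracted by a Koszul homotopy: the derivations `delta` and `theta`
exchange E_{i+1} and O_i, and their anticommutator counts such letters (`theta_delta`). What the
homotopy leaves over in weight zero are the words T^r and E_0 E_2 T^r (O 1)^q; the latter are tied
to T^{r+1} (O 1)^{q+1} by one instance of the cocycle identity (`crit_eq_zero`). Conversely, with a
the dual form of `O 1`, t that of `T` and q = 4 E^0 ∧ E^2, one has dq = t ∧ da and q ∧ da = 0, which
makes a^n t + n a^{n-1} q closed (`dw_gen`); its products with powers of t realise all pairs with r
≥ 1.

Passing from basic to all cochains is a Gysin argument for E_1. The Euler class, the differential of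
the form dual to E_1, sends the class (n-1, r-1) to a nonzero multiple of (n, r), because [T, O_1] =
E_1 (`dw_replicate`). This multiplication is injective, so every cocycle is cohomologous to a basic
one (`exists_basic`), and the classes that survive are those outside its image: n = 0, or r = 1 with
n ≥ 2 (`exists_dw_of_not_gen`, `not_exists_dw`). The first family is g = -k, the second g = k - 2.
The pair (1, 1) is the Euler class itself, whence H^2_0 = 0.

In a product of cocycles of positive degrees that lands in grade k + m - 2, one factor lies in a
bidegree without cohomology, so the product is exact. An explicit expression is a coordinate once it
kills coboundaries and is nonzero on a basic generator, where every term containing E_1 drops out.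
-/

namespace SMWord

/-! ### Words in the basis labels, structure constants and the differential of word functions -/

/-- Labels of the topological basis `E_i`, `x^i`, `T X` of `SM(1)`. -/
inductive Idx : Type
  | E (i : ℕ) : Idx
  | O (i : ℕ) : Idx
  | T : Idx
  deriving DecidableEq

open Idx

variable {K : Type*} [Field K]

/-- Parity of a basis element. -/
def par : Idx → ℕ
  | E _ => 0
  | O _ => 1
  | T => 1

/-- The sign `(-1)^{p(a)p(b)}`. -/
def sg (K : Type*) [Field K] (a b : Idx) : K := (-1) ^ (par a * par b)

/-- The basis element to which the bracket of two basis elements is proportional. -/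
def op : Idx → Idx → Idx
  | E i, E j => E (i + j - 1)
  | E i, O j => O (i + j - 1)
  | O i, E j => O (i + j - 1)
  | T, O i => E i
  | O i, T => E i
  -- The bracket is zero here; the label is chosen even so that the parity of `op a b` is the sum of
  -- the two parities for all pairs, which keeps the sign rules free of case distinctions. The same
  -- holds for the last line.
  | O _, O _ => E 0
  | T, E _ => T
  | E _, T => T
  | T, T => E 0

/-- The structure constants: `[a, b] = cs a b • op a b`. -/
def cs (K : Type*) [Field K] : Idx → Idx → K
  | E i, E j => 2 * (j - i)
  | E i, O j => 2 * (j - i)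
  | O i, E j => 2 * (j - i)
  | T, O _ => 1
  | O _, T => 1
  | O _, O _ => 0
  | T, E _ => 0
  | E _, T => 0
  | T, T => 0

/-- Insertion of `a` as first argument. -/
def ins (a : Idx) (F : List Idx → K) : List Idx → K := fun l => F (a :: l)

/-- The derivation of parity `τ` of word functions induced by `a ↦ c a • f a`. -/
def lie (τ : ℕ) (c : Idx → K) (f : Idx → Idx) : (List Idx → K) → List Idx → K
  | _, [] => 0
  | F, a :: l => c a * F (f a :: l) + (-1) ^ (τ * par a) * lie τ c f (ins a F) l

/-- The differential of word functions for the bracket with structure constants `c`. -/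
def dw (c : Idx → Idx → K) : (List Idx → K) → List Idx → K
  | _, [] => 0
  | F, a :: l => -lie (par a) (c a) (op a) F l - dw c (ins a F) l

/-- Super skew-symmetry of word functions. -/
def Skew (F : List Idx → K) : Prop :=
  ∀ l₁ a b l₂, F (l₁ ++ a :: b :: l₂) = -sg K a b * F (l₁ ++ b :: a :: l₂)

theorem ins_apply (a : Idx) (F : List Idx → K) (l) : ins a F l = F (a :: l) := rfl
theorem ins_add (a : Idx) (F G : List Idx → K) : ins a (F + G) = ins a F + ins a G := rfl
theorem ins_sub (a : Idx) (F G : List Idx → K) : ins a (F - G) = ins a F - ins a G := rfl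
theorem ins_smul (a : Idx) (r : K) (F : List Idx → K) : ins a (r • F) = r • ins a F := rfl
theorem ins_zero (a : Idx) : ins a (0 : List Idx → K) = 0 := rfl

section lie
variable (τ : ℕ) (c : Idx → K) (f : Idx → Idx)

theorem lie_nil (F : List Idx → K) : lie τ c f F [] = 0 := rfl
theorem lie_cons (F : List Idx → K) (a l) : lie τ c f F (a :: l) =
    c a * F (f a :: l) + (-1) ^ (τ * par a) * lie τ c f (ins a F) l := rfl

theorem lie_add (F G : List Idx → K) : lie τ c f (F + G) = lie τ c f F + lie τ c f G := by
  funext l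
  induction l generalizing F G with
  | nil => simp [lie_nil]
  | cons a l ih =>
    simp only [lie_cons, ins_add, ih, Pi.add_apply]
    ring

theorem lie_smul (r : K) (F : List Idx → K) : lie τ c f (r • F) = r • lie τ c f F := by
  funext l
  induction l generalizing F with
  | nil => simp [lie_nil]
  | cons a l ih =>
    simp only [lie_cons, ins_smul, ih, Pi.smul_apply, smul_eq_mul]
    ring

theorem lie_neg (F : List Idx → K) : lie τ c f (-F) = -lie τ c f F := by
  simpa using lie_smul τ c f (-1 : K) F

theorem lie_sub (F G : List Idx → K) : lie τ c f (F - G) = lie τ c f F - lie τ c f G := by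
  rw [sub_eq_add_neg, lie_add, lie_neg, sub_eq_add_neg]

theorem ins_lie (a : Idx) (F : List Idx → K) : ins a (lie τ c f F) =
    c a • ins (f a) F + ((-1 : K) ^ (τ * par a)) • lie τ c f (ins a F) := rfl

end lie

section dw
variable (c : Idx → Idx → K)

theorem dw_nil (F : List Idx → K) : dw c F [] = 0 := rfl
theorem dw_cons (F : List Idx → K) (a l) : dw c F (a :: l) =
    -lie (par a) (c a) (op a) F l - dw c (ins a F) l := rfl

theorem ins_dw (a : Idx) (F : List Idx → K) : ins a (dw c F) =
    -lie (par a) (c a) (op a) F - dw c (ins a F) := rfl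

theorem dw_add (F G : List Idx → K) : dw c (F + G) = dw c F + dw c G := by
  funext l
  induction l generalizing F G with
  | nil => simp [dw_nil]
  | cons a l ih =>
    simp only [dw_cons, ins_add, ih, Pi.add_apply, lie_add]
    ring

theorem dw_smul (r : K) (F : List Idx → K) : dw c (r • F) = r • dw c F := by
  funext l
  induction l generalizing F with
  | nil => simp [dw_nil]
  | cons a l ih =>
    simp only [dw_cons, ins_smul, ih, Pi.smul_apply, lie_smul, smul_eq_mul]
    ring

theorem dw_zero : dw c (0 : List Idx → K) = 0 := by
  simpa using dw_smul c (0 : K) 0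

theorem dw_neg (F : List Idx → K) : dw c (-F) = -dw c F := by
  simpa using dw_smul c (-1 : K) F

theorem dw_sub (F G : List Idx → K) : dw c (F - G) = dw c F - dw c G := by
  rw [sub_eq_add_neg, dw_add, dw_neg, sub_eq_add_neg]

end dw

theorem sg_comm (a b : Idx) : sg K a b = sg K b a := by
  simp [sg, mul_comm]

theorem sg_mul_self (a b : Idx) : sg K a b * sg K a b = 1 := by
  simp [sg, ← pow_add, ← two_mul]

theorem sg_op_left (a b x : Idx) : sg K (op a b) x = sg K a x * sg K b x := by
  cases a <;> cases b <;> cases x <;> simp [sg, op, par]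

theorem sg_op_right (a b x : Idx) : sg K x (op a b) = sg K x a * sg K x b := by
  rw [sg_comm, sg_op_left, sg_comm a, sg_comm b]

theorem op_comm (a b : Idx) : op a b = op b a := by
  cases a <;> cases b <;> simp [op, add_comm]

theorem cs_symm (a b : Idx) : cs K b a = -sg K a b * cs K a b := by
  cases a <;> cases b <;> simp [sg, cs, par] <;> ring

/-! ### Skew-symmetry -/

theorem Skew.ins {F : List Idx → K} (hF : Skew F) (a : Idx) : Skew (ins a F) :=
  fun l₁ x y l₂ => hF (a :: l₁) x y l₂

theorem Skew.swap {F : List Idx → K} (hF : Skew F) (a b : Idx) (l) :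
    F (a :: b :: l) = -sg K a b * F (b :: a :: l) := hF [] a b l

theorem Skew.ins_swap {F : List Idx → K} (hF : Skew F) (a b : Idx) :
    SMWord.ins a (SMWord.ins b F) = (-sg K a b) • SMWord.ins b (SMWord.ins a F) := by
  funext l
  simpa [ins_apply, sg_comm] using hF.swap b a l

theorem Skew.add {F G : List Idx → K} (hF : Skew F) (hG : Skew G) : Skew (F + G) :=
  fun l₁ x y l₂ => by simp only [Pi.add_apply, hF l₁ x y l₂, hG l₁ x y l₂]; ring

theorem Skew.smul {F : List Idx → K} (hF : Skew F) (r : K) : Skew (r • F) :=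
  fun l₁ x y l₂ => by simp only [Pi.smul_apply, hF l₁ x y l₂, smul_eq_mul]; ring

theorem Skew.neg {F : List Idx → K} (hF : Skew F) : Skew (-F) := by
  simpa using hF.smul (-1)

theorem Skew.sub {F G : List Idx → K} (hF : Skew F) (hG : Skew G) : Skew (F - G) := by
  simpa [sub_eq_add_neg] using hF.add hG.neg

theorem Skew.zero : Skew (0 : List Idx → K) := fun l₁ x y l₂ => by simp

theorem Skew.perm {F : List Idx → K} (hF : Skew F) {l l' : List Idx} (h : l.Perm l') :
    ∃ u : K, u ≠ 0 ∧ F l = u * F l' := by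
  induction h generalizing F with
  | nil => exact ⟨1, one_ne_zero, by simp⟩
  | cons x _ ih => exact ih (hF.ins x)
  | swap x y l =>
    refine ⟨-sg K y x, ?_, hF.swap y x l⟩
    simp [sg]
  | trans _ _ ih₁ ih₂ =>
    obtain ⟨u, hu, h⟩ := ih₁ hF
    obtain ⟨v, hv, h'⟩ := ih₂ hF
    exact ⟨u * v, mul_ne_zero hu hv, by rw [h, h', mul_assoc]⟩

theorem Skew.eq_zero_of_perm {F : List Idx → K} (hF : Skew F) {l l' : List Idx}
    (h : l.Perm l') (h0 : F l' = 0) : F l = 0 := by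
  obtain ⟨u, -, h⟩ := hF.perm h
  rw [h, h0, mul_zero]

/-- The hypothesis on `f` says that it shifts parity by `τ`, including on letters where `c`
vanishes. -/
theorem Skew.lie {F : List Idx → K} (hF : Skew F) {τ : ℕ} {c : Idx → K} {f : Idx → Idx}
    (hf : ∀ a b, sg K (f a) b = (-1) ^ (τ * par b) * sg K a b) : Skew (lie τ c f F) := by
  intro l₁
  induction l₁ generalizing F with
  | nil =>
    intro a b l
    simp only [List.nil_append, lie_cons, ins_lie, Pi.add_apply, Pi.smul_apply, smul_eq_mul]
    rw [hF.ins_swap b a, lie_smul, ins_apply, ins_apply, hF.swap (f a) b, hF.swap a (f b),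
      sg_comm a (f b), hf, hf, sg_comm b a]
    have h1 : ((-1 : K) ^ (τ * par a)) * (-1) ^ (τ * par a) = 1 := by
      simp [← pow_add, ← two_mul]
    simp only [Pi.smul_apply, smul_eq_mul]
    linear_combination (-sg K a b * c b * F (f b :: a :: l)) * h1
  | cons x l₁ ih =>
    intro a b l
    simp only [List.cons_append, lie_cons]
    rw [ih (hF.ins x), show f x :: (l₁ ++ a :: b :: l) = (f x :: l₁) ++ a :: b :: l from rfl,
      hF]
    simp only [List.cons_append]
    ring

theorem Skew.lie_op {F : List Idx → K} (hF : Skew F) (c : Idx → K) (a : Idx) :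
    Skew (SMWord.lie (par a) c (op a) F) :=
  hF.lie fun x b => by rw [sg_op_left]; rfl

theorem Skew.dw {F : List Idx → K} (hF : Skew F) {c : Idx → Idx → K}
    (hc : ∀ a b, c b a = -sg K a b * c a b) : Skew (dw c F) := by
  intro l₁
  induction l₁ generalizing F with
  | nil =>
    intro a b l
    have h1 := sg_mul_self (K := K) a b
    simp only [List.nil_append, dw_cons, ins_lie, lie_cons, ins_dw, Pi.sub_apply, Pi.neg_apply,
      Pi.add_apply, Pi.smul_apply, smul_eq_mul]
    rw [hF.ins_swap b a, dw_smul, hc a b, op_comm b a, mul_comm (par b) (par a), sg_comm b a]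
    simp only [Pi.smul_apply, smul_eq_mul]
    rw [show (-1 : K) ^ (par a * par b) = sg K a b from rfl]
    linear_combination (-c a b * F (op a b :: l) + SMWord.lie (par b) (c b) (op b) (SMWord.ins a F) l) * (-h1)
  | cons x l₁ ih =>
    intro a b l
    simp only [List.cons_append, dw_cons]
    rw [ih (hF.ins x), hF.lie_op _ _ l₁]
    ring

/-! ### Cartan calculus -/

/-- This is the Jacobi identity for three basis elements, read inside the first argument of `F`. -/
theorem lie_comm_aux (a b x : Idx) (F : List Idx → K) (l : List Idx) :
    cs K a x * cs K b (op a x) * F (op b (op a x) :: l)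
      - sg K a b * (cs K b x * cs K a (op b x) * F (op a (op b x) :: l))
      = -sg K a b * (cs K a b * cs K (op a b) x * F (op (op a b) x :: l)) := by
  have key : ∀ (i j k : ℕ) (G : ℕ → K),
      (2 * ((k : K) - i)) * (2 * (((i + k - 1 : ℕ) : K) - j)) * G (j + (i + k - 1) - 1)
        - (2 * ((k : K) - j)) * (2 * (((j + k - 1 : ℕ) : K) - i)) * G (i + (j + k - 1) - 1)
        = -((2 * ((j : K) - i)) * (2 * ((k : K) - ((i + j - 1 : ℕ) : K)))
          * G (i + j - 1 + k - 1)) := by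
    intro i j k G
    -- Truncated subtraction misbehaves only if two of the indices vanish. The bracket of those two
    -- has coefficient zero, and the other two terms agree as they stand.
    rcases Nat.eq_zero_or_pos (i + k) with h1 | h1
    · obtain ⟨rfl, rfl⟩ : i = 0 ∧ k = 0 := by omega
      simp
    rcases Nat.eq_zero_or_pos (j + k) with h2 | h2
    · obtain ⟨rfl, rfl⟩ : j = 0 ∧ k = 0 := by omega
      simp
    rcases Nat.eq_zero_or_pos (i + j) with h3 | h3
    · obtain ⟨rfl, rfl⟩ : i = 0 ∧ j = 0 := by omega
      simp
    rw [Nat.cast_sub h1, Nat.cast_sub h2, Nat.cast_sub h3,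
      show j + (i + k - 1) - 1 = i + j + k - 2 by omega,
      show i + (j + k - 1) - 1 = i + j + k - 2 by omega,
      show i + j - 1 + k - 1 = i + j + k - 2 by omega]
    push_cast
    ring
  have hE := fun i j k => key i j k fun n => F (E n :: l)
  have hO := fun i j k => key i j k fun n => F (O n :: l)
  rcases a with i | i | _ <;> rcases b with j | j | _ <;> rcases x with k | k | _ <;>
    simp only [cs, op, sg, par]
  all_goals first
    | (simp; done)
    | linear_combination hE i j k
    | linear_combination hO i j k
    | (rw [Nat.add_comm i j]; ring)

/-- When the two operators act on different letters their contributions cancel; when they act on the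
same letter the Jacobi identity `lie_comm_aux` applies. The recursion on the word separates these
cases. -/
theorem lie_comm (a b : Idx) (F : List Idx → K) :
    lie (par a) (cs K a) (op a) (lie (par b) (cs K b) (op b) F)
      - sg K a b • lie (par b) (cs K b) (op b) (lie (par a) (cs K a) (op a) F)
      = (-sg K a b * cs K a b) • lie (par (op a b)) (cs K (op a b)) (op (op a b)) F := by
  funext l
  induction l generalizing F with
  | nil => simp [lie_nil]
  | cons x l ih =>
    have h1 := lie_comm_aux a b x F l
    have h2 := ih (ins x F)
    have e : ∀ y z : Idx, (-1 : K) ^ (par y * par z) = sg K y z := fun _ _ => rfl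
    simp only [lie_cons, ins_lie, Pi.sub_apply, Pi.add_apply, Pi.smul_apply, smul_eq_mul,
      lie_add, lie_smul, e, sg_op_left, sg_op_right] at h2 ⊢
    rw [sg_comm b a]
    have h3 := sg_mul_self (K := K) a b
    linear_combination h1 + sg K a x * sg K b x * h2
      - (cs K b x * sg K a x * lie (par a) (cs K a) (op a) (ins (op b x) F) l) * h3

/-- Expanding both sides by Cartan's formula at the first letter leaves a commutator of two Lie
derivatives, which `lie_comm` evaluates, and the claim for a shorter word. -/
theorem dw_lie (a : Idx) (F : List Idx → K) :
    dw (cs K) (lie (par a) (cs K a) (op a) F) = lie (par a) (cs K a) (op a) (dw (cs K) F) := by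
  funext l
  induction l generalizing F with
  | nil => simp [lie_nil, dw_nil]
  | cons x l ih =>
    have e : ∀ y z : Idx, (-1 : K) ^ (par y * par z) = sg K y z := fun _ _ => rfl
    have h1 := congrFun (lie_comm a x F) l
    have h2 := ih (ins x F)
    have h3 := sg_mul_self (K := K) a x
    simp only [lie_cons, dw_cons, ins_lie, ins_dw, Pi.sub_apply, Pi.add_apply, Pi.smul_apply,
      smul_eq_mul, lie_add, lie_sub, lie_neg, lie_smul, e, dw_add, dw_smul, Pi.neg_apply] at h1 h2 ⊢
    linear_combination sg K a x * h1 - sg K a x * h2 - (cs K a x * lie (par (op a x)) (cs K (op a x)) (op (op a x)) F l) * h3 + (lie (par x) (cs K x) (op x) (lie (par a) (cs K a) (op a) F) l) * h3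

/-- Inserting a letter into d(dF) gives two Lie derivative terms, equal up to sign by `dw_lie`, and
d² of a form with one argument fewer. -/
theorem dw_dw (F : List Idx → K) : dw (cs K) (dw (cs K) F) = 0 := by
  funext l
  induction l generalizing F with
  | nil => rfl
  | cons x l ih =>
    simp only [dw_cons, ins_dw, dw_sub, dw_neg, dw_lie, Pi.sub_apply, Pi.neg_apply, ih]
    simp

end SMWord

namespace SMWord
open Idx
variable {K : Type*} [Field K]

/-! ### Additive statistics of words -/

/-- The additive extension to words of a statistic on letters. -/
def st (φ : Idx → ℤ) (l : List Idx) : ℤ := (l.map φ).sum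

theorem st_nil (φ : Idx → ℤ) : st φ [] = 0 := rfl
theorem st_cons (φ : Idx → ℤ) (a l) : st φ (a :: l) = φ a + st φ l := by simp [st]
theorem st_append (φ : Idx → ℤ) (l l') : st φ (l ++ l') = st φ l + st φ l' := by simp [st]
theorem st_perm (φ : Idx → ℤ) {l l' : List Idx} (h : l.Perm l') : st φ l = st φ l' :=
  (h.map φ).sum_eq
theorem st_replicate (φ : Idx → ℤ) (n a) : st φ (List.replicate n a) = n * φ a := by simp [st]

/-- `F` vanishes on the words with statistic different from `n`. -/
def Supp (φ : Idx → ℤ) (n : ℤ) (F : List Idx → K) : Prop := ∀ l, st φ l ≠ n → F l = 0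

theorem Supp.add {φ : Idx → ℤ} {n : ℤ} {F G : List Idx → K} (hF : Supp φ n F) (hG : Supp φ n G) :
    Supp φ n (F + G) := fun l hl => by simp [hF l hl, hG l hl]
theorem Supp.smul {φ : Idx → ℤ} {n : ℤ} {F : List Idx → K} (hF : Supp φ n F) (r : K) :
    Supp φ n (r • F) := fun l hl => by simp [hF l hl]
theorem Supp.sub {φ : Idx → ℤ} {n : ℤ} {F G : List Idx → K} (hF : Supp φ n F) (hG : Supp φ n G) :
    Supp φ n (F - G) := fun l hl => by simp [hF l hl, hG l hl]
theorem Supp.zero (φ : Idx → ℤ) (n : ℤ) : Supp φ n (0 : List Idx → K) := fun _ _ => rfl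
theorem Supp.ins {φ : Idx → ℤ} {n : ℤ} {F : List Idx → K} (hF : Supp φ n F) (a : Idx) :
    Supp φ (n - φ a) (ins a F) := fun l hl => hF _ (by rw [st_cons]; omega)

theorem lie_eq_zero {τ : ℕ} {c : Idx → K} {f : Idx → Idx} {F : List Idx → K} {l : List Idx}
    (h : ∀ l₁ a l₂, l = l₁ ++ a :: l₂ → c a = 0 ∨ F (l₁ ++ f a :: l₂) = 0) :
    lie τ c f F l = 0 := by
  induction l generalizing F with
  | nil => rfl
  | cons x l ih =>
    rw [lie_cons, ih fun l₁ a l₂ e => h (x :: l₁) a l₂ (by rw [e]; rfl)]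
    rcases h [] x l rfl with h | h
    · simp [h]
    · rw [show F (f x :: l) = 0 from h]; simp

theorem Supp.lie {φ : Idx → ℤ} {n e : ℤ} {F : List Idx → K} (hF : Supp φ n F)
    {τ : ℕ} {c : Idx → K} {f : Idx → Idx} (h : ∀ a, c a ≠ 0 → φ (f a) = φ a + e) :
    Supp φ (n - e) (lie τ c f F) := by
  intro l hl
  refine lie_eq_zero fun l₁ a l₂ e' => or_iff_not_imp_left.mpr fun hc => hF _ ?_
  have := h a hc
  rw [e', st_append, st_cons] at hl
  rw [st_append, st_cons]
  omega

/-- The value of `dw c F` at `l` only involves words in which a pair of letters is replaced by its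
bracket, so the statistic changes by an amount that depends on the pair alone. `R` records the
admissible changes: an equation for a grading, an inequality for a filtration. -/
theorem dw_eq_zero (R : ℤ → Prop) {φ : Idx → ℤ} {c : Idx → Idx → K}
    (hc : ∀ a b, c a b ≠ 0 → R (φ (op a b) - φ a - φ b)) {F : List Idx → K} {l : List Idx}
    (h : ∀ l', R (st φ l' - st φ l) → F l' = 0) : dw c F l = 0 := by
  induction l generalizing F with
  | nil => rfl
  | cons x l ih =>
    rw [dw_cons, ih, lie_eq_zero, neg_zero, sub_zero]
    · intro l₁ a l₂ e
      refine or_iff_not_imp_left.mpr fun hx => h _ ?_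
      have := hc x a hx
      simp only [e, st_append, st_cons]
      convert this using 1
      ring
    · intro l' hl'
      refine h _ ?_
      simp only [st_cons]
      convert hl' using 1
      ring

theorem Supp.dw {φ : Idx → ℤ} {n e : ℤ} {F : List Idx → K} (hF : Supp φ n F)
    {c : Idx → Idx → K} (h : ∀ a b, c a b ≠ 0 → φ (op a b) = φ a + φ b + e) :
    Supp φ (n - e) (dw c F) := by
  intro l hl
  refine dw_eq_zero (fun x => x = e) (φ := φ) (fun a b hab => ?_) fun l' hl' => hF _ ?_
  · rw [h a b hab]; ring
  · omega

theorem lie_mul {τ : ℕ} {c : Idx → K} {f : Idx → Idx} (κ F : List Idx → K) {l : List Idx}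
    (h : ∀ l₁ a l₂, l = l₁ ++ a :: l₂ → c a ≠ 0 → κ (l₁ ++ f a :: l₂) = κ l) :
    lie τ c f (κ * F) l = κ l * lie τ c f F l := by
  induction l generalizing κ F with
  | nil => simp [lie_nil]
  | cons x l ih =>
    have h1 := ih (ins x κ) (ins x F) fun l₁ a l₂ e => h (x :: l₁) a l₂ (by rw [e]; rfl)
    rw [lie_cons, lie_cons, show ins x (κ * F) = ins x κ * ins x F from rfl, h1, ins_apply,
      Pi.mul_apply]
    by_cases hx : c x = 0
    · rw [hx]; ring
    · rw [show κ (f x :: l) = κ (x :: l) from h [] x l rfl hx]; ring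

theorem lie_diag {τ : ℕ} {c : Idx → K} (F : List Idx → K) (l : List Idx)
    {φ : Idx → ℤ} (h : ∀ a, c a = φ a) (hτ : τ = 0) {f : Idx → Idx}
    (hf : ∀ a, c a ≠ 0 → f a = a) : lie τ c f F l = st φ l * F l := by
  subst hτ
  induction l generalizing F with
  | nil => simp [lie_nil, st_nil]
  | cons x l ih =>
    rw [lie_cons, ih, ins_apply, st_cons]
    by_cases hx : c x = 0
    · rw [hx]
      simp [show ((φ x : ℤ) : K) = 0 from (h x).symm.trans hx]
    · rw [hf x hx, h x]; push_cast; simp; ring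

/-- Two odd derivations whose anticommutator is diagonal. -/
theorem lie_anticomm {c₁ c₂ : Idx → K} {f₁ f₂ : Idx → Idx} {φ : Idx → ℤ}
    (h₁ : ∀ a, (-1 : K) ^ par (f₁ a) = -(-1) ^ par a)
    (h₂ : ∀ a, (-1 : K) ^ par (f₂ a) = -(-1) ^ par a)
    (h : ∀ a (G : Idx → K), c₁ a * c₂ (f₁ a) * G (f₂ (f₁ a)) + c₂ a * c₁ (f₂ a) * G (f₁ (f₂ a))
      = φ a * G a) (F : List Idx → K) (l : List Idx) :
    lie 1 c₁ f₁ (lie 1 c₂ f₂ F) l + lie 1 c₂ f₂ (lie 1 c₁ f₁ F) l = st φ l * F l := by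
  induction l generalizing F with
  | nil => simp [lie_nil, st_nil]
  | cons x l ih =>
    have h3 := ih (ins x F)
    have h4 := h x fun y => F (y :: l)
    have h5 : (-1 : K) ^ par x * (-1) ^ par x = 1 := by simp [← pow_add, ← two_mul]
    simp only [lie_cons, ins_lie, lie_add, lie_smul, Pi.add_apply, Pi.smul_apply, smul_eq_mul,
      one_mul, h₁, h₂, st_cons, ins_apply] at h3 h4 ⊢
    push_cast
    linear_combination h3 * ((-1 : K) ^ par x * (-1) ^ par x) + h4 + (st φ l * F (x :: l)) * h5

/-! ### Weight, grade and the defining data of cochains -/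

/-- Half of the eigenvalue of `E_1`. -/
def wt : Idx → ℤ
  | E i => i - 1
  | O i => i - 1
  | T => 0

/-- The grade of a basis element. -/
def gr : Idx → ℤ
  | E i => i - 1
  | O i => i
  | T => -1

theorem wt_op (a b : Idx) (h : cs K a b ≠ 0) : wt (op a b) = wt a + wt b + 0 := by
  rcases a with i | i | _ <;> rcases b with j | j | _ <;> simp [cs, op, wt] at h ⊢
  all_goals
    -- The index `i + j - 1` is truncated only for `i = j = 0`, where the structure constant
    -- vanishes.
    have : i + j ≠ 0 := by
      intro h0
      obtain ⟨rfl, rfl⟩ : i = 0 ∧ j = 0 := by omega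
      simp at h
    omega

theorem gr_op (a b : Idx) (h : cs K a b ≠ 0) : gr (op a b) = gr a + gr b + 0 := by
  rcases a with i | i | _ <;> rcases b with j | j | _ <;> simp [cs, op, gr] at h ⊢
  all_goals try omega
  all_goals
    have : i + j ≠ 0 := by
      intro h0
      obtain ⟨rfl, rfl⟩ : i = 0 ∧ j = 0 := by omega
      simp at h
    omega

theorem st_one (l : List Idx) : st (fun _ => 1) l = l.length := by simp [st]

/-- Word functions of degree `k` and grade `g`. -/
structure IsCoch (k g : ℤ) (F : List Idx → K) : Prop where
  skew : Skew F
  len : Supp (fun _ => 1) k F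
  grade : Supp gr g F

theorem IsCoch.add {k g : ℤ} {F G : List Idx → K} (hF : IsCoch k g F) (hG : IsCoch k g G) :
    IsCoch k g (F + G) :=
  ⟨hF.skew.add hG.skew, hF.len.add hG.len, hF.grade.add hG.grade⟩
theorem IsCoch.sub {k g : ℤ} {F G : List Idx → K} (hF : IsCoch k g F) (hG : IsCoch k g G) :
    IsCoch k g (F - G) :=
  ⟨hF.skew.sub hG.skew, hF.len.sub hG.len, hF.grade.sub hG.grade⟩
theorem IsCoch.smul {k g : ℤ} {F : List Idx → K} (hF : IsCoch k g F) (r : K) :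
    IsCoch k g (r • F) :=
  ⟨hF.skew.smul r, hF.len.smul r, hF.grade.smul r⟩
theorem IsCoch.zero (k g : ℤ) : IsCoch k g (0 : List Idx → K) :=
  ⟨Skew.zero, Supp.zero _ _, Supp.zero _ _⟩
theorem IsCoch.ins {k g : ℤ} {F : List Idx → K} (hF : IsCoch k g F) (a : Idx) :
    IsCoch (k - 1) (g - gr a) (ins a F) :=
  ⟨hF.skew.ins a, hF.len.ins a, hF.grade.ins a⟩
theorem IsCoch.dw {k g : ℤ} {F : List Idx → K} (hF : IsCoch k g F) :
    IsCoch (k + 1) g (dw (cs K) F) := by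
  refine ⟨hF.skew.dw cs_symm, ?_, ?_⟩
  · simpa using hF.len.dw (c := cs K) (e := -1) (by simp)
  · simpa using hF.grade.dw (c := cs K) gr_op

theorem IsCoch.apply_eq_zero {k g : ℤ} {F : List Idx → K} (hF : IsCoch k g F) {l : List Idx}
    (h : (l.length : ℤ) ≠ k) : F l = 0 := hF.len l (by rwa [st_one])

/-- Cochains of weight `0` that vanish when `E_1` is inserted. -/
structure Basic (F : List Idx → K) : Prop where
  weight : Supp wt 0 F
  ins_eq : ins (E 1) F = 0

theorem Basic.add {F G : List Idx → K} (hF : Basic F) (hG : Basic G) : Basic (F + G) :=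
  ⟨hF.weight.add hG.weight, by rw [ins_add, hF.ins_eq, hG.ins_eq, add_zero]⟩
theorem Basic.sub {F G : List Idx → K} (hF : Basic F) (hG : Basic G) : Basic (F - G) :=
  ⟨hF.weight.sub hG.weight, by rw [ins_sub, hF.ins_eq, hG.ins_eq, sub_zero]⟩
theorem Basic.smul {F : List Idx → K} (hF : Basic F) (r : K) : Basic (r • F) :=
  ⟨hF.weight.smul r, by rw [ins_smul, hF.ins_eq, smul_zero]⟩
theorem Basic.zero : Basic (0 : List Idx → K) := ⟨Supp.zero _ _, rfl⟩

theorem lie_E_one (F : List Idx → K) (l : List Idx) :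
    lie (par (E 1)) (cs K (E 1)) (op (E 1)) F l = 2 * st wt l * F l := by
  have h := lie_diag (τ := par (E 1)) (c := cs K (E 1)) F l (φ := fun a => 2 * wt a)
    (f := op (E 1)) (by intro a; cases a <;> simp [cs, wt]) rfl
    (by intro a; cases a <;> simp [op])
  rw [h]
  simp [st, List.sum_map_mul_left]

/-- By Cartan's formula, inserting E_1 into dF gives the Lie derivative along E_1, which vanishes in
weight zero, and the differential of the zero form. -/
theorem Basic.dw {F : List Idx → K} (hF : Basic F) : Basic (dw (cs K) F) := by
  refine ⟨by simpa using hF.weight.dw (c := cs K) wt_op, ?_⟩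
  rw [ins_dw, hF.ins_eq, dw_zero, sub_zero, neg_eq_zero]
  funext l
  rw [lie_E_one]
  by_cases h : st wt l = 0
  · simp [h]
  · simp [hF.weight l h]

theorem Basic.eq_zero_of_mem {F : List Idx → K} (hF : Basic F) (hs : Skew F) {l : List Idx}
    (h : E 1 ∈ l) : F l = 0 :=
  hs.eq_zero_of_perm (List.perm_cons_erase h) (congrFun hF.ins_eq _)

end SMWord

namespace SMWord
open Idx
variable {K : Type*} [Field K]

/-! ### The contracting homotopy -/

/-- The number of `O 0` minus the number of `T`. -/
def ex : Idx → ℤ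
  | O 0 => 1
  | T => -1
  | _ => 0

/-- Counts the letters `O i`, `i ≥ 1`, and `E i`, `i ≥ 2`. -/
def nu : Idx → ℤ
  | O (_ + 1) => 1
  | E (_ + 2) => 1
  | _ => 0

/-- Counts the letters `O 0`. -/
def oz : Idx → ℤ
  | O 0 => 1
  | _ => 0

/-- The part `[E_i, O_0]`, `i ≥ 2`, of the structure constants. -/
def cz (K : Type*) [Field K] : Idx → Idx → K
  | E (i + 2), O 0 => -(2 * (i + 2))
  | O 0, E (i + 2) => 2 * (i + 2)
  | _, _ => 0

/-- Coefficients of `O_i ↦ E_{i+1}`, `i ≥ 1`. -/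
def tc (K : Type*) [Field K] : Idx → K
  | O (i + 1) => (2 * (i + 2))⁻¹
  | _ => 0

/-- The map on letters underlying `O_i ↦ E_{i+1}`. -/
def tf : Idx → Idx
  | O i => E (i + 1)
  -- The coefficient `tc` vanishes on these labels; the values only make the map reverse parity
  -- everywhere, as skewness of `theta` requires.
  | E i => O i
  | T => E 0

/-- The derivation dual to `O_i ↦ E_{i+1}`. -/
def theta (F : List Idx → K) : List Idx → K := lie 1 (tc K) tf F

/-- The derivation given by `E_i ↦ [O_0, E_i]`, `i ≥ 2`. -/
def delta (F : List Idx → K) : List Idx → K := lie (par (O 0)) (cz K (O 0)) (op (O 0)) F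

/-- The contracting homotopy. -/
def hom (F : List Idx → K) : List Idx → K :=
  -- The factor undoes the two numbers met in `dw (hom F)`: the multiplicity of `O 0` in the longer
  -- word, which is one more than `oz` here and enters with a minus sign by `dw_cz_replicate`, and
  -- the eigenvalue `nu` of `theta_delta`. Neither statistic changes under `delta`, so the factor
  -- can be pulled out.
  (fun l => -(((st oz l : K) + 1) * st nu l)⁻¹) * theta (ins (O 0) F)

theorem skew_theta {F : List Idx → K} (hF : Skew F) : Skew (theta F) :=
  hF.lie fun a b => by cases a <;> cases b <;> simp [sg, par, tf]

theorem skew_delta {F : List Idx → K} (hF : Skew F) : Skew (delta F) := hF.lie_op _ _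

theorem skew_mul {F κ : List Idx → K} (hF : Skew F)
    (h : ∀ l l', List.Perm l l' → κ l = κ l') : Skew (κ * F) := by
  intro l₁ a b l₂
  rw [Pi.mul_apply, Pi.mul_apply, hF,
    h (l₁ ++ a :: b :: l₂) (l₁ ++ b :: a :: l₂) ((List.Perm.swap _ _ _).append_left l₁)]
  ring

theorem skew_hom {F : List Idx → K} (hF : Skew F) : Skew (hom F) :=
  skew_mul (skew_theta (hF.ins _)) fun l l' h => by rw [st_perm _ h, st_perm _ h]

theorem theta_supp {φ : Idx → ℤ} {n e : ℤ} {F : List Idx → K} (hF : Supp φ n F)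
    (h : ∀ i, φ (E (i + 2)) = φ (O (i + 1)) + e) : Supp φ (n - e) (theta F) := by
  refine hF.lie fun a ha => ?_
  rcases a with i | i | _
  · simp [tc] at ha
  · rcases i with _ | i
    · simp [tc] at ha
    · exact h i
  · simp [tc] at ha

theorem hom_supp {φ : Idx → ℤ} {n e : ℤ} {F : List Idx → K} (hF : Supp φ n F)
    (h : ∀ i, φ (E (i + 2)) = φ (O (i + 1)) + e) : Supp φ (n - φ (O 0) - e) (hom F) := by
  intro l hl
  rw [hom, Pi.mul_apply, theta_supp (hF.ins (O 0)) h l hl, mul_zero]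

theorem IsCoch.hom {k g : ℤ} {F : List Idx → K} (hF : IsCoch k g F) :
    IsCoch (k - 1) g (hom F) := by
  refine ⟨skew_hom hF.skew, ?_, ?_⟩
  · simpa using hom_supp hF.len (e := 0) (by simp)
  · simpa [gr] using hom_supp hF.grade (e := 0) (by intro i; simp [gr]; ring)

theorem Basic.hom {F : List Idx → K} (hF : Basic F) (hs : Skew F) : Basic (hom F) := by
  refine ⟨?_, ?_⟩
  · simpa [wt] using hom_supp hF.weight (e := 1) (by intro i; simp [wt]; ring)
  · funext l
    rw [ins_apply, SMWord.hom, Pi.mul_apply]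
    refine mul_eq_zero_of_right _ (lie_eq_zero fun l₁ a l₂ e => ?_)
    by_cases ha : a = E 1
    · left; rw [ha]; rfl
    · right
      refine hF.eq_zero_of_mem hs ?_
      have : E 1 ∈ l₁ ++ a :: l₂ := e ▸ List.mem_cons_self
      simp only [List.mem_append, List.mem_cons] at this ⊢
      rcases this with h | h | h
      · exact Or.inr (Or.inl h)
      · exact absurd h.symm ha
      · exact Or.inr (Or.inr (Or.inr h))

/-- On letters the two odd maps are mutually inverse between E_{i+1} and O_i, i ≥ 1, and zero
elsewhere. Hence their anticommutator is the identity on those letters, and on words it counts them.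
-/
theorem theta_delta [CharZero K] (F : List Idx → K) (l : List Idx) :
    delta (theta F) l + theta (delta F) l = st nu l * F l := by
  refine lie_anticomm ?_ ?_ ?_ F l
  · intro a; cases a <;> simp [op, par]
  · intro a; cases a <;> simp [tf, par]
  · intro a G
    have h (i : ℕ) : (2 * ((i : K) + 2)) ≠ 0 := by
      have : ((i + 2 : ℕ) : K) ≠ 0 := Nat.cast_ne_zero.mpr (by omega)
      push_cast at this
      exact mul_ne_zero two_ne_zero this
    rcases a with i | i | _
    · rcases i with _ | _ | i
      · simp [cz, tc, tf, op, nu]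
      · simp [cz, tc, tf, op, nu]
      · simp [cz, tc, tf, op, nu, -mul_inv_rev]
        rw [mul_inv_cancel₀ (h i), one_mul]
    · rcases i with _ | i
      · simp [cz, tc, tf, op, nu]
      · simp [cz, tc, tf, op, nu, -mul_inv_rev]
        rw [inv_mul_cancel₀ (h i), one_mul]
    · simp [cz, tc, tf, op, nu]

theorem lie_add_coeff (τ : ℕ) (c c' : Idx → K) (f : Idx → Idx) (F : List Idx → K) :
    lie τ (c + c') f F = lie τ c f F + lie τ c' f F := by
  funext l
  induction l generalizing F with
  | nil => simp [lie_nil]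
  | cons a l ih =>
    simp only [lie_cons, ih, Pi.add_apply]
    ring

theorem dw_add_coeff (c c' : Idx → Idx → K) (F : List Idx → K) :
    dw (c + c') F = dw c F + dw c' F := by
  funext l
  induction l generalizing F with
  | nil => simp [dw_nil]
  | cons a l ih =>
    simp only [dw_cons, ih, Pi.add_apply, lie_add_coeff]
    ring

/-- The differential does not lower `ex` except through `cz`. -/
theorem dw_eq_dw_cz {F : List Idx → K} {l : List Idx} (h : ∀ l', st ex l ≤ st ex l' → F l' = 0) :
    dw (cs K) F l = dw (cz K) F l := by
  rw [show cs K = cz K + (cs K - cz K) by abel, dw_add_coeff, Pi.add_apply, add_eq_left]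
  refine dw_eq_zero (fun x => 0 ≤ x) (φ := ex) (fun a b hab => ?_) fun l' hl' => h l' (by omega)
  rcases a with (_ | _ | i) | (_ | i) | _ <;> rcases b with (_ | _ | j) | (_ | j) | _ <;>
    simp [cs, cz, op, ex] at hab ⊢
  all_goals first
    | exact hab (by ring)
    | (split <;> simp_all)

theorem cz_eq_zero {a b : Idx} (ha : a ≠ O 0) (hb : b ≠ O 0) : cz K a b = 0 := by
  rcases a with (_ | _ | i) | (_ | i) | _ <;> rcases b with (_ | _ | j) | (_ | j) | _ <;>
    simp [cz] at ha hb ⊢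

theorem dw_cz_of_notMem (F : List Idx → K) {l : List Idx} (h : O 0 ∉ l) : dw (cz K) F l = 0 := by
  induction l generalizing F with
  | nil => rfl
  | cons x l ih =>
    rw [List.mem_cons, not_or] at h
    rw [dw_cons, ih _ h.2, lie_eq_zero, neg_zero, sub_zero]
    intro l₁ a l₂ e
    left
    refine cz_eq_zero (Ne.symm h.1) ?_
    rintro rfl
    exact h.2 (by rw [e]; simp)

/-- Only pairs containing `O 0` contribute. All `a + 1` copies contribute equally, because `delta`
changes sign when it passes an `O 0` and so does the recursion of `dw`. -/
theorem dw_cz_replicate (F : List Idx → K) {l : List Idx} (h : O 0 ∉ l) (a : ℕ) :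
    dw (cz K) F (List.replicate (a + 1) (O 0) ++ l)
      = -((a : K) + 1) * delta F (List.replicate a (O 0) ++ l) := by
  induction a generalizing F with
  | zero =>
    rw [List.replicate_succ, List.cons_append, dw_cons]
    simp [dw_cz_of_notMem _ h, delta]
  | succ a ih =>
    rw [List.replicate_succ, List.cons_append, dw_cons, ih]
    conv_rhs => rw [List.replicate_succ, List.cons_append]
    rw [show ∀ l, lie (par (O 0)) (cz K (O 0)) (op (O 0)) F l = delta F l from fun _ => rfl,
      List.replicate_succ, List.cons_append]
    have : delta F (O 0 :: (List.replicate a (O 0) ++ l))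
        = -delta (ins (O 0) F) (List.replicate a (O 0) ++ l) := by
      rw [delta, lie_cons]
      simp [cz, par, delta]
    rw [this]
    push_cast
    ring

/-- Words may be rearranged so that the letters `O 0` come first. -/
theorem exists_perm_replicate (l : List Idx) (x : Idx) :
    ∃ a l', x ∉ l' ∧ l.Perm (List.replicate a x ++ l') := by
  refine ⟨l.count x, l.filter (· ≠ x), by simp, ?_⟩
  rw [← List.filter_eq]
  have := List.filter_append_perm (fun y => decide (y = x)) l
  refine (this.symm.trans ?_)
  simp [eq_comm]

end SMWord

/-! ### Exactness of the basic complex by the filtration `ex` -/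

namespace SMWord
open Idx
variable {K : Type*} [Field K]

theorem le_st_of_mem {φ : Idx → ℤ} {l : List Idx} (h : ∀ a ∈ l, 0 ≤ φ a) {a : Idx} (ha : a ∈ l) :
    φ a ≤ st φ l := by
  rw [st_perm φ (List.perm_cons_erase ha), st_cons]
  have : 0 ≤ st φ (l.erase a) := List.sum_nonneg fun x hx => by
    obtain ⟨b, hb, rfl⟩ := List.mem_map.mp hx
    exact h b (List.mem_of_mem_erase hb)
  omega

theorem st_nonneg {φ : Idx → ℤ} {l : List Idx} (h : ∀ a ∈ l, 0 ≤ φ a) : 0 ≤ st φ l :=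
  List.sum_nonneg fun x hx => by
    obtain ⟨b, hb, rfl⟩ := List.mem_map.mp hx
    exact h b hb

theorem st_nonpos {φ : Idx → ℤ} {l : List Idx} (h : ∀ a ∈ l, φ a ≤ 0) : st φ l ≤ 0 := by
  induction l with
  | nil => rfl
  | cons a l ih =>
    have := ih fun b hb => h b (by simp [hb])
    have := h a (by simp)
    rw [st_cons]
    omega

theorem nu_nonneg (a : Idx) : 0 ≤ nu a := by
  rcases a with (_ | _ | i) | (_ | i) | _ <;> simp [nu]

theorem dw_eq_zero_of_letters {c : Idx → Idx → K} {F : List Idx → K} {l : List Idx}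
    (h : ∀ a ∈ l, ∀ b ∈ l, c a b ≠ 0 → ∀ l', op a b ∈ l' → F l' = 0) : dw c F l = 0 := by
  induction l generalizing F with
  | nil => rfl
  | cons x l ih =>
    rw [dw_cons, ih, lie_eq_zero, neg_zero, sub_zero]
    · intro l₁ a l₂ e
      refine or_iff_not_imp_left.mpr fun hx => h x (by simp) a (by simp [e]) hx _ (by simp)
    · intro a ha b hb hab l' hl'
      exact h a (by simp [ha]) b (by simp [hb]) hab _ (by simp [hl'])

theorem delta_ins (F : List Idx → K) : delta (ins (O 0) F) = -ins (O 0) (delta F) := by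
  rw [delta, delta, ins_lie]
  simp [cz, par]

theorem theta_ins_eq_zero {F : List Idx → K} {s : ℤ} (h : ∀ l, s < st ex l → F l = 0)
    {l : List Idx} (hl : s ≤ st ex l) : theta (ins (O 0) F) l = 0 := by
  refine lie_eq_zero fun l₁ a l₂ e => ?_
  rcases a with i | (_ | i) | _
  · left; rfl
  · left; rfl
  · right
    refine h _ ?_
    simp only [e, st_append, st_cons, ex, tf] at hl ⊢
    omega
  · left; rfl

theorem hom_eq_zero {F : List Idx → K} {s : ℤ} (h : ∀ l, s < st ex l → F l = 0)
    {l : List Idx} (hl : s ≤ st ex l) : hom F l = 0 := by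
  rw [hom, Pi.mul_apply, theta_ins_eq_zero h hl, mul_zero]

theorem st_oz_of_notMem {l : List Idx} (h : O 0 ∉ l) : st oz l = 0 := by
  have : ∀ a ∈ l, oz a = 0 := by
    intro a ha
    rcases a with i | (_ | i) | _ <;> simp [oz]
    exact h ha
  exact le_antisymm (st_nonpos fun a ha => (this a ha).le) (st_nonneg fun a ha => (this a ha).ge)

variable [CharZero K]

/-- Prepend an `O 0` to the word. At the new level only the leading part of the differential
survives, and by `dw_cz_replicate` it is a nonzero multiple of `delta F`; the cocycle identity makes
it vanish. -/
theorem delta_eq_zero {F : List Idx → K} (hs : Skew F) (hd : dw (cs K) F = 0) {s : ℤ}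
    (h : ∀ l, s < st ex l → F l = 0) {l : List Idx} (hl : st ex l = s) : delta F l = 0 := by
  obtain ⟨a, l', hl', hp⟩ := exists_perm_replicate l (O 0)
  refine (skew_delta hs).eq_zero_of_perm hp ?_
  rw [st_perm ex hp, st_append, st_replicate] at hl
  have h1 := dw_cz_replicate F hl' a
  rw [← dw_eq_dw_cz, hd] at h1
  · have : (a : K) + 1 ≠ 0 := Nat.cast_add_one_ne_zero a
    exact (mul_eq_zero.mp h1.symm).resolve_left (neg_ne_zero.mpr this)
  · intro l'' hl''
    refine h _ ?_
    simp only [st_append, st_replicate, ex] at hl hl''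
    push_cast at hl hl''
    omega

theorem theta_delta_eq_zero {F : List Idx → K} (hs : Skew F) (hd : dw (cs K) F = 0) {s : ℤ}
    (h : ∀ l, s < st ex l → F l = 0) {l : List Idx} (hl : st ex l = s) :
    theta (delta F) l = 0 := by
  refine lie_eq_zero fun l₁ a l₂ e => ?_
  rcases a with i | (_ | i) | _
  · left; rfl
  · left; rfl
  · right
    refine delta_eq_zero hs hd h ?_
    simp only [e, st_append, st_cons, ex, tf] at hl ⊢
    omega
  · left; rfl

/-- At the top level `s` the differential of the homotopy reduces to its leading part, a multiple of
`delta (theta (ins (O 0) F))`. Since `delta F` vanishes there, `theta_delta` turns this into `nu`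
times `F`, and the normalising factor cancels both multiples. -/
theorem dw_hom_replicate {F : List Idx → K} (hs : Skew F) (hd : dw (cs K) F = 0) {s : ℤ}
    (h : ∀ l, s < st ex l → F l = 0) {l : List Idx} (h0 : O 0 ∉ l) {a : ℕ}
    (hl : st ex (List.replicate (a + 1) (O 0) ++ l) = s)
    (hnu : st nu (List.replicate (a + 1) (O 0) ++ l) ≠ 0) :
    dw (cs K) (hom F) (List.replicate (a + 1) (O 0) ++ l)
      = F (List.replicate (a + 1) (O 0) ++ l) := by
  rw [dw_eq_dw_cz fun l' hl' => hom_eq_zero h (hl ▸ hl'), dw_cz_replicate _ h0]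
  set m := List.replicate a (O 0) ++ l with hm
  have hm' : List.replicate (a + 1) (O 0) ++ l = O 0 :: m := by
    rw [List.replicate_succ, List.cons_append]
  rw [hm'] at hl hnu ⊢
  have e1 : delta (hom F) m = -(((a : K) + 1) * st nu m)⁻¹ * delta (theta (ins (O 0) F)) m := by
    rw [hom, delta, lie_mul]
    · rw [hm, st_append, st_replicate, st_oz_of_notMem h0]
      simp [oz, delta]
    · intro l₁ x l₂ e hx
      rw [e]
      rcases x with (_ | _ | i) | (_ | i) | _ <;> simp [cz] at hx
      simp [st_append, st_cons, op, oz, nu]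
  have e2 := theta_delta (ins (O 0) F) m
  rw [delta_ins] at e2
  have e3 : theta (-ins (O 0) (delta F)) m = 0 := by
    refine lie_eq_zero fun l₁ x l₂ e => ?_
    rcases x with i | (_ | i) | _
    · left; rfl
    · left; rfl
    · right
      rw [Pi.neg_apply, ins_apply, delta_eq_zero hs hd h, neg_zero]
      simp only [e, st_append, st_cons, ex, tf] at hl ⊢
      omega
    · left; rfl
  rw [e3, add_zero] at e2
  rw [e1, e2, ins_apply]
  have h1 : (a : K) + 1 ≠ 0 := Nat.cast_add_one_ne_zero a
  have h2 : (st nu m : K) ≠ 0 := by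
    rw [st_cons] at hnu
    simpa [nu] using hnu
  field_simp

/-- Here `theta_delta` has no surviving term: `theta (delta F)` vanishes at the top level by the
cocycle identity, and the outer `delta` finds no letter E_{i+2} to act on. -/
theorem eq_zero_of_notMem {F : List Idx → K} (hs : Skew F) (hd : dw (cs K) F = 0) {s : ℤ}
    (h : ∀ l, s < st ex l → F l = 0) {l : List Idx} (hl : st ex l = s)
    (hnu : st nu l ≠ 0) (hE : ∀ i, E (i + 2) ∉ l) : F l = 0 := by
  have e := theta_delta F l
  rw [theta_delta_eq_zero hs hd h hl, add_zero, delta, lie_eq_zero] at e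
  · have h2 : (st nu l : K) ≠ 0 := by simpa using hnu
    simpa [h2] using e.symm
  · intro l₁ x l₂ e
    left
    rcases x with (_ | _ | i) | (_ | i) | _ <;> try rfl
    exact absurd (by rw [e]; simp) (hE i)

/-- Only [O_2, T] = E_2 contributes. Moving E_2 to the front past a `T` gives a sign that cancels
the one from moving the odd derivation, so all `r` terms are equal. -/
theorem lie_O_two {G : List Idx → K} (hs : Skew G) (r q : ℕ) :
    lie (par (O 2)) (cs K (O 2)) (op (O 2)) G (List.replicate r T ++ List.replicate q (O 1))
      = r * G (E 2 :: (List.replicate (r - 1) T ++ List.replicate q (O 1))) := by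
  induction r generalizing G with
  | zero =>
    rw [lie_eq_zero]
    · simp
    · intro l₁ a l₂ e
      left
      have : a ∈ List.replicate q (O 1) := by
        have : a ∈ l₁ ++ a :: l₂ := by simp
        rw [← e] at this
        simpa using this
      rw [List.eq_of_mem_replicate this]
      rfl
  | succ r ih =>
    rw [List.replicate_succ, List.cons_append, lie_cons, ih (hs.ins T)]
    rcases r with _ | r
    · simp [cs, op]
    · rw [ins_apply, hs.swap]
      simp [cs, op, par, sg, List.replicate_succ]
      ring

/-- The critical words. -/
theorem crit_eq_zero {F : List Idx → K} (hs : Skew F) (hb : Basic F) (hd : dw (cs K) F = 0)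
    {r q : ℕ} (h2 : ∀ l, st ex l = -r → O 0 ∈ l → F l = 0)
    (h3 : F (List.replicate (r + 1) T ++ List.replicate (q + 1) (O 1)) = 0) :
    F (E 0 :: E 2 :: (List.replicate r T ++ List.replicate q (O 1))) = 0 := by
  set w := List.replicate (r + 1) T ++ List.replicate q (O 1) with hw
  have hmem : ∀ a ∈ w, a = T ∨ a = O 1 := by
    intro a ha
    simp only [hw, List.mem_append, List.mem_replicate] at ha
    tauto
  -- In this instance of the cocycle identity, [E_0, O_2] gives T^{r+1} (O 1)^{q+1}, the brackets
  -- [O_2, T] give the wanted word `r + 1` times, [E_0, O_1] creates an `O 0` at level `-r`, and [T,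
  -- O_1] = E_1 is killed by basicness. Note that the first word lies one level lower, which is why
  -- its vanishing must be assumed.
  have h0 := congrFun hd (E 0 :: O 2 :: w)
  rw [dw_cons, dw_cons, lie_cons, hw, lie_O_two (hs.ins _), ← hw,
    dw_eq_zero_of_letters (l := w), lie_eq_zero (l := w)] at h0
  · have h4 : F (op (E 0) (O 2) :: w) = 0 := by
      refine hs.eq_zero_of_perm ?_ h3
      exact List.perm_middle.symm
    rw [h4] at h0
    have : (r : K) + 1 ≠ 0 := Nat.cast_add_one_ne_zero r
    simpa [this, ins_apply] using h0
  · intro l₁ a l₂ e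
    rcases hmem a (by simp [e]) with rfl | rfl
    · left; rfl
    · right
      refine h2 _ ?_ (by simp [op])
      have h5 := congrArg (st ex) e
      rw [hw] at h5
      simp [st_append, st_cons, st_replicate, ex, op] at h5 ⊢
      omega
  · intro a ha b hb' hab l' hl'
    refine hb.eq_zero_of_mem hs (l := E 0 :: O 2 :: l') ?_
    rcases hmem a ha with rfl | rfl <;> rcases hmem b hb' with rfl | rfl <;>
      simp [cs, op] at hab hl' ⊢ <;> exact hl'

theorem Skew.cons_cons_self {F : List Idx → K} (hs : Skew F) (i : ℕ) (l : List Idx) :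
    F (E i :: E i :: l) = 0 := by
  have h := hs.swap (E i) (E i) l
  simp only [sg, par, mul_zero, pow_zero] at h
  have h2 : (2 : K) * F (E i :: E i :: l) = 0 := by linear_combination h
  simpa using h2

theorem exists_perm_replicate_two {l : List Idx} {x y : Idx} (h : ∀ a ∈ l, a = x ∨ a = y) :
    ∃ r q, l.Perm (List.replicate r x ++ List.replicate q y) := by
  obtain ⟨r, l', hl', hp⟩ := exists_perm_replicate l x
  refine ⟨r, l'.length, ?_⟩
  rwa [← List.eq_replicate_of_mem (a := y) (l := l') ?_]
  intro b hb
  rcases h b (hp.mem_iff.mpr (by simp [hb])) with rfl | h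
  · exact absurd hb hl'
  · exact h

/-- The values on which exactness of basic cocycles depends. -/
def Normal (F : List Idx → K) : Prop :=
  ∀ n r, (n = 0 ∨ 1 ≤ r) → F (List.replicate r T ++ List.replicate n (O 1)) = 0

/-- The only nonzero bracket among the letters `T` and `O 1` is E_1, on which basic cochains vanish.
These values are therefore invariants of basic cohomology classes. -/
theorem Basic.dw_apply_replicate {G : List Idx → K} (hs : Skew G) (hb : Basic G) (n r : ℕ) :
    SMWord.dw (cs K) G (List.replicate r T ++ List.replicate n (O 1)) = 0 := by
  refine dw_eq_zero_of_letters fun a ha b hb' hab l' hl' => ?_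
  simp only [List.mem_append, List.mem_replicate] at ha hb'
  rcases ha with ⟨-, rfl⟩ | ⟨-, rfl⟩ <;> rcases hb' with ⟨-, rfl⟩ | ⟨-, rfl⟩ <;>
    simp [cs] at hab <;> exact hb.eq_zero_of_mem hs hl'

/-- Words without `O 0` that are relevant for basic cochains. -/
theorem classify {F : List Idx → K} (hs : Skew F) (hb : Basic F) {l : List Idx}
    (h0 : O 0 ∉ l) (hF : F l ≠ 0) :
    (∃ r q, l.Perm (E 0 :: E 2 :: (List.replicate r T ++ List.replicate q (O 1)))) ∨
      ((∀ i, E (i + 2) ∉ l) ∧ st nu l ≠ 0) ∨ ∃ r, l = List.replicate r T := by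
  have h1 : E 1 ∉ l := fun h => hF (hb.eq_zero_of_mem hs h)
  have hwt : st wt l = 0 := by
    by_contra h
    exact hF (hb.weight l h)
  by_cases hE : ∀ i, E (i + 2) ∉ l
  · right
    rw [or_iff_not_imp_left]
    intro h
    have hnu : st nu l = 0 := by
      by_contra h'
      exact h ⟨hE, h'⟩
    have hlet : ∀ a ∈ l, a = E 0 ∨ a = T := by
      intro a ha
      have h2 : nu a ≤ 0 := hnu ▸ le_st_of_mem (fun b _ => nu_nonneg b) ha
      rcases a with (_ | _ | i) | (_ | i) | _ <;> simp_all [nu]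
    -- `T` has weight 0 and E_0 weight -1, so weight zero leaves no room for E_0.
    have h2 : E 0 ∉ l := by
      intro h2
      have := le_st_of_mem (φ := fun a => -wt a) (l := l) (fun a ha => by
        rcases hlet a ha with rfl | rfl <;> simp [wt]) h2
      have h3 : st (fun a => -wt a) l = -st wt l := by
        simp [st, List.sum_neg, Function.comp_def]
      rw [h3, hwt] at this
      simp [wt] at this
    refine ⟨l.length, List.eq_replicate_of_mem fun a ha => ?_⟩
    rcases hlet a ha with rfl | rfl
    · exact absurd ha h2
    · rfl
  · left
    push Not at hE
    obtain ⟨i, hi⟩ := hE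
    have hp := List.perm_cons_erase hi
    set l₂ := l.erase (E (i + 2))
    have hmem : ∀ a ∈ l₂, a ≠ E 0 → 0 ≤ wt a := by
      intro a ha h2
      have ha' : a ∈ l := hp.mem_iff.mpr (by simp [ha])
      rcases a with (_ | _ | i) | (_ | i) | _ <;> simp_all [wt] <;> omega
    rw [st_perm wt hp, st_cons] at hwt
    -- E_{i+2} has positive weight, and without `O 0` only E_0 can compensate it.
    have h2 : E 0 ∈ l₂ := by
      by_contra h2
      have := st_nonneg (φ := wt) (l := l₂) fun a ha => hmem a ha (by rintro rfl; exact h2 ha)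
      simp [wt] at hwt
      omega
    have hp2 := List.perm_cons_erase h2
    set l₃ := l₂.erase (E 0)
    -- E_0 is even, hence occurs at most once; so the positive weight is exactly 1, which forces `i
    -- = 0` and letters of weight zero elsewhere.
    have h3 : E 0 ∉ l₃ := by
      intro h3
      have hp3 := List.perm_cons_erase h3
      refine hF (hs.eq_zero_of_perm (l' := E 0 :: E 0 :: E (i + 2) :: l₃.erase (E 0)) ?_
        (hs.cons_cons_self 0 _))
      refine hp.trans (((hp2.trans (hp3.cons _)).cons _).trans ?_)
      exact (List.Perm.swap _ _ _).trans ((List.Perm.swap _ _ _).cons _)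
    have hmem3 : ∀ a ∈ l₃, 0 ≤ wt a := fun a ha =>
      hmem a (hp2.mem_iff.mpr (by simp [ha])) (by rintro rfl; exact h3 ha)
    have h4 := st_nonneg hmem3
    rw [st_perm wt hp2, st_cons] at hwt
    simp only [wt] at hwt
    push_cast at hwt
    obtain rfl : i = 0 := by omega
    obtain ⟨r, q, hrq⟩ := exists_perm_replicate_two (l := l₃) (x := T) (y := O 1) (by
      intro a ha
      have h5 := le_st_of_mem hmem3 ha
      have ha' : a ∈ l := hp.mem_iff.mpr (by
        rw [List.mem_cons, hp2.mem_iff]; simp [ha])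
      have h6 : wt a ≤ 0 := by omega
      rcases a with (_ | _ | i) | (_ | _ | i) | _ <;> simp_all [wt] <;> omega)
    exact ⟨r, q, hp.trans (((hp2.trans (hrq.cons _)).cons _).trans (List.Perm.swap _ _ _))⟩

/-- Subtracting the coboundary of the homotopy moves the cocycle one level down in the filtration.
Words with an `O 0` are treated by `dw_hom_replicate`; those without are sorted by `classify` into
critical words, words on which `eq_zero_of_notMem` applies, and powers of `T`. -/
theorem homotopy_step {F : List Idx → K} (hs : Skew F) (hb : Basic F) (hd : dw (cs K) F = 0)
    (hn : Normal F) {s : ℤ} (h : ∀ l, s < st ex l → F l = 0) {l : List Idx}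
    (hl : s - 1 < st ex l) : (F - dw (cs K) (hom F)) l = 0 := by
  have hhs := skew_hom hs
  have hhb := hb.hom hs
  have hdh := hhs.dw (cs_symm (K := K))
  set F' := F - dw (cs K) (hom F) with hF'
  have hs' : Skew F' := hs.sub hdh
  have hb' : Basic F' := hb.sub hhb.dw
  have hd' : dw (cs K) F' = 0 := by rw [hF', dw_sub, hd, dw_dw, sub_zero]
  have hn' : Normal F' := fun n r hnr => by
    rw [hF', Pi.sub_apply, hn n r hnr, hhb.dw_apply_replicate hhs, sub_zero]
  -- The homotopy vanishes from level `s` upwards and the leading part of the differential lowers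
  -- the level by one, so nothing reappears above `s`.
  have hgt : ∀ l, s < st ex l → F' l = 0 := by
    intro l hl
    rw [hF', Pi.sub_apply, h l hl, dw_eq_dw_cz fun l' hl' => hom_eq_zero h (by omega),
      dw_eq_zero (fun x => x = -1) (φ := ex), sub_zero]
    · intro a b hab
      rcases a with (_ | _ | i) | (_ | i) | _ <;> rcases b with (_ | _ | j) | (_ | j) | _ <;>
        simp [cz, op, ex] at hab ⊢
    · intro l' hl'
      exact hom_eq_zero h (by omega)
  have hO : ∀ l, st ex l = s → O 0 ∈ l → F' l = 0 := by
    intro l hl hO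
    obtain ⟨a, l', hl', hp⟩ := exists_perm_replicate l (O 0)
    rcases a with _ | a
    · exact absurd (hp.mem_iff.mp hO) (by simpa using hl')
    refine hs'.eq_zero_of_perm hp ?_
    rw [st_perm ex hp] at hl
    -- If `nu` vanishes, all letters have weight at most 0 and `O 0` has weight -1, so basicness
    -- settles this case.
    by_cases hnu : st nu (List.replicate (a + 1) (O 0) ++ l') = 0
    · refine hb'.weight _ fun hwt => ?_
      rw [st_append, st_replicate] at hnu hwt
      simp only [nu, mul_zero, zero_add] at hnu
      have h2 := st_nonpos (φ := wt) (l := l') (by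
        intro b hb
        have := le_st_of_mem (fun b _ => nu_nonneg b) hb
        rw [hnu] at this
        rcases b with (_ | _ | i) | (_ | i) | _ <;> simp_all [nu, wt])
      simp only [wt] at hwt
      push_cast at hwt
      omega
    · rw [hF', Pi.sub_apply, dw_hom_replicate hs hd h hl' hl hnu, sub_self]
  rcases (show s < st ex l ∨ st ex l = s by omega) with hl | hl
  · exact hgt l hl
  by_cases h0 : O 0 ∈ l
  · exact hO l hl h0
  by_contra hne
  rcases classify hs' hb' h0 hne with ⟨r, q, hp⟩ | ⟨hE, hnu⟩ | ⟨r, rfl⟩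
  · refine hne (hs'.eq_zero_of_perm hp (crit_eq_zero hs' hb' hd' (fun l' h1 h2 => hO l' ?_ h2)
      (hn' _ _ (Or.inr (by omega)))))
    rw [h1, ← hl, st_perm ex hp]
    simp [st_cons, st_append, st_replicate, ex]
  · exact hne (eq_zero_of_notMem hs' hd' hgt hl hnu hE)
  · exact hne (by simpa using hn' 0 r (Or.inl rfl))

theorem neg_length_le_st_ex (l : List Idx) : -(l.length : ℤ) ≤ st ex l ∧ st ex l ≤ l.length := by
  induction l with
  | nil => simp [st]
  | cons a l ih =>
    have : -1 ≤ ex a ∧ ex a ≤ 1 := by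
      rcases a with i | (_ | i) | _ <;> simp [ex]
    rw [st_cons, List.length_cons]
    push_cast
    omega

/-- A basic cocycle with vanishing values on the words `T ^ r (O 1) ^ n` is the coboundary of a
basic cochain. -/
theorem exists_dw_of_normal {k g : ℤ} {F : List Idx → K} (hF : IsCoch k g F) (hb : Basic F)
    (hd : dw (cs K) F = 0) (hn : Normal F) :
    ∃ G, IsCoch (k - 1) g G ∧ Basic G ∧ dw (cs K) G = F := by
  -- The level of a word of length `k` lies between `-k` and `k`, so finitely many steps exhaust the
  -- filtration; `N` counts the levels still to be cleared.
  have key : ∀ (N : ℕ) (F : List Idx → K), IsCoch k g F → Basic F → dw (cs K) F = 0 → Normal F →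
      (∀ l, (N : ℤ) - k - 1 < st ex l → F l = 0) →
      ∃ G, IsCoch (k - 1) g G ∧ Basic G ∧ dw (cs K) G = F := by
    intro N
    induction N with
    | zero =>
      intro F hF _ _ _ h
      refine ⟨0, IsCoch.zero _ _, Basic.zero, ?_⟩
      rw [dw_zero]
      funext l
      by_cases hl : (l.length : ℤ) = k
      · have := (neg_length_le_st_ex l).1
        exact (h l (by push_cast; omega)).symm
      · exact (hF.apply_eq_zero hl).symm
    | succ N ih =>
      intro F hF hb hd hn h
      have hh := hF.hom
      have hhb := hb.hom hF.skew
      obtain ⟨G, hG, hGb, hGd⟩ := ih (F - dw (cs K) (hom F))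
        (hF.sub (by simpa using hh.dw)) (hb.sub hhb.dw) (by rw [dw_sub, hd, dw_dw, sub_zero])
        (fun n r hnr => by
          rw [Pi.sub_apply, hn n r hnr, hhb.dw_apply_replicate hh.skew, sub_zero])
        (fun l hl => homotopy_step hF.skew hb hd hn h (by push_cast; omega))
      exact ⟨G + hom F, hG.add hh, hGb.add hhb, by rw [dw_add, hGd]; abel⟩
  refine key (2 * k + 1).toNat F hF hb hd hn fun l hl => ?_
  by_cases hlk : (l.length : ℤ) = k
  · have := (neg_length_le_st_ex l).2
    omega
  · exact hF.apply_eq_zero hlk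

end SMWord

namespace SMWord
open Idx
variable {K : Type*} [Field K]

/-! ### The exterior product -/

/-- Multiplication by a multiplicative function of the letters. -/
def tw (σ : Idx → K) (F : List Idx → K) : List Idx → K := fun l => (l.map σ).prod * F l

/-- The sign of moving `a` through the arguments of a form. -/
def pass (K : Type*) [Field K] (a : Idx) : Idx → K := fun b => -sg K b a

/-- The exterior product of word functions. -/
def wedge : (List Idx → K) → (List Idx → K) → List Idx → K
  | F, G, [] => F [] * G []
  | F, G, a :: l => wedge (ins a F) G l + wedge (tw (pass K a) F) (ins a G) l

theorem ins_tw (σ : Idx → K) (a : Idx) (F : List Idx → K) :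
    ins a (tw σ F) = σ a • tw σ (ins a F) := by
  funext l
  simp [ins, tw, mul_assoc]
theorem tw_add (σ : Idx → K) (F G : List Idx → K) : tw σ (F + G) = tw σ F + tw σ G := by
  funext l
  simp [tw, mul_add]
theorem tw_smul (σ : Idx → K) (r : K) (F : List Idx → K) : tw σ (r • F) = r • tw σ F := by
  funext l
  simp [tw, mul_left_comm]
theorem tw_tw (σ ρ : Idx → K) (F : List Idx → K) : tw σ (tw ρ F) = tw (σ * ρ) F := by
  funext l
  change _ = (l.map fun i => σ i * ρ i).prod * F l
  rw [List.prod_map_mul, mul_assoc]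
  rfl
theorem tw_comm (σ ρ : Idx → K) (F : List Idx → K) : tw σ (tw ρ F) = tw ρ (tw σ F) := by
  rw [tw_tw, tw_tw, mul_comm]

theorem wedge_cons (F G : List Idx → K) (a l) : wedge F G (a :: l) =
    wedge (ins a F) G l + wedge (tw (pass K a) F) (ins a G) l := rfl
theorem ins_wedge (F G : List Idx → K) (a) : ins a (wedge F G) =
    wedge (ins a F) G + wedge (tw (pass K a) F) (ins a G) := rfl

theorem add_wedge (F F' G : List Idx → K) : wedge (F + F') G = wedge F G + wedge F' G := by
  funext l
  induction l generalizing F F' G with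
  | nil => simp [wedge, add_mul]
  | cons a l ih => simp only [wedge_cons, ins_add, tw_add, ih, Pi.add_apply]; ring
theorem wedge_add (F G G' : List Idx → K) : wedge F (G + G') = wedge F G + wedge F G' := by
  funext l
  induction l generalizing F G G' with
  | nil => simp [wedge, mul_add]
  | cons a l ih => simp only [wedge_cons, ins_add, ih, Pi.add_apply]; ring
theorem smul_wedge (r : K) (F G : List Idx → K) : wedge (r • F) G = r • wedge F G := by
  funext l
  induction l generalizing F G with
  | nil => simp [wedge, mul_assoc]
  | cons a l ih =>
    simp only [wedge_cons, ins_smul, tw_smul, ih, Pi.smul_apply, smul_eq_mul]; ring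
theorem wedge_smul (r : K) (F G : List Idx → K) : wedge F (r • G) = r • wedge F G := by
  funext l
  induction l generalizing F G with
  | nil => simp [wedge, mul_left_comm]
  | cons a l ih => simp only [wedge_cons, ins_smul, ih, Pi.smul_apply, smul_eq_mul]; ring
theorem neg_wedge (F G : List Idx → K) : wedge (-F) G = -wedge F G := by
  simpa using smul_wedge (-1) F G
theorem wedge_neg (F G : List Idx → K) : wedge F (-G) = -wedge F G := by
  simpa using wedge_smul (-1) F G
theorem sub_wedge (F F' G : List Idx → K) : wedge (F - F') G = wedge F G - wedge F' G := by
  rw [sub_eq_add_neg, add_wedge, neg_wedge, sub_eq_add_neg]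
theorem wedge_sub (F G G' : List Idx → K) : wedge F (G - G') = wedge F G - wedge F G' := by
  rw [sub_eq_add_neg, wedge_add, wedge_neg, sub_eq_add_neg]
theorem zero_wedge (G : List Idx → K) : wedge 0 G = 0 := by simpa using smul_wedge 0 0 G
theorem wedge_zero (F : List Idx → K) : wedge F 0 = 0 := by simpa using wedge_smul 0 F 0

theorem tw_wedge (σ : Idx → K) (F G : List Idx → K) :
    tw σ (wedge F G) = wedge (tw σ F) (tw σ G) := by
  funext l
  induction l generalizing F G with
  | nil => simp [wedge, tw]
  | cons a l ih =>
    have h := ih (ins a F) G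
    have h' := ih (tw (pass K a) F) (ins a G)
    rw [wedge_cons, ins_tw, ins_tw, smul_wedge, wedge_smul, tw_comm, Pi.smul_apply,
      Pi.smul_apply, ← h, ← h']
    simp [tw, wedge_cons]
    ring

theorem wedge_assoc (F G H : List Idx → K) : wedge (wedge F G) H = wedge F (wedge G H) := by
  funext l
  induction l generalizing F G H with
  | nil => simp [wedge, mul_assoc]
  | cons a l ih =>
    simp only [wedge_cons, ins_wedge, add_wedge, wedge_add, tw_wedge, ih, Pi.add_apply, add_assoc]

theorem Supp.tw {φ : Idx → ℤ} {n : ℤ} {F : List Idx → K} (hF : Supp φ n F) (σ : Idx → K) :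
    Supp φ n (tw σ F) := fun l hl => by rw [SMWord.tw, hF l hl, mul_zero]

theorem Supp.wedge {φ : Idx → ℤ} {m n : ℤ} {F G : List Idx → K} (hF : Supp φ m F)
    (hG : Supp φ n G) : Supp φ (m + n) (wedge F G) := by
  intro l
  induction l generalizing F G m n with
  | nil =>
    intro hl
    rw [SMWord.wedge]
    by_cases h : st φ [] = m
    · rw [hG [] (by rw [st_nil] at *; omega), mul_zero]
    · rw [hF [] h, zero_mul]
  | cons a l ih =>
    intro hl
    rw [st_cons] at hl
    rw [wedge_cons, ih (hF.ins a) hG (by omega), ih (hF.tw _) (hG.ins a) (by omega), add_zero]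

theorem Skew.tw {F : List Idx → K} (hF : Skew F) (σ : Idx → K) : Skew (tw σ F) := by
  have : SMWord.tw σ F = (fun l => (l.map σ).prod) * F := rfl
  rw [this]
  exact skew_mul hF fun l l' h => (h.map σ).prod_eq

theorem Skew.wedge {F G : List Idx → K} (hF : Skew F) (hG : Skew G) : Skew (wedge F G) := by
  intro l₁
  induction l₁ generalizing F G with
  | nil =>
    intro a b l
    have h3 := sg_mul_self (K := K) a b
    simp only [List.nil_append, wedge_cons, ins_wedge, ins_tw, smul_wedge, Pi.add_apply,
      Pi.smul_apply, smul_eq_mul]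
    rw [hF.ins_swap b a, hG.ins_swap b a, smul_wedge, wedge_smul, tw_comm (pass K b)]
    simp only [pass, Pi.smul_apply, smul_eq_mul, sg_comm b a]
    linear_combination (-SMWord.wedge (SMWord.tw (pass K b) (SMWord.ins a F)) (SMWord.ins b G) l) * h3
  | cons x l₁ ih =>
    intro a b l
    simp only [List.cons_append, wedge_cons]
    rw [ih (hF.ins x) hG, ih (hF.tw _) (hG.ins x)]
    ring

theorem lie_tw {τ : ℕ} {c : Idx → K} {f : Idx → Idx} {σ : Idx → K} {ρ : K}
    (h : ∀ b, σ (f b) = ρ * σ b) (F : List Idx → K) :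
    lie τ c f (tw σ F) = ρ • tw σ (lie τ c f F) := by
  funext l
  induction l generalizing F with
  | nil => simp [lie_nil, tw]
  | cons a l ih =>
    simp only [lie_cons, ins_tw, lie_smul, ih, Pi.smul_apply, smul_eq_mul]
    simp only [tw, lie_cons, List.map_cons, List.prod_cons, h]
    ring

/-- For the twist by `pass K a` the factor `ρ` is -1: a bracket replaces two letters by one, while
the parity signs multiply. -/
theorem dw_tw {c : Idx → Idx → K} {σ : Idx → K} {ρ : K}
    (h : ∀ b b', σ (op b b') = ρ * (σ b * σ b')) (F : List Idx → K) :
    dw c (tw σ F) = ρ • tw σ (dw c F) := by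
  funext l
  induction l generalizing F with
  | nil => simp [dw_nil, tw]
  | cons a l ih =>
    rw [dw_cons, lie_tw (ρ := ρ * σ a) (fun b => by rw [h]; ring), ins_tw, dw_smul,
      Pi.smul_apply, Pi.smul_apply, ih]
    simp [tw, dw_cons]
    ring

theorem lie_wedge {τ : ℕ} {c : Idx → K} {f : Idx → Idx}
    (h : ∀ a b, sg K (f a) b = (-1) ^ (τ * par b) * sg K a b) (F G : List Idx → K) :
    lie τ c f (wedge F G) =
      wedge (lie τ c f F) G + wedge (tw (fun b => (-1) ^ (τ * par b)) F) (lie τ c f G) := by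
  funext l
  induction l generalizing F G with
  | nil => simp [lie_nil, wedge]
  | cons a l ih =>
    have h1 : tw (pass K (f a)) F = tw (fun b => (-1) ^ (τ * par b)) (tw (pass K a) F) := by
      rw [tw_tw]
      congr 1
      funext b
      simp [pass, sg_comm b, h]
    have h2 : lie τ c f (tw (pass K a) F)
        = ((-1 : K) ^ (τ * par a)) • tw (pass K a) (lie τ c f F) :=
      lie_tw (fun b => by simp [pass, h]) F
    have h3 := ih (ins a F) G
    have h4 := ih (tw (pass K a) F) (ins a G)
    have h5 : ((-1 : K) ^ (τ * par a)) * (-1) ^ (τ * par a) = 1 := by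
      simp [← pow_add, ← two_mul]
    rw [Pi.add_apply] at h3 h4 ⊢
    rw [lie_cons, wedge_cons, ins_wedge, lie_add, Pi.add_apply, h3, h4, wedge_cons, wedge_cons,
      ins_lie, ins_lie, ins_tw, add_wedge, wedge_add, h1, h2]
    simp only [smul_wedge, wedge_smul, Pi.add_apply, Pi.smul_apply, smul_eq_mul,
      tw_comm (pass K a)]
    linear_combination (wedge (tw (pass K a) (lie τ c f F)) (ins a G) l) * h5

/-- The Leibniz rule: the twist by the constant -1 on `F` is the sign (-1)^{deg F}. By induction it
follows from the Leibniz rule `lie_wedge` for Lie derivatives and Cartan's formula. -/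
theorem dw_wedge (c : Idx → Idx → K) (F G : List Idx → K) :
    dw c (wedge F G) = wedge (dw c F) G + wedge (tw (fun _ => -1) F) (dw c G) := by
  funext l
  induction l generalizing F G with
  | nil => simp [dw_nil, wedge]
  | cons a l ih =>
    have h1 : tw (fun b => (-1 : K) ^ (par a * par b)) F
        = tw (pass K a) (tw (fun _ => -1) F) := by
      rw [tw_tw]
      congr 1
      funext b
      simp [pass, sg, mul_comm]
    have h2 : dw c (tw (pass K a) F) = (-1 : K) • tw (pass K a) (dw c F) :=
      dw_tw (fun b b' => by simp [pass, sg_op_left]) F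
    have h3 := ih (ins a F) G
    have h4 := ih (tw (pass K a) F) (ins a G)
    rw [Pi.add_apply] at h3 h4 ⊢
    rw [dw_cons, ins_wedge, dw_add, Pi.add_apply, h3, h4,
      lie_wedge (fun x b => by rw [sg_op_left]; rfl), wedge_cons, wedge_cons, ins_dw, ins_dw,
      ins_tw, h1, h2]
    simp only [smul_wedge, wedge_smul, Pi.add_apply, Pi.smul_apply, smul_eq_mul, sub_wedge,
      wedge_sub, neg_wedge, wedge_neg, Pi.sub_apply, Pi.neg_apply, tw_comm (pass K a)]
    ring

theorem IsCoch.tw {k g : ℤ} {F : List Idx → K} (hF : IsCoch k g F) (σ : Idx → K) :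
    IsCoch k g (tw σ F) := ⟨hF.skew.tw σ, hF.len.tw σ, hF.grade.tw σ⟩

theorem IsCoch.wedge {k g m h : ℤ} {F G : List Idx → K} (hF : IsCoch k g F) (hG : IsCoch m h G) :
    IsCoch (k + m) (g + h) (wedge F G) :=
  ⟨hF.skew.wedge hG.skew, hF.len.wedge hG.len, hF.grade.wedge hG.grade⟩

/-! ### The unit and the dual basis -/

/-- The unit of the exterior product. -/
def one : List Idx → K
  | [] => 1
  | _ :: _ => 0

/-- The `1`-form dual to a basis element. -/
def cov (a : Idx) : List Idx → K
  | [b] => if b = a then 1 else 0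
  | _ => 0

theorem ins_one (a : Idx) : ins a (one : List Idx → K) = 0 := rfl
theorem ins_cov_self (a : Idx) : ins a (cov a) = (one : List Idx → K) := by
  funext l
  cases l <;> simp [ins, cov, one]
theorem ins_cov_ne {a b : Idx} (h : b ≠ a) : ins b (cov a) = (0 : List Idx → K) := by
  funext l
  cases l <;> simp [ins, cov, h]
theorem tw_one (σ : Idx → K) : tw σ one = one := by
  funext l
  cases l <;> simp [tw, one]
theorem tw_cov (σ : Idx → K) (a : Idx) : tw σ (cov a) = σ a • cov a := by
  funext l
  rcases l with _ | ⟨b, _ | ⟨c, l⟩⟩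
  · simp [tw, cov]
  · by_cases h : b = a
    · simp [tw, cov, h]
    · simp [tw, cov, h]
  · simp [tw, cov]

theorem one_wedge (G : List Idx → K) : wedge one G = G := by
  funext l
  induction l generalizing G with
  | nil => simp [wedge, one]
  | cons a l ih => rw [wedge_cons, ins_one, zero_wedge, tw_one, ih]; simp [ins]

theorem wedge_one (F : List Idx → K) : wedge F one = F := by
  funext l
  induction l generalizing F with
  | nil => simp [wedge, one]
  | cons a l ih => rw [wedge_cons, ins_one, wedge_zero, ih]; simp [ins]

theorem wedge_cov (F : List Idx → K) (a : Idx) :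
    wedge F (cov a) = wedge (cov a) (tw (pass K a) F) := by
  funext l
  induction l generalizing F with
  | nil => simp [wedge, cov]
  | cons b l ih =>
    rw [wedge_cons, wedge_cons, ih, ins_tw, tw_cov, smul_wedge, wedge_smul]
    have h3 := sg_mul_self (K := K) a b
    by_cases h : b = a
    · subst h
      rw [ins_cov_self, one_wedge, wedge_one]
      simp only [Pi.smul_apply, smul_eq_mul, pass]
      linear_combination (-wedge (cov b) (tw (pass K b) (ins b F)) l) * h3
    · rw [ins_cov_ne h, zero_wedge, wedge_zero]
      simp only [Pi.smul_apply, smul_eq_mul, pass, sg_comm b a, Pi.zero_apply]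
      linear_combination (-wedge (cov a) (tw (pass K a) (ins b F)) l) * h3

theorem cov_wedge_cov (a b : Idx) :
    wedge (cov a : List Idx → K) (cov b) = (-sg K a b) • wedge (cov b) (cov a) := by
  rw [wedge_cov, tw_cov, wedge_smul]
  rfl

theorem cov_wedge_cov_wedge (a b : Idx) (F : List Idx → K) :
    wedge (cov a) (wedge (cov b) F) = (-sg K a b) • wedge (cov b) (wedge (cov a) F) := by
  rw [← wedge_assoc, cov_wedge_cov, smul_wedge, wedge_assoc]

theorem cov_wedge_of_notMem {a : Idx} (F : List Idx → K) {l : List Idx} (h : a ∉ l) :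
    wedge (cov a) F l = 0 := by
  induction l generalizing F with
  | nil => simp [wedge, cov]
  | cons b l ih =>
    rw [List.mem_cons, not_or] at h
    rw [wedge_cons, ins_cov_ne (Ne.symm h.1), zero_wedge, tw_cov, smul_wedge, Pi.smul_apply,
      ih _ h.2]
    simp

theorem skew_cov (a : Idx) : Skew (cov a : List Idx → K) := by
  intro l₁ x y l₂
  rcases l₁ with _ | ⟨b, _ | ⟨c, l⟩⟩ <;> simp [cov]

theorem supp_cov (φ : Idx → ℤ) (a : Idx) : Supp φ (φ a) (cov a : List Idx → K) := by
  intro l hl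
  rcases l with _ | ⟨b, _ | ⟨c, l⟩⟩
  · rfl
  · by_cases h : b = a
    · subst h
      simp [st_cons, st_nil] at hl
    · simp [cov, h]
  · rfl

theorem supp_one (φ : Idx → ℤ) : Supp φ 0 (one : List Idx → K) := by
  intro l hl
  cases l
  · simp [st_nil] at hl
  · rfl

theorem isCoch_cov (a : Idx) : IsCoch 1 (gr a) (cov a : List Idx → K) :=
  ⟨skew_cov a, supp_cov _ a, supp_cov _ a⟩

theorem isCoch_one : IsCoch 0 0 (one : List Idx → K) :=
  ⟨fun l₁ x y l₂ => by cases l₁ <;> simp [one], supp_one _, supp_one _⟩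

end SMWord

namespace SMWord
open Idx
variable {K : Type*} [Field K]

/-! ### The explicit cocycles -/

theorem supp_two_ext {F G : List Idx → K} (hF : Supp (fun _ => 1) 2 F)
    (hG : Supp (fun _ => 1) 2 G) (h : ∀ x y, F [x, y] = G [x, y]) : F = G := by
  funext l
  by_cases hl : st (fun _ => 1) l = 2
  · rw [st_one] at hl
    obtain ⟨x, y, rfl⟩ := List.length_eq_two.mp (by exact_mod_cast hl)
    exact h x y
  · rw [hF l hl, hG l hl]

theorem supp_dw_cov (a : Idx) : Supp (fun _ => 1) 2 (dw (cs K) (cov a)) :=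
  (isCoch_cov a).dw.len

theorem supp_cov_wedge_cov (a b : Idx) :
    Supp (fun _ => 1) 2 (wedge (cov a) (cov b) : List Idx → K) :=
  ((isCoch_cov a).wedge (isCoch_cov b)).len

theorem dw_cov_apply (a x y : Idx) :
    dw (cs K) (cov a) [x, y] = -(cs K x y * if op x y = a then 1 else 0) := by
  simp [dw, lie, cov, ins]

theorem cov_wedge_cov_apply (a b x y : Idx) : wedge (cov a) (cov b) [x, y] =
    (if x = a then if y = b then 1 else 0 else 0)
      - (if y = a then if x = b then (sg K a b) else 0 else 0 : K) := by
  by_cases h1 : x = a <;> by_cases h2 : y = b <;> by_cases h3 : y = a <;> by_cases h4 : x = b <;>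
    simp_all [wedge, cov, ins, tw, pass, sub_eq_add_neg]

theorem dw_cov_T : dw (cs K) (cov T) = 0 := by
  refine supp_two_ext (supp_dw_cov _) (Supp.zero _ _) fun x y => ?_
  rw [dw_cov_apply]
  rcases x with i | i | _ <;> rcases y with j | j | _ <;> simp [cs, op]

theorem dw_cov_O_one : dw (cs K) (cov (O 1)) =
    (-4 : K) • wedge (cov (E 0)) (cov (O 2)) + (4 : K) • wedge (cov (E 2)) (cov (O 0)) := by
  refine supp_two_ext (supp_dw_cov _)
    (((supp_cov_wedge_cov _ _).smul _).add ((supp_cov_wedge_cov _ _).smul _)) fun x y => ?_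
  simp only [dw_cov_apply, Pi.add_apply, Pi.smul_apply, cov_wedge_cov_apply, smul_eq_mul]
  rcases x with (_ | _ | _ | i) | (_ | _ | _ | i) | _ <;>
    rcases y with (_ | _ | _ | j) | (_ | _ | _ | j) | _ <;>
    simp [cs, op, sg, par] <;> norm_num <;> intros <;> omega

theorem dw_cov_E_zero : dw (cs K) (cov (E 0)) =
    (-1 : K) • wedge (cov T) (cov (O 0)) + (-2 : K) • wedge (cov (E 0)) (cov (E 1)) := by
  refine supp_two_ext (supp_dw_cov _)
    (((supp_cov_wedge_cov _ _).smul _).add ((supp_cov_wedge_cov _ _).smul _)) fun x y => ?_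
  simp only [dw_cov_apply, Pi.add_apply, Pi.smul_apply, cov_wedge_cov_apply, smul_eq_mul]
  rcases x with (_ | _ | i) | (_ | i) | _ <;>
    rcases y with (_ | _ | j) | (_ | j) | _ <;>
    simp [cs, op, sg, par]

theorem dw_cov_E_two : dw (cs K) (cov (E 2)) =
    (-1 : K) • wedge (cov T) (cov (O 2)) + (-6 : K) • wedge (cov (E 0)) (cov (E 3))
      + (-2 : K) • wedge (cov (E 1)) (cov (E 2)) := by
  refine supp_two_ext (supp_dw_cov _)
    ((((supp_cov_wedge_cov _ _).smul _).add ((supp_cov_wedge_cov _ _).smul _)).add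
      ((supp_cov_wedge_cov _ _).smul _)) fun x y => ?_
  simp only [dw_cov_apply, Pi.add_apply, Pi.smul_apply, cov_wedge_cov_apply, smul_eq_mul]
  rcases x with (_ | _ | _ | _ | i) | (_ | _ | _ | i) | _ <;>
    rcases y with (_ | _ | _ | _ | j) | (_ | _ | _ | j) | _ <;>
    simp [cs, op, sg, par] <;> norm_num <;> intros <;> omega

/-- Powers of the `1`-form dual to `O 1`. -/
def oPow (K : Type*) [Field K] : ℕ → List Idx → K
  | 0 => one
  | n + 1 => wedge (cov (O 1)) (oPow K n)

/-- The `2`-form dual to `E_0 ∧ E_2`, up to a factor. -/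
def qForm (K : Type*) [Field K] : List Idx → K := (4 : K) • wedge (cov (E 0)) (cov (E 2))

/-- A representative of the generator in degree `n + 1` and grade `n - 1`, `n ≥ 2`. -/
def gen (K : Type*) [Field K] : ℕ → List Idx → K
  | 0 => cov T
  | n + 1 => wedge (cov (O 1)) (gen K n) + wedge (qForm K) (oPow K n)

theorem qForm_wedge (F : List Idx → K) : wedge (qForm K) F
    = (4 : K) • wedge (cov (E 0)) (wedge (cov (E 2)) F) := by
  rw [qForm, smul_wedge, wedge_assoc]

theorem cov_E_wedge_self (i : ℕ) (F : List Idx → K) :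
    wedge (cov (E i)) (wedge (cov (E i)) F) = 0 ∨ (2 : K) = 0 := by
  have h := cov_wedge_cov_wedge (E i) (E i) F
  simp only [sg, par, mul_zero, pow_zero, neg_smul, one_smul] at h
  by_cases h2 : (2 : K) = 0
  · exact Or.inr h2
  · left
    have h3 : (2 : K) • wedge (cov (E i)) (wedge (cov (E i)) F) = 0 := by
      rw [two_smul]
      nth_rewrite 2 [h]
      exact add_neg_cancel _
    simpa [h2] using h3

theorem dw_cov_wedge (a : Idx) (F : List Idx → K) : dw (cs K) (wedge (cov a) F)
    = wedge (dw (cs K) (cov a)) F - wedge (cov a) (dw (cs K) F) := by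
  rw [dw_wedge, tw_cov, smul_wedge, neg_one_smul, sub_eq_add_neg]

variable [CharZero K]

theorem cov_E_wedge_cov_E (i : ℕ) (F : List Idx → K) :
    wedge (cov (E i)) (wedge (cov (E i)) F) = 0 :=
  (cov_E_wedge_self i F).resolve_right two_ne_zero

/-- The terms with E^1 cancel between the two differentials and the term with E^3 contains E^0
twice. What remains is t ∧ da, for t dual to `T` and a dual to `O 1`. -/
theorem dw_qForm : dw (cs K) (qForm K) = wedge (cov T) (dw (cs K) (cov (O 1))) := by
  have h1 := cov_wedge_cov_wedge (K := K) (E 0) T (cov (O 2))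
  have h2 := cov_wedge_cov (K := K) (O 0) (E 2)
  have h3 := cov_E_wedge_cov_E (K := K) 0 (cov (E 3))
  simp only [sg, par, mul_zero, zero_mul, pow_zero] at h1 h2
  rw [qForm, dw_smul, dw_cov_wedge, dw_cov_E_zero, dw_cov_E_two, dw_cov_O_one]
  simp only [add_wedge, wedge_add, smul_wedge, wedge_smul, wedge_assoc, h1, h2, h3]
  module

/-- Both terms of the differential of the form dual to `O 1` contain E^0 or E^2, and squares of
these forms vanish. The same reason gives `qForm_wedge_dw_O_one`. -/
theorem dw_O_one_wedge_qForm (F : List Idx → K) :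
    wedge (dw (cs K) (cov (O 1))) (wedge (qForm K) F) = 0 := by
  have h1 := cov_wedge_cov_wedge (K := K) (O 2) (E 0)
  have h2 := cov_wedge_cov_wedge (K := K) (O 0) (E 0)
  have h3 := cov_wedge_cov_wedge (K := K) (O 0) (E 2)
  have h4 := cov_wedge_cov_wedge (K := K) (E 2) (E 0)
  simp only [dw_cov_O_one, qForm_wedge, add_wedge, smul_wedge, wedge_smul, wedge_assoc, h1, h2, h3,
    h4, cov_E_wedge_cov_E, smul_zero, add_zero, wedge_zero]

theorem qForm_wedge_dw_O_one (F : List Idx → K) :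
    wedge (qForm K) (wedge (dw (cs K) (cov (O 1))) F) = 0 := by
  have h4 := cov_wedge_cov_wedge (K := K) (E 2) (E 0)
  simp only [dw_cov_O_one, qForm_wedge, add_wedge, wedge_add, smul_wedge, wedge_smul, wedge_assoc,
    h4, cov_E_wedge_cov_E, smul_zero, add_zero]
  simp [wedge_zero]

theorem qForm_wedge_O_one (F : List Idx → K) :
    wedge (qForm K) (wedge (cov (O 1)) F) = wedge (cov (O 1)) (wedge (qForm K) F) := by
  have h1 := cov_wedge_cov_wedge (K := K) (E 0) (O 1)
  have h2 := cov_wedge_cov_wedge (K := K) (E 2) (O 1)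
  simp only [sg, par, mul_zero, zero_mul, pow_zero] at h1 h2
  simp only [qForm_wedge, h1, h2, wedge_smul]
  module

theorem dw_O_one_wedge_odd {a : Idx} (ha : par a = 1) (F : List Idx → K) :
    wedge (dw (cs K) (cov (O 1))) (wedge (cov a) F)
      = -wedge (cov a) (wedge (dw (cs K) (cov (O 1))) F) := by
  have h1 := fun i => cov_wedge_cov_wedge (K := K) (O i) a
  have h2 := fun i => cov_wedge_cov_wedge (K := K) (E i) a
  have h3 : ∀ i, sg K (O i) a = -1 := fun i => by simp [sg, ha, show par (O i) = 1 from rfl]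
  have h4 : ∀ i, sg K (E i) a = 1 := fun i => by simp [sg, show par (E i) = 0 from rfl]
  simp only [h3, h4] at h1 h2
  simp only [dw_cov_O_one, add_wedge, wedge_add, smul_wedge, wedge_smul, wedge_assoc, h1, h2]
  module

theorem qForm_wedge_dw_oPow (n : ℕ) : wedge (qForm K) (dw (cs K) (oPow K n)) = 0 := by
  induction n with
  | zero =>
    rw [oPow, show dw (cs K) one = 0 from by
      funext l
      by_cases hl : st (fun _ => 1) l = 0 + 1
      · rw [st_one] at hl
        obtain ⟨x, rfl⟩ := List.length_eq_one_iff.mp (by exact_mod_cast hl)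
        simp [dw, lie]
      · exact isCoch_one.dw.len l hl, wedge_zero]
  | succ n ih =>
    rw [oPow, dw_cov_wedge, wedge_sub, qForm_wedge_dw_O_one, qForm_wedge_O_one, ih, wedge_zero,
      sub_zero]

/-- Multiplying by this differential removes the `qForm` part of the generator and leaves t times a
power of the form dual to `O 1`. -/
theorem dw_O_one_wedge_gen (n : ℕ) : wedge (dw (cs K) (cov (O 1))) (gen K n)
    = -wedge (cov T) (wedge (dw (cs K) (cov (O 1))) (oPow K n)) := by
  induction n with
  | zero =>
    have h := dw_O_one_wedge_odd (K := K) (a := T) rfl one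
    rw [wedge_one] at h
    exact h
  | succ n ih =>
    have h := cov_wedge_cov_wedge (K := K) (O 1) T
    simp only [sg, par, mul_one, pow_one, neg_neg, one_smul] at h
    rw [gen, wedge_add, dw_O_one_wedge_qForm, add_zero, dw_O_one_wedge_odd rfl, ih, wedge_neg, h,
      oPow, dw_O_one_wedge_odd rfl, wedge_neg]

/-- The term from differentiating the leading factor is cancelled by the differential of `qForm`,
which is why that correction is present. -/
theorem dw_gen (n : ℕ) : dw (cs K) (gen K n) = 0 := by
  induction n with
  | zero => exact dw_cov_T
  | succ n ih =>
    have h : tw (fun _ => (-1 : K)) (qForm K) = qForm K := by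
      rw [qForm, tw_smul, tw_wedge, tw_cov, tw_cov, smul_wedge, wedge_smul]
      module
    rw [gen, dw_add, dw_cov_wedge, ih, wedge_zero, sub_zero, dw_wedge, h, qForm_wedge_dw_oPow,
      add_zero, dw_qForm, dw_O_one_wedge_gen, wedge_assoc, neg_add_cancel]

/-! ### Properties of the explicit cocycles -/

theorem isCoch_oPow (n : ℕ) : IsCoch n n (oPow K n) := by
  induction n with
  | zero => exact isCoch_one
  | succ n ih =>
    have := (isCoch_cov (K := K) (O 1)).wedge ih
    simp only [gr] at this
    push_cast at this ⊢
    rwa [add_comm (n : ℤ) 1]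

theorem supp_wt_oPow (n : ℕ) : Supp wt 0 (oPow K n) := by
  induction n with
  | zero => exact supp_one _
  | succ n ih => simpa [wt, oPow] using (supp_cov wt (O 1)).wedge ih

theorem ins_wedge_eq_zero {a : Idx} {F G : List Idx → K} (hF : ins a F = 0) (hG : ins a G = 0) :
    ins a (wedge F G) = 0 := by
  rw [ins_wedge, hF, hG, zero_wedge, wedge_zero, add_zero]

theorem ins_oPow (n : ℕ) : ins (E 1) (oPow K n) = 0 := by
  induction n with
  | zero => rfl
  | succ n ih => exact ins_wedge_eq_zero (ins_cov_ne (by simp)) ih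

theorem isCoch_qForm : IsCoch 2 0 (qForm K) := by
  simpa [gr, qForm] using ((isCoch_cov (K := K) (E 0)).wedge (isCoch_cov (E 2))).smul (4 : K)

theorem isCoch_gen (n : ℕ) : IsCoch (n + 1) (n - 1) (gen K n) := by
  induction n with
  | zero => simpa [gr, gen] using isCoch_cov (K := K) T
  | succ n ih =>
    have h1 := (isCoch_cov (K := K) (O 1)).wedge ih
    have h2 := (isCoch_qForm (K := K)).wedge (isCoch_oPow n)
    simp only [gr] at h1
    push_cast at h1 h2 ⊢
    rw [show (n : ℤ) + 1 - 1 = n by ring]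
    refine IsCoch.add ?_ ?_
    · convert h1 using 1 <;> ring
    · convert h2 using 1 <;> ring

theorem basic_gen (n : ℕ) : Basic (gen K n) := by
  induction n with
  | zero => exact ⟨supp_cov wt T, ins_cov_ne (by simp)⟩
  | succ n ih =>
    refine Basic.add ⟨?_, ?_⟩ ⟨?_, ?_⟩
    · simpa [wt] using (supp_cov wt (O 1)).wedge ih.weight
    · exact ins_wedge_eq_zero (ins_cov_ne (by simp)) ih.ins_eq
    · simpa [wt, qForm] using (((supp_cov wt (E 0)).wedge (supp_cov wt (E 2))).smul (4 : K)).wedge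
        (supp_wt_oPow n)
    · refine ins_wedge_eq_zero ?_ (ins_oPow n)
      rw [qForm, ins_smul, ins_wedge_eq_zero (ins_cov_ne (by simp)) (ins_cov_ne (by simp)),
        smul_zero]

theorem cov_T_wedge_replicate (F : List Idx → K) (n r : ℕ) :
    wedge (cov T) F (List.replicate (r + 1) T ++ List.replicate n (O 1))
      = (r + 1) * F (List.replicate r T ++ List.replicate n (O 1)) := by
  induction r generalizing F with
  | zero =>
    simp only [zero_add, List.replicate_one, List.cons_append, List.nil_append, wedge_cons,
      ins_cov_self, one_wedge, tw_cov, smul_wedge, Pi.smul_apply]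
    rw [cov_wedge_of_notMem]
    · simp
    · simp [List.mem_replicate]
  | succ r ih =>
    rw [List.replicate_succ, List.cons_append, wedge_cons, ins_cov_self, one_wedge, tw_cov,
      smul_wedge, Pi.smul_apply, ih]
    simp [pass, sg, par, ins_apply, List.replicate_succ]
    ring

theorem cov_O_wedge_replicate (F : List Idx → K) (n : ℕ) :
    wedge (cov (O 1)) F (List.replicate (n + 1) (O 1))
      = (n + 1) * F (List.replicate n (O 1)) := by
  induction n generalizing F with
  | zero => simp [wedge, ins_cov_self, one, cov]; simp [ins, cov, tw]
  | succ r ih =>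
    rw [List.replicate_succ, wedge_cons, ins_cov_self, one_wedge, tw_cov,
      smul_wedge, Pi.smul_apply, ih]
    simp [pass, sg, par, ins_apply, List.replicate_succ]
    ring

/-- The correction terms need a letter E_0 and do not see this word; the rest is the n-th power of
an even variable evaluated on n equal arguments. -/
theorem gen_apply (n : ℕ) : gen K n (T :: List.replicate n (O 1)) = n.factorial := by
  induction n with
  | zero => simp [gen, cov]
  | succ n ih =>
    rw [gen, Pi.add_apply, qForm_wedge, Pi.smul_apply, cov_wedge_of_notMem (a := E 0), smul_zero,
      add_zero, wedge_cons, ins_cov_ne (by simp), zero_wedge, Pi.zero_apply, zero_add, tw_cov,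
      smul_wedge, Pi.smul_apply, cov_O_wedge_replicate, ins_apply, ih, Nat.factorial_succ]
    · simp [pass, sg, par]
    · simp [List.mem_replicate]

/-- The exterior product of `gen K n` with the `r`-th power of `cov T`. -/
def genT (K : Type*) [Field K] (n : ℕ) : ℕ → List Idx → K
  | 0 => gen K n
  | r + 1 => wedge (cov T) (genT K n r)

theorem isCoch_genT (n r : ℕ) : IsCoch (n + r + 1) (n - r - 1) (genT K n r) := by
  induction r with
  | zero => simpa [genT] using isCoch_gen n
  | succ r ih =>
    have := (isCoch_cov (K := K) T).wedge ih
    simp only [gr] at this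
    push_cast
    change IsCoch _ _ (wedge (cov T) (genT K n r))
    convert this using 1 <;> ring

theorem basic_genT (n r : ℕ) : Basic (genT K n r) := by
  induction r with
  | zero => exact basic_gen n
  | succ r ih =>
    refine ⟨?_, ins_wedge_eq_zero (ins_cov_ne (by simp)) ih.ins_eq⟩
    simpa [wt, genT] using (supp_cov wt T).wedge ih.weight

theorem dw_genT (n r : ℕ) : dw (cs K) (genT K n r) = 0 := by
  induction r with
  | zero => exact dw_gen n
  | succ r ih => rw [genT, dw_cov_wedge, dw_cov_T, ih, zero_wedge, wedge_zero, sub_zero]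

theorem genT_apply_ne_zero (n r : ℕ) :
    genT K n r (List.replicate (r + 1) T ++ List.replicate n (O 1)) ≠ 0 := by
  induction r with
  | zero =>
    rw [genT, zero_add, List.replicate_one, List.cons_append, List.nil_append, gen_apply]
    exact Nat.cast_ne_zero.mpr n.factorial_ne_zero
  | succ r ih =>
    rw [genT, cov_T_wedge_replicate]
    exact mul_ne_zero (Nat.cast_add_one_ne_zero _) ih

end SMWord

namespace SMWord
open Idx
variable {K : Type*} [Field K]

/-! ### The cohomology of word functions -/

/-- The bracket preserves weight, so the differential at a fixed word sees the multiplier as a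
constant. This permits inverting and projecting weight by weight. -/
theorem dw_weight_mul (κ : ℤ → K) (F : List Idx → K) :
    dw (cs K) ((fun l => κ (st wt l)) * F) = (fun l => κ (st wt l)) * dw (cs K) F := by
  funext l
  have h : dw (cs K) ((fun l => κ (st wt l)) * F - κ (st wt l) • F) l = 0 := by
    refine dw_eq_zero (fun x => x = 0) (φ := wt) (fun a b hab => ?_) fun l' hl' => ?_
    · rw [wt_op a b hab]; ring
    · have : st wt l' = st wt l := by omega
      simp [this]
  rw [dw_sub, dw_smul] at h
  exact sub_eq_zero.mp h

theorem skew_weight_mul (κ : ℤ → K) {F : List Idx → K} (hF : Skew F) :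
    Skew ((fun l => κ (st wt l)) * F) :=
  skew_mul hF fun l l' h => by rw [st_perm wt h]

theorem IsCoch.weight_mul (κ : ℤ → K) {k g : ℤ} {F : List Idx → K} (hF : IsCoch k g F) :
    IsCoch k g ((fun l => κ (st wt l)) * F) :=
  ⟨skew_weight_mul κ hF.skew, fun l hl => by simp [hF.len l hl],
    fun l hl => by simp [hF.grade l hl]⟩

theorem dw_ins_E_one {F : List Idx → K} (l : List Idx) :
    dw (cs K) (ins (E 1) F) l = -(2 * st wt l * F l) - ins (E 1) (dw (cs K) F) l := by
  rw [ins_dw, Pi.sub_apply, Pi.neg_apply, lie_E_one]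
  ring

theorem dw_ins_E_one_eq_zero {F : List Idx → K} (hw : Supp wt 0 F)
    (h : ins (E 1) (dw (cs K) F) = 0) : dw (cs K) (ins (E 1) F) = 0 := by
  funext l
  rw [dw_ins_E_one, h]
  by_cases hl : st wt l = 0
  · simp [hl]
  · simp [hw l hl]

theorem lie_T_replicate {G : List Idx → K} (hs : Skew G) (r n : ℕ) :
    lie (par T) (cs K T) (op T) G (List.replicate r T ++ List.replicate n (O 1))
      = n * G (E 1 :: (List.replicate r T ++ List.replicate (n - 1) (O 1))) := by
  induction r generalizing G with
  | zero =>
    induction n generalizing G with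
    | zero => simp [lie_nil]
    | succ n ih =>
      simp only [List.replicate_zero, List.nil_append] at ih ⊢
      rw [List.replicate_succ, lie_cons, ih (hs.ins (O 1))]
      rcases n with _ | n
      · simp [cs, op]
      · rw [ins_apply, hs.swap]
        simp [cs, op, par, sg, List.replicate_succ]
        ring
  | succ r ih =>
    rw [List.replicate_succ, List.cons_append, lie_cons, ih (hs.ins T), ins_apply, hs.swap]
    simp [cs, op, par, sg]

/-- Each of the `r * n` pairs of a `T` and an `O 1` contributes its bracket E_1, and all with the
same sign. For `r, n ≥ 1` this shows that the Euler class acts injectively on the detecting values;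
for `n = 0` it shows that coboundaries vanish on T^r. -/
theorem dw_replicate {F : List Idx → K} (hs : Skew F) (r n : ℕ) :
    dw (cs K) F (List.replicate r T ++ List.replicate n (O 1))
      = -(r * n * F (E 1 :: (List.replicate (r - 1) T ++ List.replicate (n - 1) (O 1)))) := by
  induction r generalizing F with
  | zero =>
    rw [dw_eq_zero_of_letters]
    · simp
    · intro a ha b hb hab
      simp only [List.replicate_zero, List.nil_append, List.mem_replicate] at ha hb
      rw [ha.2, hb.2] at hab
      exact absurd rfl hab
  | succ r ih =>
    rw [List.replicate_succ, List.cons_append, dw_cons, lie_T_replicate hs, ih (hs.ins T)]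
    rcases r with _ | r
    · simp
    · rw [ins_apply, hs.swap]
      simp [par, sg, List.replicate_succ]
      ring

theorem Skew.ins_E_ins_E [CharZero K] {F : List Idx → K} (hs : Skew F) (i : ℕ) :
    SMWord.ins (E i) (SMWord.ins (E i) F) = 0 := by
  funext l
  exact hs.cons_cons_self i l

/-- `cov (E 1) ∧ F` for basic `F`. -/
theorem covE_wedge {k g : ℤ} {F : List Idx → K} (hF : IsCoch k g F) (hb : Basic F) :
    IsCoch (k + 1) g (wedge (cov (E 1)) F) ∧ Supp wt 0 (wedge (cov (E 1)) F) ∧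
      ins (E 1) (wedge (cov (E 1)) F) = F := by
  refine ⟨?_, ?_, ?_⟩
  · simpa [gr, add_comm] using (isCoch_cov (K := K) (E 1)).wedge hF
  · simpa [wt] using (supp_cov wt (E 1)).wedge hb.weight
  · rw [ins_wedge, ins_cov_self, one_wedge, hb.ins_eq, wedge_zero, add_zero]

variable [CharZero K]

/-- Every cocycle is cohomologous to a basic one. -/
theorem exists_basic {k g : ℤ} {C : List Idx → K} (hC : IsCoch k g C) (hd : dw (cs K) C = 0) :
    ∃ C' z, IsCoch k g C' ∧ Basic C' ∧ dw (cs K) C' = 0 ∧ IsCoch (k - 1) g z ∧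
      C = C' + dw (cs K) z := by
  -- The usual homotopy for a diagonal action: insertion of E_1 divided by the eigenvalue. As the
  -- inverse of 0 is 0, `y` has no component of weight zero, and `dw y` equals `C` exactly in
  -- nonzero weight.
  set y : List Idx → K := (fun l => (fun w : ℤ => -(2 * (w : K))⁻¹) (st wt l)) * ins (E 1) C
    with hy
  have hyc : IsCoch (k - 1) g y := by
    simpa only [gr, Nat.cast_one, sub_self, sub_zero] using
      (hC.ins (E 1)).weight_mul (fun w : ℤ => -(2 * (w : K))⁻¹)
  have hdy : ∀ l, dw (cs K) y l = if st wt l = 0 then 0 else C l := by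
    intro l
    rw [congrFun (dw_weight_mul (fun w : ℤ => -(2 * (w : K))⁻¹) (ins (E 1) C)) l, Pi.mul_apply,
      dw_ins_E_one, hd]
    split_ifs with h
    · simp [h]
    · have h2 : (st wt l : K) ≠ 0 := by exact_mod_cast h
      simp only [ins_zero, Pi.zero_apply, sub_zero]
      field_simp
  set C₀ := C - dw (cs K) y with hC₀
  have h0 : IsCoch k g C₀ := hC.sub (by simpa using hyc.dw)
  have hw0 : Supp wt 0 C₀ := fun l hl => by
    rw [hC₀, Pi.sub_apply, hdy, if_neg hl, sub_self]
  have hd0 : dw (cs K) C₀ = 0 := by rw [hC₀, dw_sub, hd, dw_dw, sub_zero]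
  have hb : Basic (ins (E 1) C₀) :=
    ⟨by simpa [wt] using hw0.ins (E 1), h0.skew.ins_E_ins_E 1⟩
  have hbc : IsCoch (k - 1) g (ins (E 1) C₀) := by simpa [gr] using h0.ins (E 1)
  -- The contraction of a closed weight zero cochain with E_1 is a basic cocycle, and the cocycle
  -- identity on T^{r+1} (O 1)^{n+1} forces its value on T^r (O 1)^n to vanish. Hence it is the
  -- differential of a basic `v`.
  obtain ⟨v, hv, hvb, hvd⟩ := exists_dw_of_normal hbc hb
    (dw_ins_E_one_eq_zero hw0 (by rw [hd0, ins_zero])) (by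
      intro n r _
      have h := dw_replicate h0.skew (r + 1) (n + 1)
      rw [hd0] at h
      have h1 : ((r + 1 : ℕ) : K) * ((n + 1 : ℕ) : K) ≠ 0 :=
        mul_ne_zero (Nat.cast_ne_zero.mpr (by omega)) (Nat.cast_ne_zero.mpr (by omega))
      exact (mul_eq_zero.mp (neg_eq_zero.mp h.symm)).resolve_left h1)
  obtain ⟨hz, hzw, hzi⟩ := covE_wedge hv hvb
  -- Contracting `z` with E_1 returns `v`, so by Cartan's formula adding `dw z` removes the
  -- contraction of `C₀`.
  set z := wedge (cov (E 1)) v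
  rw [sub_add_cancel] at hz
  have hz2 : Basic (C₀ + dw (cs K) z) := by
    refine ⟨hw0.add (by simpa using hzw.dw (c := cs K) wt_op), ?_⟩
    funext l
    have h := dw_ins_E_one (F := z) l
    have h2 : (st wt l : K) * z l = 0 := by
      by_cases hl : st wt l = 0
      · simp [hl]
      · simp [hzw l hl]
    rw [hzi, hvd] at h
    rw [ins_add, Pi.add_apply, Pi.zero_apply]
    linear_combination h - 2 * h2
  refine ⟨C₀ + dw (cs K) z, y - z, h0.add (by simpa using hz.dw), hz2, ?_, hyc.sub hz, ?_⟩
  · rw [dw_add, hd0, dw_dw, add_zero]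
  · rw [dw_sub, hC₀]
    abel

theorem exists_generator_basic (n r : ℕ) (h : n = 0 ∨ 1 ≤ r) :
    ∃ D : List Idx → K, IsCoch (n + r) (n - r) D ∧ Basic D ∧ dw (cs K) D = 0 ∧
      D (List.replicate r T ++ List.replicate n (O 1)) ≠ 0 := by
  rcases r with _ | r
  · obtain rfl : n = 0 := by omega
    refine ⟨one, by simpa using isCoch_one, ⟨supp_one _, rfl⟩, ?_, by simp [one]⟩
    funext l
    by_cases hl : st (fun _ => 1) l = 0 + 1
    · rw [st_one] at hl
      obtain ⟨x, rfl⟩ := List.length_eq_one_iff.mp (by exact_mod_cast hl)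
      simp [dw, lie]
    · exact isCoch_one.dw.len l hl
  · refine ⟨genT K n r, ?_, basic_genT n r, dw_genT n r, genT_apply_ne_zero n r⟩
    have := isCoch_genT (K := K) n r
    push_cast
    convert this using 1 <;> ring

theorem IsCoch.apply_replicate {k g : ℤ} {F : List Idx → K} (hF : IsCoch k g F) {n r : ℕ}
    (h : F (List.replicate r T ++ List.replicate n (O 1)) ≠ 0) : k = n + r ∧ g = n - r := by
  constructor
  · by_contra h1
    refine h (hF.apply_eq_zero ?_)
    simp
    omega
  · by_contra h1
    refine h (hF.grade _ ?_)
    simp [st_append, st_replicate, gr]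
    omega

theorem normal_of_apply_eq_zero {k g : ℤ} {F : List Idx → K} (hF : IsCoch k g F) {n r : ℕ}
    (hk : k = n + r) (hg : g = n - r)
    (h : F (List.replicate r T ++ List.replicate n (O 1)) = 0) : Normal F := by
  intro n' r' _
  by_contra h'
  obtain ⟨h1, h2⟩ := hF.apply_replicate h'
  obtain rfl : n' = n := by omega
  obtain rfl : r' = r := by omega
  exact h' h

/-- Cocycles are determined up to coboundaries by one value after a reduction to basic ones. -/
theorem exists_dw_of_ne {k g : ℤ} {C : List Idx → K} (hC : IsCoch k g C) (hb : Basic C)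
    (hd : dw (cs K) C = 0) {n r : ℕ} (hk : k = n + r) (hg : g = n - r) {A : List Idx → K}
    (hA : IsCoch k g A) (hAb : Basic A) (hAd : dw (cs K) A = 0)
    (hA0 : A (List.replicate r T ++ List.replicate n (O 1)) ≠ 0) :
    ∃ (c : K) (z : List Idx → K), IsCoch (k - 1) g z ∧ C = c • A + dw (cs K) z := by
  set w := List.replicate r T ++ List.replicate n (O 1)
  obtain ⟨z, hz, -, h⟩ := exists_dw_of_normal (hC.sub (hA.smul (C w / A w)))
    (hb.sub (hAb.smul _)) (by rw [dw_sub, dw_smul, hd, hAd, smul_zero, sub_zero])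
    (normal_of_apply_eq_zero (hC.sub (hA.smul (C w / A w))) hk hg (by
      change (C - (C w / A w) • A) w = 0
      simp [hA0]))
  exact ⟨C w / A w, z, hz, by rw [h]; abel⟩

/-- The hypothesis excludes the surviving pairs. For any other pair that carries a basic class, the
pair (n-1, r-1) carries one too, and its product with the Euler class spans the class in question.
-/
theorem exists_dw_of_not_gen {k g : ℤ} {C : List Idx → K} (hC : IsCoch k g C)
    (hd : dw (cs K) C = 0) (h : ∀ n r : ℕ, k = n + r → g = n - r → 1 ≤ n ∧ (r = 1 → n = 1)) :
    ∃ z, IsCoch (k - 1) g z ∧ C = dw (cs K) z := by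
  obtain ⟨C', z, hC', hb, hd', hz, rfl⟩ := exists_basic hC hd
  suffices ∃ z, IsCoch (k - 1) g z ∧ C' = dw (cs K) z by
    obtain ⟨z', hz', rfl⟩ := this
    exact ⟨z' + z, hz'.add hz, by rw [dw_add]⟩
  by_cases hn : Normal C'
  · obtain ⟨y, hy, -, h⟩ := exists_dw_of_normal hC' hb hd' hn
    exact ⟨y, hy, h.symm⟩
  · unfold Normal at hn
    push Not at hn
    obtain ⟨n, r, hnr, hne⟩ := hn
    obtain ⟨hk, hg⟩ := hC'.apply_replicate hne
    obtain ⟨h1, h2⟩ := h n r hk hg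
    -- The pair (n-1, r-1) is admissible: `r = 1` forces `n = 1`, where the unit serves, and
    -- otherwise `r - 1 ≥ 1`.
    obtain ⟨D, hD, hDb, hDd, hD0⟩ := exists_generator_basic (K := K) (n - 1) (r - 1) (by omega)
    obtain ⟨hv, hvw, hvi⟩ := covE_wedge hD hDb
    set v := wedge (cov (E 1)) D
    have hv' : IsCoch (k - 1) g v := by
      convert hv using 1 <;> omega
    have hvb : Basic (dw (cs K) v) := by
      refine ⟨by simpa using hvw.dw (c := cs K) wt_op, ?_⟩
      funext l
      have h := dw_ins_E_one (F := v) l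
      have h2 : (st wt l : K) * v l = 0 := by
        by_cases hl : st wt l = 0
        · simp [hl]
        · simp [hvw l hl]
      rw [hvi, hDd, Pi.zero_apply] at h
      rw [Pi.zero_apply]
      linear_combination h - 2 * h2
    obtain ⟨c, y, hy, rfl⟩ := exists_dw_of_ne hC' hb hd' hk hg (A := dw (cs K) v)
      (by simpa using hv'.dw) hvb (dw_dw v) (by
        rw [dw_replicate hv.skew, neg_ne_zero]
        refine mul_ne_zero (mul_ne_zero (Nat.cast_ne_zero.mpr (by omega))
          (Nat.cast_ne_zero.mpr (by omega))) ?_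
        change ins (E 1) v _ ≠ 0
        rwa [hvi])
    exact ⟨c • v + y, (hv'.smul c).add hy, by rw [dw_add, dw_smul]⟩

/-- For `n = 0` coboundaries vanish on T^r. For `r = 1` a primitive would contract with E_1 to a
basic cocycle in the bidegree of (n-1, 0), where there is no basic class as `n ≥ 2`; that
contraction is then exact and vanishes on (O 1)^{n-1}, hence `A` vanishes on T (O 1)^n. -/
theorem not_exists_dw {k g : ℤ} {n r : ℕ} (hk : k = n + r) (hg : g = n - r)
    (h : n = 0 ∨ (r = 1 ∧ 2 ≤ n)) {A : List Idx → K} (hAb : Basic A)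
    (hA0 : A (List.replicate r T ++ List.replicate n (O 1)) ≠ 0) {y : List Idx → K}
    (hy : IsCoch (k - 1) g y) : A ≠ dw (cs K) y := by
  intro hA
  rcases h with rfl | ⟨rfl, hn⟩
  · rw [hA, dw_replicate hy.skew] at hA0
    simp at hA0
  · have hy0 := hy.weight_mul fun w => if w = 0 then (1 : K) else 0
    have hd0 := dw_weight_mul (fun w => if w = 0 then (1 : K) else 0) y
    set y₀ := (fun l => (fun w : ℤ => if w = 0 then (1 : K) else 0) (st wt l)) * y with hy₀
    have hd1 : dw (cs K) y₀ = A := by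
      rw [hd0, ← hA]
      funext l
      by_cases hl : st wt l = 0
      · simp [hl]
      · simp [hl, hAb.weight l hl]
    have hw : Supp wt 0 y₀ := fun l hl => by simp [hy₀, hl]
    have hb : Basic (ins (E 1) y₀) :=
      ⟨by simpa [wt] using hw.ins (E 1), hy0.skew.ins_E_ins_E 1⟩
    have hbc : IsCoch (k - 1 - 1) g (ins (E 1) y₀) := by simpa [gr] using hy0.ins (E 1)
    obtain ⟨v, hv, hvb, hvd⟩ := exists_dw_of_normal hbc hb
      (dw_ins_E_one_eq_zero hw (by rw [hd1, hAb.ins_eq])) (by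
        -- Bidegree forces `r' = 0` and `n' = n - 1 ≥ 1`, which the condition `hnr` excludes; so
        -- normality holds vacuously.
        intro n' r' hnr
        by_contra h'
        obtain ⟨h1, h2⟩ := hbc.apply_replicate h'
        omega)
    rw [← hd1, dw_replicate hy0.skew] at hA0
    refine hA0 ?_
    have h1 := hvb.dw_apply_replicate hv.skew (n - 1) 0
    rw [hvd, ins_apply] at h1
    simp only [Nat.sub_self]
    rw [h1]
    simp

end SMWord

namespace SMWord
open Idx OddContact
variable {K : Type*} [Field K]

/-! ### The topological basis of `SM(1)` -/

/-- The basis elements of `SM(1)`. -/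
noncomputable def bas : Idx → SM K
  | E i => bE i
  | O i => bO i
  | T => bTX

theorem monomial_eq (n : ℕ) (a : K) :
    PowerSeries.monomial n a = PowerSeries.C a * PowerSeries.X ^ n := by
  rw [PowerSeries.monomial_eq_mk, PowerSeries.X_pow_eq]
  ext m
  simp [PowerSeries.coeff_monomial]

section components
variable (f g : SFun K)
local notation "∂" => PowerSeries.derivative K
local notation "ξ" => (PowerSeries.X : PowerSeries K)

theorem contact_zero_zero : contact f g 0 0 =
    (2 * f 0 0 - ξ * ∂ (f 0 0)) * g 1 0 - f 1 0 * (2 * g 0 0 - ξ * ∂ (g 0 0))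
      - (∂ (f 0 0) * g 0 1 - f 0 1 * ∂ (g 0 0)) := by
  have hC : PowerSeries.C (2 : K) = 2 := map_ofNat _ 2
  simp [contact, delt, buttin, euler, mul, varx, varX, sgn, dT, dX, dx, Algebra.smul_def, hC]
  ring

theorem contact_zero_one : contact f g 0 1 =
    (2 * f 0 0 - ξ * ∂ (f 0 0)) * g 1 1 + (f 0 1 - ξ * ∂ (f 0 1)) * g 1 0
      - f 1 0 * (g 0 1 - ξ * ∂ (g 0 1)) + f 1 1 * (2 * g 0 0 - ξ * ∂ (g 0 0))
      - (∂ (f 0 1) * g 0 1 - f 0 1 * ∂ (g 0 1)) := by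
  have hC : PowerSeries.C (2 : K) = 2 := map_ofNat _ 2
  simp [contact, delt, buttin, euler, mul, varx, varX, sgn, dT, dX, dx, Algebra.smul_def, hC]
  ring

theorem contact_one_zero : contact f g 1 0 =
    (2 * f 1 0 - ξ * ∂ (f 1 0)) * g 1 0 - f 1 0 * (2 * g 1 0 - ξ * ∂ (g 1 0))
      + ∂ (f 0 0) * g 1 1 - ∂ (f 1 0) * g 0 1 + f 0 1 * ∂ (g 1 0) + f 1 1 * ∂ (g 0 0) := by
  have hC : PowerSeries.C (2 : K) = 2 := map_ofNat _ 2
  simp [contact, delt, buttin, euler, mul, varx, varX, sgn, dT, dX, dx, Algebra.smul_def, hC]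
  ring

theorem contact_one_one : contact f g 1 1 =
    (f 1 1 - ξ * ∂ (f 1 1)) * g 1 0 + (2 * f 1 0 - ξ * ∂ (f 1 0)) * g 1 1
      - f 1 0 * (g 1 1 - ξ * ∂ (g 1 1)) - f 1 1 * (2 * g 1 0 - ξ * ∂ (g 1 0))
      - ∂ (f 1 1) * g 0 1 - ∂ (f 0 1) * g 1 1 + f 0 1 * ∂ (g 1 1) + f 1 1 * ∂ (g 0 1) := by
  have hC : PowerSeries.C (2 : K) = 2 := map_ofNat _ 2
  simp [contact, delt, buttin, euler, mul, varx, varX, sgn, dT, dX, dx, Algebra.smul_def, hC]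
  ring

end components

theorem bE_val (i : ℕ) : (bE i : SM K).1 = ![![0, (2 - (i : PowerSeries K)) * PowerSeries.X ^ i],
    ![(i : PowerSeries K) * PowerSeries.X ^ (i - 1), 0]] := by
  have hC : PowerSeries.C (2 : K) = 2 := map_ofNat _ 2
  have h : PowerSeries.monomial i (2 - (i : K)) =
      (2 - (i : PowerSeries K)) * PowerSeries.X ^ i := by
    rw [monomial_eq, map_sub, map_natCast, hC]
  simp only [bE, h, monomial_eq, map_natCast]

theorem bO_val (i : ℕ) : (bO i : SM K).1 = ![![PowerSeries.X ^ i, 0], ![0, 0]] := by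
  simp only [bO, monomial_eq, map_one, one_mul]

theorem bTX_val : (bTX : SM K).1 = ![![0, 0], ![0, 1]] := rfl

theorem sfun_ext {f g : SFun K} (h₁ : f 0 0 = g 0 0) (h₂ : f 0 1 = g 0 1) (h₃ : f 1 0 = g 1 0)
    (h₄ : f 1 1 = g 1 1) : f = g := by
  funext p q
  fin_cases p <;> fin_cases q <;> assumption

theorem derivative_two : PowerSeries.derivative K 2 = 0 := by
  rw [← map_ofNat (PowerSeries.C (R := K)) 2, PowerSeries.derivative_C]

theorem contact_bE_bE (i j : ℕ) : contact (bE i).1 (bE j).1 =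
    (2 * ((j : K) - i)) • (bE (i + j - 1) : SM K).1 := by
  have hC : PowerSeries.C (2 : K) = 2 := map_ofNat _ 2
  simp only [bE_val]
  apply sfun_ext <;> rcases i with _ | _ | i <;> rcases j with _ | _ | j <;>
    simp [contact_zero_zero, contact_zero_one, contact_one_zero,
      contact_one_one, Algebra.smul_def, hC, derivative_two] <;> ring

theorem contact_bE_bO (i j : ℕ) : contact (bE i).1 (bO j).1 =
    (2 * ((j : K) - i)) • (bO (i + j - 1) : SM K).1 := by
  have hC : PowerSeries.C (2 : K) = 2 := map_ofNat _ 2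
  simp only [bE_val, bO_val]
  apply sfun_ext <;> rcases i with _ | i <;> rcases j with _ | j <;>
    simp [contact_zero_zero, contact_zero_one, contact_one_zero,
      contact_one_one, Algebra.smul_def, hC, derivative_two] <;> ring

theorem contact_bO_bE (i j : ℕ) : contact (bO i).1 (bE j).1 =
    (2 * ((j : K) - i)) • (bO (i + j - 1) : SM K).1 := by
  have hC : PowerSeries.C (2 : K) = 2 := map_ofNat _ 2
  simp only [bE_val, bO_val]
  apply sfun_ext <;> rcases i with _ | i <;> rcases j with _ | j <;>
    simp [contact_zero_zero, contact_zero_one, contact_one_zero,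
      contact_one_one, Algebra.smul_def, hC, derivative_two] <;> ring

theorem contact_bO_bO (i j : ℕ) : contact (bO i).1 (bO j).1 = (0 : SFun K) := by
  simp only [bO_val]
  apply sfun_ext <;> simp [contact_zero_zero, contact_zero_one, contact_one_zero,
      contact_one_one]

theorem contact_bTX_bO (j : ℕ) : contact bTX.1 (bO j).1 = (bE j : SM K).1 := by
  simp only [bTX_val, bO_val, bE_val]
  apply sfun_ext <;> rcases j with _ | j <;> simp [contact_zero_zero, contact_zero_one,
      contact_one_zero, contact_one_one] <;> ring

theorem contact_bO_bTX (j : ℕ) : contact (bO j).1 bTX.1 = (bE j : SM K).1 := by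
  simp only [bTX_val, bO_val, bE_val]
  apply sfun_ext <;> rcases j with _ | j <;> simp [contact_zero_zero, contact_zero_one,
      contact_one_zero, contact_one_one] <;> ring

theorem contact_bTX_bE (j : ℕ) : contact bTX.1 (bE j).1 = (0 : SFun K) := by
  simp only [bTX_val, bE_val]
  apply sfun_ext <;> rcases j with _ | _ | j <;> simp [contact_zero_zero, contact_zero_one,
      contact_one_zero, contact_one_one, derivative_two] <;> ring

theorem contact_bE_bTX (j : ℕ) : contact (bE j).1 bTX.1 = (0 : SFun K) := by
  simp only [bTX_val, bE_val]
  apply sfun_ext <;> rcases j with _ | _ | j <;> simp [contact_zero_zero, contact_zero_one,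
      contact_one_zero, contact_one_one, derivative_two] <;> ring

theorem contact_bTX_bTX : contact bTX.1 bTX.1 = (0 : SFun K) := by
  simp only [bTX_val]
  apply sfun_ext <;> simp [contact_zero_zero, contact_zero_one, contact_one_zero, contact_one_one]

theorem br_bas (a b : Idx) : br (bas a) (bas b) = cs K a b • (bas (op a b) : SM K) := by
  apply Subtype.ext
  rcases a with i | i | _ <;> rcases b with j | j | _ <;>
    simp [br, bas, op, cs, contact_bE_bE, contact_bE_bO, contact_bO_bE, contact_bO_bO,
      contact_bTX_bO, contact_bO_bTX, contact_bTX_bE, contact_bE_bTX, contact_bTX_bTX]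

end SMWord

namespace SMWord
open Idx OddContact
variable {K : Type*} [Field K]

/-! ### Coordinates -/

/-- Parity of a basis element, as an element of `Fin 2`. -/
def pf : Idx → Fin 2
  | E _ => 0
  | O _ => 1
  | T => 1

theorem coe_pf (a : Idx) : (pf a : ℕ) = par a := by cases a <;> rfl

theorem psgn_pf (a b : Idx) : psgn K (pf a) (pf b) = sg K a b := by
  simp only [psgn, sg, coe_pf]

/-- The coordinate functionals of the topological basis of `SM(1)`. -/
noncomputable def coef : Idx → SM K →ₗ[K] K
  | E i =>
    -- The coefficients of E_i are 2 - i at X and i at T. Either may vanish, but their sum is always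
    -- 2.
    { toFun := fun v => (PowerSeries.coeff i (v.1 0 1)
        + PowerSeries.coeff i (PowerSeries.X * v.1 1 0)) / 2
      map_add' := fun u v => by simp [mul_add]; ring
      map_smul' := fun c v => by simp; ring }
  | O i =>
    { toFun := fun v => PowerSeries.coeff i (v.1 0 0)
      map_add' := fun u v => by simp
      map_smul' := fun c v => by simp }
  | T =>
    { toFun := fun v => PowerSeries.coeff 0 (v.1 1 1)
      map_add' := fun u v => by simp
      map_smul' := fun c v => by simp }

theorem coef_E (i : ℕ) (v : SM K) : coef (E i) v = (PowerSeries.coeff i (v.1 0 1)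
    + PowerSeries.coeff i (PowerSeries.X * v.1 1 0)) / 2 := rfl
theorem coef_O (i : ℕ) (v : SM K) : coef (O i) v = PowerSeries.coeff i (v.1 0 0) := rfl
theorem coef_T (v : SM K) : coef T v = PowerSeries.coeff 0 (v.1 1 1) := rfl

theorem hasParity_bas (a : Idx) : HasParity (pf a) (bas a : SM K) := by
  intro p q h
  rcases a with i | i | _ <;> fin_cases p <;> fin_cases q <;>
    simp_all [bas, bE, bO, bTX, pf]

theorem hasGrade_bas (a : Idx) : HasGrade (gr a) (bas a : SM K) := by
  intro p q i h
  rcases a with j | j | _ <;> fin_cases p <;> fin_cases q <;>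
    simp_all [bas, bE, bO, bTX, gr, PowerSeries.coeff_monomial]
  rintro rfl
  rcases j with _ | j <;> simp at h ⊢

theorem pf_eq_of_coef_ne_zero {p : Fin 2} {v : SM K} (hv : HasParity p v) {a : Idx}
    (ha : coef a v ≠ 0) : pf a = p := by
  by_contra h
  apply ha
  rcases a with i | i | _
  · rw [coef_E, hv 0 1 (by simpa [pf] using h), hv 1 0 (by simpa [pf] using h)]; simp
  · rw [coef_O, hv 0 0 (by simpa [pf] using h)]; simp
  · rw [coef_T, hv 1 1 (by simpa [pf] using h)]; simp

theorem gr_eq_of_coef_ne_zero {n : ℤ} {v : SM K} (hv : HasGrade n v) {a : Idx}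
    (ha : coef a v ≠ 0) : gr a = n := by
  by_contra h
  apply ha
  rcases a with i | i | _
  · rw [coef_E, hv 0 1 i (by simpa [gr] using h)]
    rcases i with _ | i
    · simp
    · rw [PowerSeries.coeff_succ_X_mul, hv 1 0 i (by simpa [gr] using h)]; simp
  · rw [coef_O, hv 0 0 i (by simpa [gr] using h)]
  · rw [coef_T, hv 1 1 0 (by simpa [gr] using h)]

variable [CharZero K]

theorem coef_bas (a b : Idx) : coef a (bas b : SM K) = if a = b then 1 else 0 := by
  rcases a with i | i | _ <;> rcases b with j | j | _ <;>
    simp [coef_E, coef_O, coef_T, bas, bE, bO, bTX, PowerSeries.coeff_monomial]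
  rcases i with _ | i <;> rcases j with _ | j <;>
    simp [PowerSeries.coeff_succ_X_mul, PowerSeries.coeff_monomial]
  split_ifs with h
  · subst h; ring
  · simp

section expand
variable (v : SM K) (i : ℕ)

/-- This is the defining equation of SM(1) read off at x^i; it ties the T- and X-coefficients
together, so that one coordinate per index determines both. -/
theorem coeff_rel : (1 - (i : K)) * PowerSeries.coeff i (v.1 1 0) =
    (i + 1) * PowerSeries.coeff (i + 1) (v.1 0 1) := by
  have h := congrArg (PowerSeries.coeff i) ((mem_SM v.1).mp v.2).1
  rw [map_sub, PowerSeries.coeff_derivative] at h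
  rw [mul_comm ((i : K) + 1), ← h]
  rcases i with _ | i
  · simp
  · rw [PowerSeries.coeff_succ_X_mul, PowerSeries.coeff_derivative]; push_cast; ring

theorem coeff_zero_one : PowerSeries.coeff i (v.1 0 1) = (2 - i) * coef (E i) v := by
  rw [coef_E]
  rcases i with _ | i
  · simp only [PowerSeries.coeff_zero_X_mul]
    push_cast
    ring
  · rw [PowerSeries.coeff_succ_X_mul]
    have := coeff_rel v i
    push_cast
    linear_combination (-1 / 2 : K) * this

theorem coeff_one_zero : PowerSeries.coeff i (v.1 1 0) = (i + 1) * coef (E (i + 1)) v := by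
  rw [coef_E, PowerSeries.coeff_succ_X_mul]
  linear_combination (1 / 2 : K) * coeff_rel v i

theorem coeff_one_one (hi : i ≠ 0) : PowerSeries.coeff i (v.1 1 1) = 0 := by
  obtain ⟨i, rfl⟩ := Nat.exists_eq_succ_of_ne_zero hi
  have h := congrArg (PowerSeries.coeff i) ((mem_SM v.1).mp v.2).2
  rw [PowerSeries.coeff_derivative, map_zero] at h
  exact (mul_eq_zero.mp h).resolve_right (Nat.cast_add_one_ne_zero i)

end expand

/-- The labels of index at most `N`. -/
def window (N : ℕ) : Finset Idx :=
  insert T ((Finset.range (N + 1)).image E ∪ (Finset.range (N + 1)).image O)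

theorem mem_window_E {N i : ℕ} : E i ∈ window N ↔ i ≤ N := by
  simp [window, Nat.lt_succ_iff]
theorem mem_window_O {N i : ℕ} : O i ∈ window N ↔ i ≤ N := by
  simp [window, Nat.lt_succ_iff]
theorem mem_window_T {N : ℕ} : T ∈ window N := by simp [window]

/-- Truncation of an element of `SM(1)`. -/
noncomputable def trunc (N : ℕ) (v : SM K) : SM K := ∑ a ∈ window N, coef a v • bas a

theorem dvd_of_coef {N : ℕ} {v : SM K} (h : ∀ a ∈ window N, coef a v = 0) (p q : Fin 2) :
    (PowerSeries.X : PowerSeries K) ^ N ∣ v.1 p q := by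
  rw [PowerSeries.X_pow_dvd_iff]
  intro i hi
  fin_cases p <;> fin_cases q
  · exact h (O i) (mem_window_O.mpr hi.le)
  · exact (coeff_zero_one v i).trans (by rw [h _ (mem_window_E.mpr hi.le), mul_zero])
  -- The coefficient of x^i T belongs to E_{i+1}, so the window has to include the index `N` itself.
  · exact (coeff_one_zero v i).trans (by rw [h _ (mem_window_E.mpr hi), mul_zero])
  · by_cases h0 : i = 0
    · subst h0
      exact h T mem_window_T
    · exact coeff_one_one v i h0

theorem coef_trunc {N : ℕ} (v : SM K) {a : Idx} (ha : a ∈ window N) :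
    coef a (trunc N v) = coef a v := by
  simp [trunc, coef_bas, ha]

theorem dvd_sub_trunc (N : ℕ) (v : SM K) (p q : Fin 2) :
    (PowerSeries.X : PowerSeries K) ^ N ∣ (v - trunc N v).1 p q := by
  refine dvd_of_coef (fun a ha => ?_) p q
  rw [map_sub, coef_trunc v ha, sub_self]

end SMWord

namespace SMWord
open Idx OddContact
variable {K : Type*} [Field K] [CharZero K]

/-! ### Forms and word functions -/

/-- Split each argument into its truncation and a remainder divisible by a high power of x. By
continuity every term with a remainder vanishes, and the truncations are finite combinations of
basis elements. -/
theorem IsCont.exists_expand {k : ℕ} {C : Form K k} (hC : IsCont C) : ∃ N, ∀ M, N ≤ M → ∀ v,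
    C v = ∑ w ∈ Fintype.piFinset (fun _ => window M),
      (∏ l, coef (w l) (v l)) * C (fun l => bas (w l)) := by
  obtain ⟨N, hN⟩ := hC
  refine ⟨N, fun M hM v => ?_⟩
  have h1 : C v = C (fun l => trunc M (v l)) := by
    have h := C.map_add_univ (fun l => trunc M (v l)) (fun l => v l - trunc M (v l))
    have hv : ((fun l => trunc M (v l)) + fun l => v l - trunc M (v l)) = v := by
      funext l; simp
    rw [hv, Finset.sum_eq_single Finset.univ] at h
    · rw [h, Finset.piecewise_univ]
    · intro s _ hs
      obtain ⟨l, hl⟩ : ∃ l, l ∉ s := by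
        by_contra! h'
        exact hs (Finset.eq_univ_iff_forall.mpr h')
      refine hN _ l fun p q => ?_
      rw [Finset.piecewise_eq_of_notMem _ _ _ hl]
      exact (pow_dvd_pow _ hM).trans (dvd_sub_trunc M (v l) p q)
    · simp
  rw [h1]
  simp only [trunc]
  rw [C.map_sum_finset]
  refine Finset.sum_congr rfl fun w _ => ?_
  rw [C.map_smul_univ, smul_eq_mul]

/-- A homogeneous argument has coordinates only at labels of its own parity, so words with the
prescribed parities suffice. This is needed because the signs in the differential and the wedge
depend on the parities. -/
theorem eq_of_words {k : ℕ} {C D : Form K k} (hC : IsCont C) (hD : IsCont D)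
    {p : Fin k → Fin 2} (h : ∀ w : Fin k → Idx, (∀ l, pf (w l) = p l) →
      C (fun l => bas (w l)) = D (fun l => bas (w l)))
    {v : Fin k → SM K} (hv : ∀ l, HasParity (p l) (v l)) : C v = D v := by
  obtain ⟨N, hN⟩ := IsCont.exists_expand hC
  obtain ⟨N', hN'⟩ := IsCont.exists_expand hD
  rw [hN _ (le_max_left N N') v, hN' _ (le_max_right N N') v]
  refine Finset.sum_congr rfl fun w _ => ?_
  by_cases h0 : ∏ l, coef (w l) (v l) = 0
  · rw [h0, zero_mul, zero_mul]
  · rw [h w fun l => pf_eq_of_coef_ne_zero (hv l) (Finset.prod_ne_zero_iff.mp h0 l (by simp))]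

theorem form_ext {k : ℕ} {C D : Form K k} (hC : IsCont C) (hD : IsCont D)
    (h : ∀ w : Fin k → Idx, C (fun l => bas (w l)) = D (fun l => bas (w l))) : C = D := by
  ext v
  obtain ⟨N, hN⟩ := IsCont.exists_expand hC
  obtain ⟨N', hN'⟩ := IsCont.exists_expand hD
  rw [hN _ (le_max_left N N') v, hN' _ (le_max_right N N') v]
  exact Finset.sum_congr rfl fun w _ => by rw [h w]

/-- The word function of a form: its values on the basis elements. -/
noncomputable def wf {k : ℕ} (C : Form K k) : List Idx → K := fun l =>
  if l.length = k then C (fun i => bas (l.getD i T)) else 0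

theorem wf_ofFn {k : ℕ} (C : Form K k) (w : Fin k → Idx) :
    wf C (List.ofFn w) = C (fun l => bas (w l)) := by
  rw [wf, if_pos List.length_ofFn]
  simp

theorem exists_ofFn {k : ℕ} {l : List Idx} (h : l.length = k) :
    ∃ w : Fin k → Idx, l = List.ofFn w := by
  subst h
  exact ⟨l.get, (List.ofFn_get l).symm⟩

theorem wf_of_length_ne {k : ℕ} (C : Form K k) {l : List Idx} (h : l.length ≠ k) :
    wf C l = 0 := if_neg h

theorem st_one_eq (l : List Idx) : st (fun _ => 1) l = (l.length : ℤ) := by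
  induction l with
  | nil => rfl
  | cons a l ih => rw [st_cons, ih]; push_cast [List.length_cons]; ring

theorem supp_length_iff {k : ℕ} {F : List Idx → K} :
    Supp (fun _ => 1) k F ↔ ∀ l, l.length ≠ k → F l = 0 := by
  simp [Supp, st_one_eq]

theorem wf_eq_iff {k : ℕ} {C : Form K k} {F : List Idx → K} (hF : Supp (fun _ => 1) k F) :
    wf C = F ↔ ∀ w : Fin k → Idx, C (fun l => bas (w l)) = F (List.ofFn w) := by
  constructor
  · rintro rfl w
    rw [wf_ofFn]
  · intro h
    funext l
    by_cases hl : l.length = k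
    · obtain ⟨w, rfl⟩ := exists_ofFn hl
      rw [wf_ofFn, h]
    · rw [wf_of_length_ne C hl, supp_length_iff.mp hF l hl]

theorem supp_wf {k : ℕ} (C : Form K k) : Supp (fun _ => 1) k (wf C) :=
  supp_length_iff.mpr fun _ h => wf_of_length_ne C h

theorem wf_injective {k : ℕ} {C D : Form K k} (hC : IsCont C) (hD : IsCont D)
    (h : wf C = wf D) : C = D :=
  form_ext hC hD fun w => by rw [← wf_ofFn, ← wf_ofFn, h]

theorem wf_add {k : ℕ} (C D : Form K k) : wf (C + D) = wf C + wf D := by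
  funext l
  simp only [wf, Pi.add_apply]
  split_ifs <;> simp

theorem wf_smul {k : ℕ} (c : K) (C : Form K k) : wf (c • C) = c • wf C := by
  funext l
  simp only [wf, Pi.smul_apply]
  split_ifs <;> simp

theorem wf_zero {k : ℕ} : wf (0 : Form K k) = 0 := by
  simpa using wf_smul (0 : K) (0 : Form K k)

theorem st_ofFn (φ : Idx → ℤ) {k : ℕ} (w : Fin k → Idx) : st φ (List.ofFn w) = ∑ l, φ (w l) := by
  induction k with
  | zero => rfl
  | succ k ih => rw [List.ofFn_succ, st_cons, ih, Fin.sum_univ_succ]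

theorem isCoch_wf {k : ℕ} {g : ℤ} {C : Form K k} (hC : C ∈ cochains K k g) :
    IsCoch k g (wf C) where
  skew := by
    intro l₁ a b l₂
    by_cases hl : (l₁ ++ a :: b :: l₂).length = k
    · have hl' : (l₁ ++ b :: a :: l₂).length = k := by simpa using hl
      have hk : l₁.length + 1 < k := by simp at hl; omega
      have h := hC.1 (fun i => pf ((l₁ ++ b :: a :: l₂).getD i T))
        (fun i => bas ((l₁ ++ b :: a :: l₂).getD i T)) (fun i => hasParity_bas _)
        ⟨l₁.length, by omega⟩ ⟨l₁.length + 1, hk⟩ rfl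
      rw [wf, if_pos hl, wf, if_pos hl']
      convert h using 2
      · funext i
        congr 1
        by_cases h1 : i = ⟨l₁.length, by omega⟩
        · subst h1
          rw [Equiv.swap_apply_left]
          simp [List.getD_append_right]
        by_cases h2 : i = ⟨l₁.length + 1, hk⟩
        · subst h2
          rw [Equiv.swap_apply_right]
          simp [List.getD_append_right]
        rw [Equiv.swap_apply_of_ne_of_ne h1 h2]
        rcases lt_or_ge (i : ℕ) l₁.length with h3 | h3
        · rw [List.getD_append _ _ _ _ h3, List.getD_append _ _ _ _ h3]
        · rw [List.getD_append_right _ _ _ _ h3, List.getD_append_right _ _ _ _ h3]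
          have h4 : 2 ≤ (i : ℕ) - l₁.length := by
            simp only [Fin.ext_iff] at h1 h2
            omega
          obtain ⟨n, hn⟩ := Nat.exists_eq_add_of_le' h4
          rw [hn]; simp
      · rw [psgn_pf]
        simp [List.getD_append_right, sg_comm]
    · have hl' : (l₁ ++ b :: a :: l₂).length ≠ k := by simpa using hl
      rw [wf, if_neg hl, wf, if_neg hl', mul_zero]
  len := supp_wf C
  grade := by
    intro l h
    by_cases hl : l.length = k
    · obtain ⟨w, rfl⟩ := exists_ofFn hl
      rw [wf_ofFn]
      rw [st_ofFn] at h
      exact hC.2.2 (fun i => gr (w i)) _ (fun i => hasGrade_bas _) h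
    · exact wf_of_length_ne C hl

theorem Skew.ofFn_swap {F : List Idx → K} (hF : Skew F) {k : ℕ} (w : Fin k → Idx) (i j : Fin k)
    (hij : (i : ℕ) + 1 = j) : F (List.ofFn fun l => w (Equiv.swap i j l)) =
      -sg K (w i) (w j) * F (List.ofFn w) := by
  induction k generalizing F with
  | zero => exact i.elim0
  | succ k ih =>
    induction i using Fin.cases with
    | zero =>
      rcases k with _ | k
      · omega
      obtain rfl : j = 1 := by ext; simpa using hij.symm
      have h (l : Fin k) : Equiv.swap (0 : Fin (k + 2)) 1 l.succ.succ = l.succ.succ :=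
        Equiv.swap_apply_of_ne_of_ne (Fin.succ_ne_zero _)
          (fun h => Fin.succ_ne_zero l (Fin.succ_injective _ h))
      have h' : Equiv.swap (0 : Fin (k + 2)) 1 (Fin.succ 0) = 0 := Equiv.swap_apply_right _ _
      simp only [List.ofFn_succ, h, h', Equiv.swap_apply_left]
      have := hF [] (w 1) (w 0) (List.ofFn fun l => w l.succ.succ)
      simp only [List.nil_append] at this
      rw [this, sg_comm]
      rfl
    | succ i =>
      obtain ⟨j, rfl⟩ : ∃ j', j = Fin.succ j' := Fin.exists_succ_eq.mpr (by rintro rfl; simp at hij) |>.imp fun _ h => h.symm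
      have h0 : Equiv.swap i.succ j.succ 0 = 0 :=
        Equiv.swap_apply_of_ne_of_ne (Fin.succ_ne_zero _).symm (Fin.succ_ne_zero _).symm
      have hs (l : Fin k) : Equiv.swap i.succ j.succ l.succ = (Equiv.swap i j l).succ := by
        simp only [Equiv.swap_apply_def, Fin.succ_inj]
        split_ifs <;> rfl
      have := ih (hF.ins (w 0)) (fun l => w l.succ) i j (by simpa using hij)
      simp only [List.ofFn_succ, h0, hs]
      exact this

section mk
variable {k : ℕ} (F : List Idx → K) (M : ℕ)

/-- The form with prescribed values on the basis elements of bounded index. -/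
noncomputable def mkForm (k : ℕ) : Form K k :=
  ∑ w ∈ Fintype.piFinset (fun _ : Fin k => window M), F (List.ofFn w) •
    (MultilinearMap.mkPiAlgebra K (Fin k) K).compLinearMap (fun l => coef (w l))

theorem mkForm_apply (v : Fin k → SM K) : mkForm F M k v =
    ∑ w ∈ Fintype.piFinset (fun _ : Fin k => window M),
      F (List.ofFn w) * ∏ l, coef (w l) (v l) := by
  simp [mkForm, sum_apply]

theorem isCont_mkForm : IsCont (mkForm F M k) := by
  refine ⟨M + 1, fun v l h => ?_⟩
  rw [mkForm_apply]
  refine Finset.sum_eq_zero fun w hw => ?_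
  rw [Finset.prod_eq_zero (Finset.mem_univ l), mul_zero]
  have hwl := Fintype.mem_piFinset.mp hw l
  rcases hc : w l with i | i | _
  · rw [hc, mem_window_E] at hwl
    rw [coef_E, PowerSeries.X_pow_dvd_iff.mp (h 0 1) i (by omega),
      PowerSeries.X_pow_dvd_iff.mp ((h 1 0).mul_left _) i (by omega)]
    simp
  · rw [hc, mem_window_O] at hwl
    rw [coef_O, PowerSeries.X_pow_dvd_iff.mp (h 0 0) i (by omega)]
  · rw [coef_T, PowerSeries.X_pow_dvd_iff.mp (h 1 1) 0 (by omega)]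

theorem mkForm_bas (w : Fin k → Idx) : mkForm F M k (fun l => bas (w l)) =
    if ∀ l, w l ∈ window M then F (List.ofFn w) else 0 := by
  have h (u : Fin k → Idx) :
      ∏ l, coef (u l) (bas (w l) : SM K) = if u = w then 1 else 0 := by
    simp only [coef_bas, Finset.prod_ite_one, Finset.mem_univ, true_implies, funext_iff]
    by_cases h : ∀ l, u l = w l
    · rw [if_pos h]; exact Finset.prod_eq_one fun l _ => if_pos (h l)
    · rw [if_neg h]
      obtain ⟨l, hl⟩ := not_forall.mp h
      exact Finset.prod_eq_zero (Finset.mem_univ l) (if_neg hl)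
  simp only [mkForm_apply, h, mul_ite, mul_one, mul_zero, Finset.sum_ite_eq',
    Fintype.mem_piFinset]

end mk

/-- Every letter has grade at least -1, so in a word of length `k` and grade `g` no letter has grade
above g + k - 1. -/
theorem IsCoch.eq_zero_of_notMem_window {k : ℕ} {g : ℤ} {F : List Idx → K} (hF : IsCoch k g F)
    {w : Fin k → Idx} {l : Fin k} (h : w l ∉ window (g + k).toNat) : F (List.ofFn w) = 0 := by
  refine hF.grade _ fun hs => ?_
  rw [st_ofFn, ← Finset.add_sum_erase _ _ (Finset.mem_univ l)] at hs
  have h1 : ∑ i ∈ Finset.univ.erase l, (-1 : ℤ) ≤ ∑ i ∈ Finset.univ.erase l, gr (w i) :=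
    Finset.sum_le_sum fun i _ => by cases w i <;> simp [gr] <;> omega
  rw [Finset.sum_const, Finset.card_erase_of_mem (Finset.mem_univ l), Finset.card_univ,
    Fintype.card_fin] at h1
  have hk := l.pos
  have h2 : gr (w l) ≤ g + k - 1 := by
    rw [nsmul_eq_mul, Nat.cast_sub (by omega)] at h1
    push_cast at h1
    linarith
  apply h
  rcases hc : w l with i | i | _
  · rw [hc] at h2; rw [mem_window_E]; simp only [gr] at h2; omega
  · rw [hc] at h2; rw [mem_window_O]; simp only [gr] at h2; omega
  · exact mem_window_T

theorem IsCont.domDomCongr {k : ℕ} {C : Form K k} (hC : IsCont C) (σ : Equiv.Perm (Fin k)) :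
    IsCont (C.domDomCongr σ) := by
  obtain ⟨N, hN⟩ := hC
  refine ⟨N, fun v l h => ?_⟩
  rw [MultilinearMap.domDomCongr_apply]
  exact hN _ (σ.symm l) (by simpa using h)

theorem IsCont.smul {k : ℕ} {C : Form K k} (hC : IsCont C) (c : K) : IsCont (c • C) := by
  obtain ⟨N, hN⟩ := hC
  exact ⟨N, fun v l h => by rw [smul_apply, hN v l h, smul_zero]⟩

theorem IsCont.add {k : ℕ} {C D : Form K k} (hC : IsCont C) (hD : IsCont D) :
    IsCont (C + D) := by
  obtain ⟨M, hM⟩ := hC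
  obtain ⟨N, hN⟩ := hD
  exact ⟨max M N, fun v l h => by
    rw [add_apply,
      hM v l fun a b => (pow_dvd_pow _ (le_max_left M N)).trans (h a b),
      hN v l fun a b => (pow_dvd_pow _ (le_max_right M N)).trans (h a b), add_zero]⟩

theorem isCont_zero {k : ℕ} : IsCont (0 : Form K k) := ⟨0, fun _ _ _ => rfl⟩

theorem isCont_sum {k : ℕ} {ι : Type*} (s : Finset ι) {C : ι → Form K k}
    (h : ∀ i ∈ s, IsCont (C i)) : IsCont (∑ i ∈ s, C i) := by
  classical
  induction s using Finset.induction_on with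
  | empty => exact isCont_zero
  | insert a s ha ih =>
    rw [Finset.sum_insert ha]
    exact IsCont.add (h _ (by simp)) (ih fun i hi => h i (by simp [hi]))

theorem IsCoch.exists_form {k : ℕ} {g : ℤ} {F : List Idx → K} (hF : IsCoch k g F) :
    ∃ C ∈ cochains K k g, wf C = F := by
  have hb (w : Fin k → Idx) : mkForm F (g + k).toNat k (fun l => bas (w l)) =
      F (List.ofFn w) := by
    rw [mkForm_bas]
    split_ifs with h
    · rfl
    · obtain ⟨l, hl⟩ := not_forall.mp h
      exact (hF.eq_zero_of_notMem_window hl).symm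
  have hc := isCont_mkForm (k := k) F (g + k).toNat
  refine ⟨mkForm F (g + k).toNat k, ⟨?_, hc, ?_⟩, (wf_eq_iff hF.len).mpr hb⟩
  · intro p v hv i j hij
    refine eq_of_words (C := (mkForm F (g + k).toNat k).domDomCongr (Equiv.swap i j))
      (D := (-psgn K (p i) (p j)) • mkForm F (g + k).toNat k)
      (IsCont.domDomCongr hc _) (IsCont.smul hc _) (fun w hw => ?_) hv
    rw [MultilinearMap.domDomCongr_apply, smul_apply, hb,
      hb w, hF.skew.ofFn_swap w i j hij, ← hw, ← hw, psgn_pf,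
      smul_eq_mul]
  · intro n v hv hn
    obtain ⟨N, hN⟩ := IsCont.exists_expand hc
    rw [hN N le_rfl]
    refine Finset.sum_eq_zero fun w _ => ?_
    by_cases h0 : ∏ l, coef (w l) (v l) = 0
    · rw [h0, zero_mul]
    · rw [hb, hF.grade, mul_zero]
      rw [st_ofFn]
      rwa [Finset.sum_congr rfl fun l _ =>
        gr_eq_of_coef_ne_zero (hv l) (Finset.prod_ne_zero_iff.mp h0 l (by simp))]

end SMWord

namespace SMWord
open Idx OddContact
variable {K : Type*} [Field K]

/-! ### The differential of forms -/

/-- The recursion leaves the bracket in the place of the j-th letter. Skewness moves it to the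
front; the parity signs of `a` cancel, leaving (-1)^j and the signs of the j-th letter. -/
theorem lie_ofFn (c : Idx → K) (a : Idx) {m : ℕ} {F : List Idx → K} (hF : Skew F)
    (w : Fin (m + 1) → Idx) : lie (par a) c (op a) F (List.ofFn w) =
      ∑ j : Fin (m + 1), (-1) ^ ((j : ℕ) + par (w j) *
        ∑ l : Fin (m + 1), if l < j then par (w l) else 0) *
        (c (w j) * F (op a (w j) :: List.ofFn fun l => w (j.succAbove l))) := by
  induction m generalizing F with
  | zero => simp [lie_cons, lie_nil]
  | succ m ih =>
    rw [List.ofFn_succ, lie_cons, ih (hF.ins (w 0))]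
    conv_rhs => rw [Fin.sum_univ_succ]
    congr 1
    · simp
    · rw [Finset.mul_sum]
      refine Finset.sum_congr rfl fun j _ => ?_
      have hsum : (∑ l : Fin (m + 1 + 1), if l < j.succ then par (w l) else 0) =
          par (w 0) + ∑ l : Fin (m + 1), if l < j then par (w l.succ) else 0 := by
        rw [Fin.sum_univ_succ]
        simp only [Fin.succ_pos, if_true, Fin.succ_lt_succ_iff]
      rw [ins_apply, hF.swap, sg_op_right, List.ofFn_succ, hsum]
      simp only [Fin.succ_succAbove_zero, Fin.succ_succAbove_succ, Fin.succ_lt_succ_iff,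
        Fin.succ_pos, if_true, Fin.val_succ, sg]
      have h : ((-1 : K) ^ (par (w 0) * par a)) * (-1) ^ (par (w 0) * par a) = 1 := by
        rw [← mul_pow]; simp
      rw [mul_comm (par a)]
      generalize ((-1 : K) ^ (par (w 0) * par a)) = e at h ⊢
      rw [mul_add (par (w j.succ)), mul_comm (par (w j.succ)) (par (w 0)), pow_add, pow_add,
        pow_add, pow_add, pow_one]
      linear_combination (-1 : K) ^ (j : ℕ) * (-1) ^ (par (w j.succ) *
        ∑ i, if i < j then par (w i.succ) else 0) * (-1) ^ (par (w 0) * par (w j.succ)) *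
        (c (w j.succ) * F (op a (w j.succ) :: w 0 ::
          List.ofFn fun i => w (j.succAbove i).succ)) * -h

theorem dw_ofFn (c : Idx → Idx → K) {k : ℕ} {F : List Idx → K} (hF : Skew F)
    (w : Fin (k + 1) → Idx) : dw c F (List.ofFn w) =
      ∑ i : Fin (k + 1), ∑ j : Fin (k + 1), if i < j then
        (-1) ^ ((j : ℕ) + par (w j) * ∑ l : Fin (k + 1), if i < l ∧ l < j then par (w l) else 0) *
          (c (w i) (w j) * F (List.ofFn fun m =>
            Function.update w i (op (w i) (w j)) (j.succAbove m))) else 0 := by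
  induction k generalizing F with
  | zero => simp [dw_cons, dw_nil, lie_nil]
  | succ k ih =>
    rw [List.ofFn_succ, dw_cons, ih (hF.ins (w 0)), lie_ofFn _ _ hF, sub_eq_add_neg]
    conv_rhs => rw [Fin.sum_univ_succ]
    congr 1
    · conv_rhs => rw [Fin.sum_univ_succ, if_neg (lt_irrefl _), zero_add]
      rw [← Finset.sum_neg_distrib]
      refine Finset.sum_congr rfl fun j _ => ?_
      have hsum : (∑ l : Fin (k + 1 + 1), if 0 < l ∧ l < j.succ then par (w l) else 0) =
          ∑ l : Fin (k + 1), if l < j then par (w l.succ) else 0 := by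
        rw [Fin.sum_univ_succ]
        simp only [Fin.succ_pos, true_and, lt_irrefl, false_and, if_false, zero_add,
          Fin.succ_lt_succ_iff]
      rw [if_pos (Fin.succ_pos j), List.ofFn_succ, hsum]
      simp only [Fin.succ_succAbove_zero, Fin.succ_succAbove_succ, Fin.succ_lt_succ_iff,
        Fin.succ_pos, true_and, lt_irrefl, false_and, if_false, zero_add, Fin.val_succ,
        Function.update_self, ne_eq, Fin.succ_ne_zero, not_false_eq_true,
        Function.update_of_ne]
      ring
    · rw [← Finset.sum_neg_distrib]
      refine Finset.sum_congr rfl fun i _ => ?_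
      conv_rhs => rw [Fin.sum_univ_succ, if_neg (Fin.not_lt_zero _), zero_add]
      rw [← Finset.sum_neg_distrib]
      refine Finset.sum_congr rfl fun j _ => ?_
      simp only [Fin.succ_lt_succ_iff]
      split_ifs with hij
      · have hsum : (∑ l : Fin (k + 1 + 1), if i.succ < l ∧ l < j.succ then par (w l) else 0) =
            ∑ l : Fin (k + 1), if i < l ∧ l < j then par (w l.succ) else 0 := by
          rw [Fin.sum_univ_succ]
          simp only [Fin.not_lt_zero, false_and, if_false, zero_add, Fin.succ_lt_succ_iff]
        rw [hsum, List.ofFn_succ, ins_apply]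
        have h0 : Function.update w i.succ (op (w i.succ) (w j.succ)) 0 = w 0 :=
          Function.update_of_ne (Fin.succ_ne_zero i).symm _ _
        have hs (m : Fin (k + 1)) : Function.update w i.succ (op (w i.succ) (w j.succ)) m.succ =
            Function.update (fun l : Fin (k + 1) => w l.succ) i (op (w i.succ) (w j.succ)) m := by
          simp only [Function.update_apply, Fin.succ_inj]
        simp only [Fin.succ_succAbove_zero, Fin.succ_succAbove_succ, Fin.succ_lt_succ_iff,
          Fin.not_lt_zero, false_and, if_false, zero_add, Fin.val_succ, h0, hs]
        ring
      · simp

theorem dVal_eq {k : ℕ} (C : Form K k) (p : Fin (k + 1) → Fin 2) (v : Fin (k + 1) → SM K) :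
    dVal C p v = ∑ i : Fin (k + 1), ∑ j : Fin (k + 1), if i < j then
      (-1) ^ ((j : ℕ) + (p j : ℕ) * ∑ l : Fin (k + 1), if i < l ∧ l < j then (p l : ℕ) else 0) *
        C (fun m => Function.update v i (br (v i) (v j)) (j.succAbove m)) else 0 := by
  rw [dVal]
  refine Finset.sum_congr rfl fun i _ => ?_
  rw [← Finset.sum_filter]
  refine Finset.sum_congr (by ext; simp) fun j _ => ?_
  rw [← Finset.sum_filter]
  congr 4
  exact Finset.sum_congr (by ext; simp) fun _ _ => rfl

theorem contact_add_left (f g h : SFun K) : contact (f + g) h = contact f h + contact g h := by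
  apply sfun_ext <;> simp [contact_zero_zero, contact_zero_one, contact_one_zero,
    contact_one_one] <;> ring

theorem contact_add_right (f g h : SFun K) : contact f (g + h) = contact f g + contact f h := by
  apply sfun_ext <;> simp [contact_zero_zero, contact_zero_one, contact_one_zero,
    contact_one_one] <;> ring

theorem contact_smul_left (c : K) (f g : SFun K) : contact (c • f) g = c • contact f g := by
  apply sfun_ext <;> simp [contact_zero_zero, contact_zero_one, contact_one_zero,
    contact_one_one, PowerSeries.smul_eq_C_mul] <;> ring

theorem contact_smul_right (c : K) (f g : SFun K) : contact f (c • g) = c • contact f g := by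
  apply sfun_ext <;> simp [contact_zero_zero, contact_zero_one, contact_one_zero,
    contact_one_one, PowerSeries.smul_eq_C_mul] <;> ring

/-- The bracket as a bilinear map. -/
noncomputable def brL : SM K →ₗ[K] SM K →ₗ[K] SM K :=
  LinearMap.mk₂ K br
    (fun f g h => Subtype.ext (contact_add_left f.1 g.1 h.1))
    (fun c f g => Subtype.ext (contact_smul_left c f.1 g.1))
    (fun f g h => Subtype.ext (contact_add_right f.1 g.1 h.1))
    (fun c f g => Subtype.ext (contact_smul_right c f.1 g.1))

theorem brL_apply (u v : SM K) : brL u v = br u v := rfl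

theorem dvd_derivative {N : ℕ} {f : PowerSeries K} (h : PowerSeries.X ^ (N + 1) ∣ f) :
    PowerSeries.X ^ N ∣ PowerSeries.derivative K f := by
  rw [PowerSeries.X_pow_dvd_iff] at h ⊢
  intro m hm
  rw [PowerSeries.coeff_derivative, h _ (by omega), zero_mul]

/-- The bracket is of first order, so it loses at most one power of x. Working modulo x^N makes
every summand vanish. -/
theorem dvd_contact_left {N : ℕ} {f : SFun K} (g : SFun K)
    (h : ∀ a b, (PowerSeries.X : PowerSeries K) ^ (N + 1) ∣ f a b) (a b : Fin 2) :
    PowerSeries.X ^ N ∣ contact f g a b := by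
  have h1 (a b) := (pow_dvd_pow _ N.le_succ).trans (h a b)
  have h2 (a b) := dvd_derivative (h a b)
  simp only [← Ideal.mem_span_singleton, ← Ideal.Quotient.eq_zero_iff_mem] at h1 h2 ⊢
  fin_cases a <;> fin_cases b <;> simp [contact_zero_zero, contact_zero_one, contact_one_zero,
    contact_one_one, h1, h2]

theorem dvd_contact_right {N : ℕ} (f : SFun K) {g : SFun K}
    (h : ∀ a b, (PowerSeries.X : PowerSeries K) ^ (N + 1) ∣ g a b) (a b : Fin 2) :
    PowerSeries.X ^ N ∣ contact f g a b := by
  have h1 (a b) := (pow_dvd_pow _ N.le_succ).trans (h a b)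
  have h2 (a b) := dvd_derivative (h a b)
  simp only [← Ideal.mem_span_singleton, ← Ideal.Quotient.eq_zero_iff_mem] at h1 h2 ⊢
  fin_cases a <;> fin_cases b <;> simp [contact_zero_zero, contact_zero_one, contact_one_zero,
    contact_one_one, h1, h2]

section contraction
variable {k : ℕ} (C : Form K k) (j : Fin (k + 1)) (i : Fin k)

theorem update_update_succAbove (v : Fin (k + 1) → SM K) (l : Fin (k + 1)) (x y : SM K) :
    (fun m => Function.update (Function.update v l x) (j.succAbove i) y (j.succAbove m)) =
      if h : ∃ l', j.succAbove l' = l ∧ l' ≠ i then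
        Function.update (Function.update (fun m => v (j.succAbove m)) i y) h.choose x
      else Function.update (fun m => v (j.succAbove m)) i y := by
  funext m
  split_ifs with h
  · obtain ⟨h1, h2⟩ := h.choose_spec
    generalize h.choose = l' at h1 h2 ⊢
    subst h1
    simp only [Function.update_apply, Fin.succAbove_right_inj]
    split_ifs <;> simp_all
  · simp only [Function.update_apply, Fin.succAbove_right_inj]
    split_ifs with h1 h2
    · rfl
    · exact absurd ⟨m, h2, h1⟩ h
    · rfl

/-- The slot `l` is either an untouched argument of `C`, or the removed entry of the bracket, or the
entry that the bracket replaces. In each case linearity comes from `C`, composed in the last two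
with the bracket. -/
theorem contraction_linear {v : Fin (k + 1) → SM K} (l : Fin (k + 1)) :
    ∃ φ : SM K →ₗ[K] K, ∀ x,
      C (fun m => Function.update (Function.update v l x) (j.succAbove i)
        (br (Function.update v l x (j.succAbove i)) (Function.update v l x j))
          (j.succAbove m)) = φ x := by
  simp only [update_update_succAbove]
  split_ifs with h
  · obtain ⟨h1, h2⟩ := h.choose_spec
    generalize h.choose = l' at h1 h2 ⊢
    subst h1
    refine ⟨C.toLinearMap (Function.update (fun m => v (j.succAbove m)) i
      (br (v (j.succAbove i)) (v j))) l', fun x => ?_⟩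
    rw [MultilinearMap.toLinearMap_apply,
      Function.update_of_ne (fun h => h2 (Fin.succAbove_right_injective h).symm),
      Function.update_of_ne (Fin.succAbove_ne j l').symm]
  · rcases eq_or_ne l j with rfl | hj
    · refine ⟨(C.toLinearMap (fun m => v (l.succAbove m)) i).comp
        (brL (v (l.succAbove i))), fun x => ?_⟩
      rw [LinearMap.comp_apply, MultilinearMap.toLinearMap_apply, brL_apply,
        Function.update_self, Function.update_of_ne (Fin.succAbove_ne l i)]
    · obtain ⟨l', rfl⟩ := Fin.exists_succAbove_eq hj
      obtain rfl : l' = i := by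
        by_contra h'
        exact h ⟨l', rfl, h'⟩
      refine ⟨(C.toLinearMap (fun m => v (j.succAbove m)) l').comp (brL.flip (v j)),
        fun x => ?_⟩
      rw [LinearMap.comp_apply, MultilinearMap.toLinearMap_apply, LinearMap.flip_apply,
        brL_apply, Function.update_self, Function.update_of_ne (Fin.succAbove_ne j l').symm]

/-- The form obtained by inserting the bracket of two arguments. -/
noncomputable def contraction : Form K (k + 1) where
  toFun v := C (fun m => Function.update v (j.succAbove i)
    (br (v (j.succAbove i)) (v j)) (j.succAbove m))
  map_update_add' := by
    intro inst v l x y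
    obtain rfl : inst = instDecidableEqFin (k + 1) := Subsingleton.elim _ _
    obtain ⟨φ, h⟩ := contraction_linear C j i (v := v) l
    simp only [h, map_add]
  map_update_smul' := by
    intro inst v l c x
    obtain rfl : inst = instDecidableEqFin (k + 1) := Subsingleton.elim _ _
    obtain ⟨φ, h⟩ := contraction_linear C j i (v := v) l
    simp only [h, map_smul]

theorem isCont_contraction (hC : IsCont C) : IsCont (contraction C j i) := by
  obtain ⟨N, hN⟩ := hC
  refine ⟨N + 1, fun v l h => ?_⟩
  change C _ = 0
  rcases eq_or_ne l j with rfl | hj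
  · refine hN _ i fun a b => ?_
    rw [Function.update_self]
    exact dvd_contact_right _ h a b
  · obtain ⟨l', rfl⟩ := Fin.exists_succAbove_eq hj
    refine hN _ l' fun a b => ?_
    rcases eq_or_ne l' i with rfl | h'
    · rw [Function.update_self]
      exact dvd_contact_left _ h a b
    · rw [Function.update_of_ne fun h => h' (Fin.succAbove_right_injective h)]
      exact (pow_dvd_pow _ N.le_succ).trans (h a b)

end contraction

variable [CharZero K]

/-- With the parities frozen, the differential formula is multilinear and continuous in all
arguments, homogeneous or not. It can thus be compared with another form on words. -/
theorem exists_dVal_form {k : ℕ} {C : Form K k} (hC : IsCont C) (p : Fin (k + 1) → Fin 2) :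
    ∃ D : Form K (k + 1), IsCont D ∧ ∀ v, D v = dVal C p v := by
  have h (i j : Fin (k + 1)) : ∃ D : Form K (k + 1), IsCont D ∧ ∀ v, D v =
      if i < j then (-1) ^ ((j : ℕ) + (p j : ℕ) * ∑ l : Fin (k + 1), if i < l ∧ l < j then (p l : ℕ) else 0) *
        C (fun m => Function.update v i (br (v i) (v j)) (j.succAbove m)) else 0 := by
    split_ifs with hij
    · obtain ⟨i', rfl⟩ := Fin.exists_succAbove_eq hij.ne
      exact ⟨_, IsCont.smul (isCont_contraction C j i' hC) _, fun v => rfl⟩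
    · exact ⟨0, isCont_zero, fun v => rfl⟩
  choose D hD hD' using h
  refine ⟨∑ i, ∑ j, D i j, isCont_sum _ fun i _ => isCont_sum _ fun j _ => hD i j, fun v => ?_⟩
  rw [dVal_eq]
  simp only [sum_apply, hD']

theorem dVal_bas {k : ℕ} {C : Form K k} (hC : Skew (wf C)) (w : Fin (k + 1) → Idx) :
    dVal C (fun l => pf (w l)) (fun l => bas (w l)) = dw (cs K) (wf C) (List.ofFn w) := by
  rw [dw_ofFn _ hC, dVal_eq]
  refine Finset.sum_congr rfl fun i _ => Finset.sum_congr rfl fun j _ => ?_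
  split_ifs with hij
  · simp only [coe_pf]
    congr 1
    rw [wf_ofFn]
    obtain ⟨i', rfl⟩ := Fin.exists_succAbove_eq hij.ne
    have h (x : SM K) : (fun m => Function.update (fun l => bas (w l)) (j.succAbove i') x
        (j.succAbove m)) = Function.update (fun m => bas (w (j.succAbove m))) i' x := by
      funext m
      simp only [Function.update_apply, Fin.succAbove_right_inj]
    rw [h, br_bas, C.map_update_smul, smul_eq_mul]
    congr 2
    funext m
    simp only [Function.update_apply, Fin.succAbove_right_inj]
    split_ifs <;> rfl
  · rfl

theorem isDiff_iff {k : ℕ} {C : Form K k} {D : Form K (k + 1)} (hC : IsCont C)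
    (hs : Skew (wf C)) (hD : IsCont D) : IsDiff C D ↔ wf D = dw (cs K) (wf C) := by
  have hl : Supp (fun _ => 1) ((k + 1 : ℕ) : ℤ) (dw (cs K) (wf C)) := by
    have h := (supp_wf C).dw (c := cs K) (e := -1) (by simp)
    push_cast
    simpa using h
  rw [wf_eq_iff hl]
  constructor
  · intro h w
    rw [h _ _ fun l => hasParity_bas (w l), dVal_bas hs]
  · intro h p v hv
    obtain ⟨D', hD', h'⟩ := exists_dVal_form hC p
    rw [← h' v]
    refine eq_of_words hD hD' (fun w hw => ?_) hv
    obtain rfl : (fun l => pf (w l)) = p := funext hw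
    rw [h, h', dVal_bas hs]

end SMWord

namespace SMWord
open Idx OddContact
variable {K : Type*} [Field K] [CharZero K]

/-! ### Cohomology -/

theorem mem_cocycles_iff {k : ℕ} {g : ℤ} {C : Form K k} :
    C ∈ cocycles K k g ↔ C ∈ cochains K k g ∧ dw (cs K) (wf C) = 0 := by
  refine and_congr_right fun hC => ?_
  rw [isDiff_iff hC.2.1 (isCoch_wf hC).skew isCont_zero, wf_zero, eq_comm]

theorem IsCoch.eq_zero_of_neg {k g : ℤ} {F : List Idx → K} (hF : IsCoch k g F) (hk : k < 0) :
    F = 0 := by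
  funext l
  exact hF.apply_eq_zero (by omega)

theorem exists_dw_of_mem_coboundaries {k : ℕ} {g : ℤ} {C : Form K k}
    (h : C ∈ coboundaries K k g) : ∃ z, IsCoch ((k : ℤ) - 1) g z ∧ wf C = dw (cs K) z := by
  rcases k with _ | k
  · obtain rfl : C = 0 := h
    exact ⟨0, .zero _ _, by rw [wf_zero, dw_zero]⟩
  · obtain ⟨D, hD, hd⟩ := h
    have hs := isCoch_wf hD
    refine ⟨wf D, by simpa using hs, ?_⟩
    have hl : Supp (fun _ => 1) ((k + 1 : ℕ) : ℤ) (dw (cs K) (wf D)) := by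
      rw [Nat.cast_succ]
      exact hs.dw.len
    refine (wf_eq_iff hl).mpr fun w => ?_
    rw [hd _ _ fun l => hasParity_bas (w l), dVal_bas hs.skew]

theorem mem_coboundaries {k : ℕ} {g : ℤ} {C : Form K k} (hC : IsCont C) {z : List Idx → K}
    (hz : IsCoch ((k : ℤ) - 1) g z) (h : wf C = dw (cs K) z) : C ∈ coboundaries K k g := by
  rcases k with _ | k
  · rw [hz.eq_zero_of_neg (by simp), dw_zero, ← wf_zero (k := 0)] at h
    exact wf_injective hC isCont_zero h
  · obtain ⟨D, hD, rfl⟩ := IsCoch.exists_form (k := k) (g := g) (F := z) (by simpa using hz)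
    exact ⟨D, hD, (isDiff_iff hD.2.1 (isCoch_wf hD).skew hC).mpr h⟩

theorem mem_coboundaries_of_not_gen {k : ℕ} {g : ℤ}
    (h : ¬((g = (k : ℤ) - 2 ∧ 1 ≤ k ∧ k ≠ 2) ∨ g = -(k : ℤ))) {C : Form K k}
    (hC : C ∈ cocycles K k g) : C ∈ coboundaries K k g := by
  obtain ⟨hC, hd⟩ := mem_cocycles_iff.mp hC
  obtain ⟨z, hz, hz'⟩ := exists_dw_of_not_gen (isCoch_wf hC) hd fun n r h1 h2 => by
    omega
  exact mem_coboundaries hC.2.1 hz hz'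

/-- The generator is basic with nonzero detecting value; these two properties are what the
evaluation of explicit expressions uses. -/
theorem exists_generator {n r k : ℕ} {g : ℤ} (hk : k = n + r) (hg : g = (n : ℤ) - r)
    (h : n = 0 ∨ (r = 1 ∧ 2 ≤ n)) :
    ∃ A ∈ cocycles K k g, Basic (wf A) ∧
      wf A (List.replicate r T ++ List.replicate n (O 1)) ≠ 0 ∧ A ∉ coboundaries K k g ∧
      ∀ C ∈ cocycles K k g, ∃ c : K, C - c • A ∈ coboundaries K k g := by
  subst hk hg
  obtain ⟨A, hA, hb, hd, h0⟩ := exists_generator_basic (K := K) n r (by omega)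
  obtain ⟨A, hA', rfl⟩ := IsCoch.exists_form (k := n + r) (by push_cast; exact hA)
  refine ⟨A, mem_cocycles_iff.mpr ⟨hA', hd⟩, hb, h0, fun hB => ?_, fun C hC => ?_⟩
  · obtain ⟨z, hz, hz'⟩ := exists_dw_of_mem_coboundaries hB
    exact not_exists_dw (by push_cast; rfl) rfl h hb h0 hz hz'
  · obtain ⟨hC, hCd⟩ := mem_cocycles_iff.mp hC
    obtain ⟨C', z, hC', hb', hd', hz, e⟩ := exists_basic (isCoch_wf hC) hCd
    obtain ⟨c, z', hz', e'⟩ := exists_dw_of_ne hC' hb' hd' (by push_cast; rfl) rfl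
      (isCoch_wf hA') hb hd h0
    refine ⟨c, mem_coboundaries (sub_mem hC (Submodule.smul_mem _ c hA')).2.1 (hz'.add hz) ?_⟩
    have h' : C - c • A = C + (-c) • A := by module
    rw [h', wf_add, wf_smul, e, e', dw_add]
    module

theorem rank_coh (k : ℕ) (g : ℤ) : Module.rank K (Coh K k g) =
    if (g = (k : ℤ) - 2 ∧ 1 ≤ k ∧ k ≠ 2) ∨ g = -(k : ℤ) then 1 else 0 := by
  split_ifs with h
  · obtain ⟨n, r, hk, hg, hnr⟩ : ∃ n r : ℕ, k = n + r ∧ g = (n : ℤ) - r ∧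
        (n = 0 ∨ (r = 1 ∧ 2 ≤ n)) := by
      by_cases hg : g = -(k : ℤ)
      · exact ⟨0, k, by omega, by omega, Or.inl rfl⟩
      · exact ⟨k - 1, 1, by omega, by omega, Or.inr ⟨rfl, by omega⟩⟩
    obtain ⟨A, hA, -, -, hB, hspan⟩ := exists_generator (K := K) hk hg hnr
    refine rank_eq_one (Submodule.Quotient.mk ⟨A, hA⟩) (fun h0 => hB ?_) fun q => ?_
    · rw [Submodule.Quotient.mk_eq_zero] at h0
      exact h0
    · obtain ⟨⟨C, hC⟩, rfl⟩ := Submodule.Quotient.mk_surjective _ q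
      obtain ⟨c, hc⟩ := hspan C hC
      refine ⟨c, ?_⟩
      rw [← Submodule.Quotient.mk_smul, eq_comm, Submodule.Quotient.eq]
      exact hc
  · have : Subsingleton (Coh K k g) := by
      refine Submodule.Quotient.subsingleton_iff.mpr (eq_top_iff.mpr ?_)
      exact fun C _ => mem_coboundaries_of_not_gen h C.2
    exact rank_subsingleton' _ _

end SMWord

namespace SMWord
open Idx OddContact
variable {K : Type*} [Field K]

/-! ### The exterior product of forms -/

/-- The subword of the letters at the places where `χ` is true. -/
def pick {n : ℕ} (χ : Fin n → Bool) (w : Fin n → Idx) : List Idx :=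
  ((List.finRange n).filter χ).map w

theorem pick_succ {n : ℕ} (χ : Fin (n + 1) → Bool) (w : Fin (n + 1) → Idx) : pick χ w =
    if χ 0 then w 0 :: pick (fun i => χ i.succ) (fun i => w i.succ)
      else pick (fun i => χ i.succ) (fun i => w i.succ) := by
  simp only [pick, List.finRange_succ, List.filter_cons, List.filter_map]
  split_ifs <;> simp [Function.comp_def]

theorem prod_map_pick {n : ℕ} (χ : Fin n → Bool) (w : Fin n → Idx) (σ : Idx → K) :
    ((pick χ w).map σ).prod = ∏ i, if χ i then σ (w i) else 1 := by
  induction n with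
  | zero => simp [pick]
  | succ n ih =>
    rw [pick_succ, Fin.prod_univ_succ]
    split_ifs <;> simp [ih]

theorem sum_bool_fun {n : ℕ} (f : (Fin (n + 1) → Bool) → K) : ∑ χ, f χ =
    ∑ χ : Fin n → Bool, f (Fin.cons true χ) + ∑ χ : Fin n → Bool, f (Fin.cons false χ) := by
  rw [← Fintype.sum_equiv (Fin.consEquiv fun _ => Bool) (fun x => f (Fin.cons x.1 x.2)) f
    (fun _ => rfl), Fintype.sum_prod_type, Fintype.sum_bool]

theorem wedge_ofFn {n : ℕ} (F G : List Idx → K) (w : Fin n → Idx) :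
    wedge F G (List.ofFn w) = ∑ χ : Fin n → Bool,
      (∏ i : Fin n, ∏ j : Fin n, if χ i ∧ ¬χ j ∧ j < i then -sg K (w i) (w j) else 1) *
        (F (pick χ w) * G (pick (fun i => !χ i) w)) := by
  induction n generalizing F G with
  | zero => simp [wedge, pick]
  | succ n ih =>
    rw [List.ofFn_succ, wedge_cons, ih, ih, sum_bool_fun]
    congr 1 <;> refine Finset.sum_congr rfl fun χ _ => ?_
    · simp [pick_succ, Fin.prod_univ_succ, ins]
    · simp [pick_succ, Fin.prod_univ_succ, ins, tw, prod_map_pick, pass, Finset.prod_mul_distrib,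
        -ite_mul]
      ring

theorem pick_eq_ofFn {n k : ℕ} (S : Finset (Fin n)) (h : S.card = k) (χ : Fin n → Bool)
    (hχ : ∀ i, χ i ↔ i ∈ S) (w : Fin n → Idx) :
    pick χ w = List.ofFn fun l => w (S.orderEmbOfFin h l) := by
  have h1 : (List.finRange n).filter χ = List.ofFn (S.orderEmbOfFin h) := by
    refine List.SortedLT.eq_of_mem_iff (List.sortedLT_iff_pairwise.mpr
      ((List.sortedLT_finRange n).pairwise.filter _))
      (S.orderEmbOfFin h).strictMono.sortedLT_ofFn fun i => ?_
    rw [List.mem_filter, List.mem_ofFn', Finset.range_orderEmbOfFin]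
    simp [hχ]
  rw [pick, h1, List.map_ofFn]
  rfl

theorem length_pick {n : ℕ} (S : Finset (Fin n)) (χ : Fin n → Bool)
    (hχ : ∀ i, χ i ↔ i ∈ S) (w : Fin n → Idx) : (pick χ w).length = S.card := by
  rw [pick_eq_ofFn S rfl χ hχ, List.length_ofFn]

variable [CharZero K]

/-- The recursion of `wedge` sums over all ways to mark letters. Markings with the wrong number of
letters vanish since `wf A` is supported on words of length `k`; the others are the subsets of size
`k`. -/
theorem wedge_wf_ofFn {k m : ℕ} (A : Form K k) (B : Form K m) (w : Fin (k + m) → Idx) :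
    wedge (wf A) (wf B) (List.ofFn w) = ∑ S : {S : Finset (Fin (k + m)) // S.card = k},
      (∏ i ∈ S.1, ∏ j ∈ S.1ᶜ with j < i, -sg K (w i) (w j)) *
        (A (fun l => bas (w (S.1.orderEmbOfFin S.2 l))) *
          B (fun l => bas (w (S.1ᶜ.orderEmbOfFin
            (by rw [Finset.card_compl, S.2, Fintype.card_fin, Nat.add_sub_cancel_left]) l)))) := by
  rw [wedge_ofFn]
  symm
  refine Finset.sum_of_injOn (fun S i => decide (i ∈ S.1)) (fun S _ S' _ h => ?_)
    (fun _ _ => Finset.mem_univ _) (fun χ _ hχ => ?_) (fun S _ => ?_)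
  · ext i
    simpa using congrFun h i
  · have hS (i) : χ i ↔ i ∈ Finset.univ.filter fun i => χ i = true := by simp
    have hl := length_pick _ χ hS w
    rw [wf_of_length_ne A, zero_mul, mul_zero]
    rw [hl]
    intro hk
    refine hχ ⟨⟨_, hk⟩, by simp, ?_⟩
    funext i
    simp
  · rw [pick_eq_ofFn S.1 S.2 _ (by simp), pick_eq_ofFn S.1ᶜ
      (by rw [Finset.card_compl, S.2, Fintype.card_fin, Nat.add_sub_cancel_left]) _ (by simp),
      wf_ofFn, wf_ofFn]
    congr 1
    rw [← Finset.univ_inter S.1, ← Finset.prod_ite_mem]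
    refine Finset.prod_congr rfl fun i _ => ?_
    split_ifs with hi
    · rw [← Finset.prod_filter]
      exact Finset.prod_congr (by ext j; simp [hi]) fun _ _ => rfl
    · simp [hi]

theorem exists_wedge_form {k m : ℕ} {A : Form K k} {B : Form K m} (hA : IsCont A)
    (hB : IsCont B) (p : Fin (k + m) → Fin 2) : ∃ D : Form K (k + m), IsCont D ∧ ∀ v, D v =
      ∑ S : {S : Finset (Fin (k + m)) // S.card = k},
        (∏ i ∈ S.1, ∏ j ∈ S.1ᶜ with j < i, -psgn K (p i) (p j)) *
          (A (fun l => v (S.1.orderEmbOfFin S.2 l)) *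
            B (fun l => v (S.1ᶜ.orderEmbOfFin
              (by rw [Finset.card_compl, S.2, Fintype.card_fin, Nat.add_sub_cancel_left]) l))) := by
  have h (S : {S : Finset (Fin (k + m)) // S.card = k}) (hS : S.1ᶜ.card = m) :
      ∃ D : Form K (k + m), IsCont D ∧ ∀ v, D v = A (fun l => v (S.1.orderEmbOfFin S.2 l)) *
        B (fun l => v (S.1ᶜ.orderEmbOfFin hS l)) := by
    have hD (v : Fin (k + m) → SM K) : (LinearMap.mul' K K).compMultilinearMap
        ((A.domCoprod B).domDomCongr (finSumEquivOfFinset S.2 hS)) v =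
          A (fun l => v (S.1.orderEmbOfFin S.2 l)) *
            B (fun l => v (S.1ᶜ.orderEmbOfFin hS l)) := by
      simp
    refine ⟨_, ?_, hD⟩
    obtain ⟨M, hM⟩ := hA
    obtain ⟨N, hN⟩ := hB
    refine ⟨max M N, fun v l hl => ?_⟩
    rw [hD]
    obtain ⟨i, rfl⟩ := (finSumEquivOfFinset S.2 hS).surjective l
    rcases i with i | i
    · rw [finSumEquivOfFinset_inl] at hl
      rw [hM _ i fun a b => (pow_dvd_pow _ (le_max_left M N)).trans (hl a b), zero_mul]
    · rw [finSumEquivOfFinset_inr] at hl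
      rw [hN _ i fun a b => (pow_dvd_pow _ (le_max_right M N)).trans (hl a b), mul_zero]
  have hS (S : {S : Finset (Fin (k + m)) // S.card = k}) : S.1ᶜ.card = m := by
    rw [Finset.card_compl, S.2, Fintype.card_fin, Nat.add_sub_cancel_left]
  choose D hD hD' using fun S => h S (hS S)
  refine ⟨∑ S : {S : Finset (Fin (k + m)) // S.card = k},
    (∏ i ∈ S.1, ∏ j ∈ S.1ᶜ with j < i, -psgn K (p i) (p j)) • D S,
    isCont_sum _ fun S _ => IsCont.smul (hD S) _, fun v => ?_⟩
  simp only [sum_apply, smul_apply, hD', smul_eq_mul]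

theorem isWedge_of_wf {k m : ℕ} {A : Form K k} {B : Form K m} {W : Form K (k + m)}
    (hA : IsCont A) (hB : IsCont B) (hW : IsCont W) (h : wf W = wedge (wf A) (wf B)) :
    IsWedge A B W := by
  intro p v hv
  obtain ⟨D, hD, hD'⟩ := exists_wedge_form hA hB p
  rw [← hD']
  refine eq_of_words hW hD (fun w hw => ?_) hv
  rw [hD', ← wf_ofFn, h, wedge_wf_ofFn]
  simp only [← hw, psgn_pf]

theorem dw_cs_tw_neg_one (F : List Idx → K) :
    dw (cs K) (tw (fun _ => -1) F) = -tw (fun _ => -1) (dw (cs K) F) := by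
  rw [dw_tw (ρ := -1) (by simp), neg_smul, one_smul]

/-- If `A` lies in a bidegree with cohomology, then the grade condition and positive degrees put `B`
in a bidegree without. So one factor is exact, and the Leibniz rule makes the product exact. -/
theorem exists_isWedge_coboundary {k m : ℕ} {g h : ℤ} (hk : 1 ≤ k) (hm : 1 ≤ m)
    (hgh : g + h = ((k + m : ℕ) : ℤ) - 2) {A : Form K k} (hA : A ∈ cocycles K k g)
    {B : Form K m} (hB : B ∈ cocycles K m h) :
    ∃ W ∈ coboundaries K (k + m) (((k + m : ℕ) : ℤ) - 2), IsWedge A B W := by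
  obtain ⟨hA, hAd⟩ := mem_cocycles_iff.mp hA
  obtain ⟨hB, hBd⟩ := mem_cocycles_iff.mp hB
  have hA' := isCoch_wf hA
  have hB' := isCoch_wf hB
  have hAB := hA'.wedge hB'
  rw [hgh, ← Nat.cast_add] at hAB
  obtain ⟨W, hW, hW'⟩ := IsCoch.exists_form hAB
  refine ⟨W, ?_, isWedge_of_wf hA.2.1 hB.2.1 hW.2.1 hW'⟩
  by_cases hg : (g = (k : ℤ) - 2 ∧ 1 ≤ k ∧ k ≠ 2) ∨ g = -(k : ℤ)
  · obtain ⟨z, hz, e⟩ := exists_dw_of_not_gen hB' hBd fun n r h1 h2 => by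
      push_cast at hgh
      omega
    -- The twist by -1 compensates the sign in the Leibniz rule.
    refine mem_coboundaries hW.2.1 (z := wedge (tw (fun _ => -1) (wf A)) z) ?_ ?_
    · have := (hA'.tw (fun _ => -1)).wedge hz
      rw [hgh] at this
      convert this using 1
      push_cast
      ring
    · rw [hW', dw_wedge, dw_cs_tw_neg_one, hAd, tw_tw, e]
      have h1 : (fun _ => -1 : Idx → K) * (fun _ => -1) = fun _ => 1 := by funext; simp
      have h2 : tw (fun _ => (1 : K)) (wf A) = wf A := by funext l; simp [tw]
      have h3 : tw (fun _ => (-1 : K)) 0 = 0 := by funext l; simp [tw]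
      rw [h1, h2, h3, neg_zero, zero_wedge, zero_add]
  · obtain ⟨z, hz, e⟩ := exists_dw_of_not_gen hA' hAd fun n r h1 h2 => by omega
    refine mem_coboundaries hW.2.1 (z := wedge z (wf B)) ?_ ?_
    · have := hz.wedge hB'
      rw [hgh] at this
      convert this using 1
      push_cast
      ring
    · rw [hW', dw_wedge, hBd, wedge_zero, add_zero, ← e]

end SMWord

namespace SMWord
open Idx OddContact
variable {K : Type*} [Field K] [CharZero K]

/-! ### Explicit expressions for the generators in degrees three and four -/

/-- The argument word is chosen so that the coboundary value is a multiple of the difference of two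
expressions, once terms are reordered and words with a repeated even letter are dropped. The
analogous lemmas below work in the same way. -/
theorem gen_three_sub_one {F : List Idx → K} (hF : Skew F) :
    F [E 1, E 2, O 0] - F [E 0, E 1, O 2] =
      -1/2 * dw (cs K) F [E 0, E 1, E 2, O 1] := by
  have e0 : dw (cs K) F [E 0, E 1, E 2, O 1] =
      -4 * F [E 1, E 1, O 1] - 2 * F [E 1, E 2, O 0] + 2 * F [E 0, E 1, O 2] := by
    simp [dw, lie, ins, cs, op, par]
    ring
  have h0 : F [E 1, E 1, O 1] = -F [E 1, E 1, O 1] := by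
    simpa [sg, par] using hF [] (E 1) (E 1) [O 1]
  linear_combination 1/2 * e0 - h0

theorem gen_three_sub_two {F : List Idx → K} (hF : Skew F) :
    F [E 1, E 2, O 0] - 4 * F [T, O 1, O 1] + F [E 0, E 2, O 1] - 2 * F [T, O 0, O 2] =
      -dw (cs K) F [E 2, T, O 0, O 1] := by
  have e0 : dw (cs K) F [E 2, T, O 0, O 1] =
      4 * F [T, O 1, O 1] + 2 * F [T, O 0, O 2] + F [E 2, E 0, O 1] - F [E 2, O 0, E 1] := by
    simp [dw, lie, ins, cs, op, par]
    ring
  have h0 : F [E 2, E 0, O 1] = -F [E 0, E 2, O 1] := by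
    simpa [sg, par] using hF [] (E 2) (E 0) [O 1]
  have h1 : F [E 2, O 0, E 1] = -F [E 2, E 1, O 0] := by
    simpa [sg, par] using hF [E 2] (O 0) (E 1) []
  have h2 : F [E 2, E 1, O 0] = -F [E 1, E 2, O 0] := by
    simpa [sg, par] using hF [] (E 2) (E 1) [O 0]
  linear_combination e0 + h0 - h1 + h2

/-- On a coboundary both values are multiples of `F [E 1, O 1]`, and the coefficient 2 balances
them. In degree four `F [E 1, O 0, O 2]` appears as well, which the term with E_3 removes. -/
theorem gen_three_dw {F : List Idx → K} (hF : Skew F) :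
    dw (cs K) F [E 1, E 2, O 0] - 2 * dw (cs K) F [T, O 1, O 1] = 0 := by
  have e0 : dw (cs K) F [E 1, E 2, O 0] =
      -4 * F [E 1, O 1] := by
    simp [dw, lie, ins, cs, op, par]
    ring
  have e1 : dw (cs K) F [T, O 1, O 1] =
      -F [E 1, O 1] + F [O 1, E 1] := by
    simp [dw, lie, ins, cs, op, par]
    ring
  have h0 : F [O 1, E 1] = -F [E 1, O 1] := by
    simpa [sg, par] using hF [] (O 1) (E 1) []
  linear_combination e0 - 2 * e1 - 2 * h0

theorem gen_four_sub_one {F : List Idx → K} (hF : Skew F) :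
    F [E 1, E 2, O 0, O 1] - F [E 0, E 1, O 1, O 2] =
      -1/4 * dw (cs K) F [E 0, E 1, E 2, O 0, O 2] := by
  have e0 : dw (cs K) F [E 0, E 1, E 2, O 0, O 2] =
      -4 * F [E 1, E 1, O 0, O 2] - 4 * F [E 1, E 2, O 0, O 1] + 4 * F [E 0, E 1, O 1, O 2] := by
    simp [dw, lie, ins, cs, op, par]
    ring
  have h0 : F [E 1, E 1, O 0, O 2] = -F [E 1, E 1, O 0, O 2] := by
    simpa [sg, par] using hF [] (E 1) (E 1) [O 0, O 2]
  linear_combination 1/4 * e0 - 1/2 * h0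

theorem gen_four_sub_two {F : List Idx → K} (hF : Skew F) :
    F [E 1, E 2, O 0, O 1] - 2 * F [T, O 1, O 1, O 1] + 1/2 * F [E 0, E 2, O 1, O 1] - 2 * F [T, O 0, O 1, O 2] =
      -1/2 * dw (cs K) F [E 2, T, O 0, O 1, O 1] := by
  have e0 : dw (cs K) F [E 2, T, O 0, O 1, O 1] =
      4 * F [T, O 1, O 1, O 1] + 2 * F [T, O 0, O 2, O 1] + 2 * F [T, O 0, O 1, O 2] + F [E 2, E 0, O 1, O 1] - F [E 2, O 0, E 1, O 1] + F [E 2, O 0, O 1, E 1] := by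
    simp [dw, lie, ins, cs, op, par]
    ring
  have h0 : F [T, O 0, O 2, O 1] = F [T, O 0, O 1, O 2] := by
    simpa [sg, par] using hF [T, O 0] (O 2) (O 1) []
  have h1 : F [E 2, E 0, O 1, O 1] = -F [E 0, E 2, O 1, O 1] := by
    simpa [sg, par] using hF [] (E 2) (E 0) [O 1, O 1]
  have h2 : F [E 2, O 0, E 1, O 1] = -F [E 2, E 1, O 0, O 1] := by
    simpa [sg, par] using hF [E 2] (O 0) (E 1) [O 1]
  have h3 : F [E 2, E 1, O 0, O 1] = -F [E 1, E 2, O 0, O 1] := by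
    simpa [sg, par] using hF [] (E 2) (E 1) [O 0, O 1]
  have h4 : F [E 2, O 0, O 1, E 1] = -F [E 2, O 0, E 1, O 1] := by
    simpa [sg, par] using hF [E 2, O 0] (O 1) (E 1) []
  linear_combination 1/2 * e0 + h0 + 1/2 * h1 - h2 + h3 + 1/2 * h4

theorem gen_four_dw {F : List Idx → K} (hF : Skew F) :
    dw (cs K) F [E 1, E 2, O 0, O 1] - 1/6 * dw (cs K) F [E 1, E 3, O 0, O 0] - 4/3 * dw (cs K) F [T, O 1, O 1, O 1] = 0 := by
  have e0 : dw (cs K) F [E 1, E 2, O 0, O 1] =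
      -4 * F [E 1, O 1, O 1] - 2 * F [E 1, O 0, O 2] := by
    simp [dw, lie, ins, cs, op, par]
    ring
  have e1 : dw (cs K) F [E 1, E 3, O 0, O 0] =
      -6 * F [E 1, O 2, O 0] - 6 * F [E 1, O 0, O 2] := by
    simp [dw, lie, ins, cs, op, par]
    ring
  have e2 : dw (cs K) F [T, O 1, O 1, O 1] =
      -F [E 1, O 1, O 1] + F [O 1, E 1, O 1] - F [O 1, O 1, E 1] := by
    simp [dw, lie, ins, cs, op, par]
    ring
  have h0 : F [E 1, O 2, O 0] = F [E 1, O 0, O 2] := by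
    simpa [sg, par] using hF [E 1] (O 2) (O 0) []
  have h1 : F [O 1, E 1, O 1] = -F [E 1, O 1, O 1] := by
    simpa [sg, par] using hF [] (O 1) (E 1) [O 1]
  have h2 : F [O 1, O 1, E 1] = -F [O 1, E 1, O 1] := by
    simpa [sg, par] using hF [O 1] (O 1) (E 1) []
  linear_combination e0 - 1/6 * e1 - 4/3 * e2 + h0 - 8/3 * h1 + 4/3 * h2

end SMWord

namespace SMWord
open Idx OddContact
variable {K : Type*} [Field K] [CharZero K]

/-! ### Coordinates on cohomology -/

/-- Every cocycle is a multiple of a basic generator plus a coboundary, so a linear expression that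
kills coboundaries is determined by its value there. -/
theorem isCoordinate_of_generator {n r k : ℕ} {g : ℤ} (hk : k = n + r) (hg : g = (n : ℤ) - r)
    (h : n = 0 ∨ (r = 1 ∧ 2 ≤ n)) {y : Form K k → K}
    (hy : ∀ (c : K) (C D : Form K k), y (c • C + D) = c * y C + y D)
    (hB : ∀ C ∈ coboundaries K k g, y C = 0)
    (hA : ∀ A ∈ cocycles K k g, Basic (wf A) →
      wf A (List.replicate r T ++ List.replicate n (O 1)) ≠ 0 → y A ≠ 0) :
    IsCoordinate k g y := by
  obtain ⟨A, hAZ, hb, h0, -, hspan⟩ := exists_generator (K := K) hk hg h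
  have hyA := hA A hAZ hb h0
  refine ⟨hy, hB, fun C hC hyC => ?_, A, hAZ, hyA⟩
  obtain ⟨c, hc⟩ := hspan C hC
  have e : C = c • A + (C - c • A) := by module
  have h1 : c * y A = 0 := by
    rw [e, hy, hB _ hc, add_zero] at hyC
    exact hyC
  rw [(mul_eq_zero.mp h1).resolve_right hyA, zero_smul, sub_zero] at hc
  exact hc

theorem wf_replicate_T {k : ℕ} (C : Form K k) :
    wf C (List.replicate k T) = C (fun _ => bTX) := by
  rw [← List.ofFn_const, wf_ofFn]
  rfl

theorem isCoordinate_bTX (k : ℕ) :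
    IsCoordinate (K := K) k (-(k : ℤ)) (fun C => C (fun _ => bTX)) := by
  refine isCoordinate_of_generator (n := 0) (r := k) (by simp) (by simp) (Or.inl rfl)
    (fun c C D => by simp) (fun C hC => ?_) (fun A _ _ h0 => ?_)
  · obtain ⟨z, hz, e⟩ := exists_dw_of_mem_coboundaries hC
    have h := dw_replicate hz.skew k 0
    simpa [← e, wf_replicate_T] using h
  · simpa [wf_replicate_T] using h0

/-- The word functions of the wedge powers of the form dual to `T X`. -/
def tPow (K : Type*) [Field K] : ℕ → List Idx → K
  | 0 => cov T
  | k + 1 => wedge (tPow K k) (cov T)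

theorem isCoch_tPow (k : ℕ) : IsCoch ((k + 1 : ℕ) : ℤ) (-((k + 1 : ℕ) : ℤ)) (tPow K k) := by
  induction k with
  | zero => simpa [gr, tPow] using isCoch_cov (K := K) T
  | succ k ih =>
    have h := ih.wedge (isCoch_cov (K := K) T)
    rw [show ((k + 1 : ℕ) : ℤ) + 1 = ((k + 1 + 1 : ℕ) : ℤ) by push_cast; ring,
      show -((k + 1 : ℕ) : ℤ) + gr T = -((k + 1 + 1 : ℕ) : ℤ) by push_cast [gr]; ring] at h
    exact h

theorem dw_tPow (k : ℕ) : dw (cs K) (tPow K k) = 0 := by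
  induction k with
  | zero => exact dw_cov_T
  | succ k ih => rw [tPow, dw_wedge, ih, dw_cov_T, zero_wedge, wedge_zero, add_zero]

theorem tPow_replicate (k : ℕ) : tPow K k (List.replicate (k + 1) T) ≠ 0 := by
  have h (F : List Idx → K) (n : ℕ) : wedge F (cov T) (List.replicate (n + 1) T) =
      (n + 1) * F (List.replicate n T) := by
    induction n generalizing F with
    | zero => simp [wedge, ins, cov, tw]
    | succ n ih =>
      rw [List.replicate_succ, wedge_cons, ih, ins_cov_self, wedge_one]
      have hp : pass K T T = 1 := by simp [pass, sg, par]
      simp only [tw, ins_apply, ← List.replicate_succ, List.map_replicate, hp, List.prod_replicate,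
        one_pow]
      push_cast
      ring
  induction k with
  | zero => simp [tPow, cov]
  | succ k ih =>
    rw [tPow, h]
    exact mul_ne_zero (by exact_mod_cast k.succ.succ_ne_zero) ih

theorem isCont_dualTX : IsCont (dualTX K) := by
  refine ⟨1, fun v l h => ?_⟩
  obtain rfl : l = 0 := Subsingleton.elim _ _
  exact PowerSeries.X_pow_dvd_iff.mp (h 1 1) 0 one_pos

theorem wf_dualTX : wf (dualTX K) = cov T := by
  refine (wf_eq_iff (by exact_mod_cast (isCoch_cov T).len)).mpr fun w => ?_
  have h : dualTX K (fun l => bas (w l)) = coef T (bas (w 0)) := rfl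
  rw [h, coef_bas]
  simp [cov, eq_comm]

theorem exists_wedge_powers : ∃ P : (k : ℕ) → Form K (k + 1), P 0 = dualTX K ∧
    (∀ k, IsWedge (P k) (dualTX K) (P (k + 1))) ∧
    ∀ k : ℕ, P k ∈ cocycles K (k + 1) (-((k + 1 : ℕ) : ℤ)) ∧
      P k ∉ coboundaries K (k + 1) (-((k + 1 : ℕ) : ℤ)) ∧
      IsCoordinate (K := K) (k + 1) (-((k + 1 : ℕ) : ℤ)) (fun C => C (fun _ => bTX)) := by
  choose P hP hP' using fun k => (isCoch_tPow (K := K) k).exists_form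
  refine ⟨P, wf_injective (hP 0).2.1 isCont_dualTX (by rw [hP', wf_dualTX]; rfl),
    fun k => isWedge_of_wf (hP k).2.1 isCont_dualTX (hP (k + 1)).2.1
      (by rw [hP', hP', wf_dualTX]; rfl),
    fun k => ⟨mem_cocycles_iff.mpr ⟨hP k, by rw [hP', dw_tPow]⟩, fun h => ?_,
      isCoordinate_bTX (k + 1)⟩⟩
  have h0 : P k (fun _ => bTX) = 0 := (isCoordinate_bTX (K := K) (k + 1)).2.1 _ h
  rw [← wf_replicate_T, hP'] at h0
  exact tPow_replicate k h0

theorem wf_three (C : Form K 3) (a b c : Idx) : wf C [a, b, c] = C ![bas a, bas b, bas c] := by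
  rw [wf, if_pos (by simp)]
  congr 1
  funext i
  fin_cases i <;> rfl

theorem wf_four (C : Form K 4) (a b c d : Idx) :
    wf C [a, b, c, d] = C ![bas a, bas b, bas c, bas d] := by
  rw [wf, if_pos (by simp)]
  congr 1
  funext i
  fin_cases i <;> rfl

theorem a31_zero (C : Form K 3) :
    a31 C 0 = wf C [E 1, E 2, O 0] - 2 * wf C [T, O 1, O 1] := by
  rw [wf_three, wf_three]; rfl

theorem a31_one (C : Form K 3) :
    a31 C 1 = wf C [E 0, E 1, O 2] - 2 * wf C [T, O 1, O 1] := by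
  rw [wf_three, wf_three]; rfl

theorem a31_two (C : Form K 3) : a31 C 2 =
    -wf C [E 0, E 2, O 1] + 2 * wf C [T, O 0, O 2] + 2 * wf C [T, O 1, O 1] := by
  rw [wf_three, wf_three, wf_three]; rfl

theorem a42_zero (C : Form K 4) : a42 C 0 = wf C [E 1, E 2, O 0, O 1]
    - 1 / 6 * wf C [E 1, E 3, O 0, O 0] - 4 / 3 * wf C [T, O 1, O 1, O 1] := by
  rw [wf_four, wf_four, wf_four]; rfl

theorem a42_one (C : Form K 4) : a42 C 1 = wf C [E 0, E 1, O 1, O 2]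
    - 1 / 6 * wf C [E 1, E 3, O 0, O 0] - 4 / 3 * wf C [T, O 1, O 1, O 1] := by
  rw [wf_four, wf_four, wf_four]; rfl

theorem a42_two (C : Form K 4) : a42 C 2 = -(1 / 2) * wf C [E 0, E 2, O 1, O 1]
    - 1 / 6 * wf C [E 1, E 3, O 0, O 0] + 2 * wf C [T, O 0, O 1, O 2]
    + 2 / 3 * wf C [T, O 1, O 1, O 1] := by
  rw [wf_four, wf_four, wf_four, wf_four]; rfl

theorem a31_eq_zero {C : Form K 3} (hs : Skew (wf C)) (hd : dw (cs K) (wf C) = 0) (r : Fin 3) :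
    a31 C r = a31 C 0 := by
  have h1 := gen_three_sub_one hs
  have h2 := gen_three_sub_two hs
  rw [hd] at h1 h2
  simp only [Pi.zero_apply, mul_zero, neg_zero] at h1 h2
  fin_cases r
  · rfl
  · change a31 C 1 = _
    rw [a31_zero, a31_one]
    linear_combination -h1
  · change a31 C 2 = _
    rw [a31_zero, a31_two]
    linear_combination -h2

theorem a42_eq_zero {C : Form K 4} (hs : Skew (wf C)) (hd : dw (cs K) (wf C) = 0) (r : Fin 3) :
    a42 C r = a42 C 0 := by
  have h1 := gen_four_sub_one hs
  have h2 := gen_four_sub_two hs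
  rw [hd] at h1 h2
  simp only [Pi.zero_apply, mul_zero, neg_zero] at h1 h2
  fin_cases r
  · rfl
  · change a42 C 1 = _
    rw [a42_zero, a42_one]
    linear_combination -h1
  · change a42 C 2 = _
    rw [a42_zero, a42_two]
    linear_combination -h2

theorem isCoordinate_a31 (r : Fin 3) : IsCoordinate (K := K) 3 1 (fun C => a31 C r) := by
  refine isCoordinate_of_generator (n := 2) (r := 1) rfl (by norm_num) (Or.inr ⟨rfl, le_rfl⟩)
    (fun c C D => ?_) (fun C hC => ?_) (fun A hA hb h0 => ?_)
  · fin_cases r <;> simp [a31] <;> ring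
  · obtain ⟨z, hz, e⟩ := exists_dw_of_mem_coboundaries hC
    rw [a31_eq_zero (e ▸ hz.skew.dw cs_symm) (by rw [e, dw_dw]), a31_zero, e]
    exact gen_three_dw hz.skew
  · obtain ⟨hA, hd⟩ := mem_cocycles_iff.mp hA
    have hs := (isCoch_wf hA).skew
    -- On the basic generator the term with E_1 vanishes, leaving -2 times its detecting value on T
    -- (O 1)^2.
    rw [a31_eq_zero hs hd, a31_zero, hb.eq_zero_of_mem hs (l := [E 1, E 2, O 0]) (by simp),
      zero_sub]
    exact neg_ne_zero.mpr (mul_ne_zero two_ne_zero h0)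

theorem isCoordinate_a42 (r : Fin 3) : IsCoordinate (K := K) 4 2 (fun C => a42 C r) := by
  refine isCoordinate_of_generator (n := 3) (r := 1) rfl (by norm_num) (Or.inr ⟨rfl, by simp⟩)
    (fun c C D => ?_) (fun C hC => ?_) (fun A hA hb h0 => ?_)
  · fin_cases r <;> simp [a42] <;> ring
  · obtain ⟨z, hz, e⟩ := exists_dw_of_mem_coboundaries hC
    rw [a42_eq_zero (e ▸ hz.skew.dw cs_symm) (by rw [e, dw_dw]), a42_zero, e]
    exact gen_four_dw hz.skew
  · obtain ⟨hA, hd⟩ := mem_cocycles_iff.mp hA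
    have hs := (isCoch_wf hA).skew
    rw [a42_eq_zero hs hd, a42_zero, hb.eq_zero_of_mem hs (l := [E 1, E 2, O 0, O 1]) (by simp),
      hb.eq_zero_of_mem hs (l := [E 1, E 3, O 0, O 0]) (by simp), mul_zero, sub_zero, zero_sub]
    exact neg_ne_zero.mpr (mul_ne_zero (by norm_num) h0)

end SMWord

/-! ### Assembly of the five statements -/

theorem mainTheorem5 (K : Type*) [Field K] [CharZero K] :
    -- all cohomology in degrees and grades at most 10
    (∀ (k : ℕ) (g : ℤ), k ≤ 10 → g ≤ 10 →
      Module.rank K (OddContact.Coh K k g) =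
        if (g = (k : ℤ) - 2 ∧ 1 ≤ k ∧ k ≠ 2) ∨ g = -(k : ℤ) then 1 else 0) ∧
    -- the classes of degree `k` and grade `k - 2` are generators: products of cocycles of
    -- positive degrees are trivial there
    (∀ (k m : ℕ) (g h : ℤ), 1 ≤ k → 1 ≤ m → k + m ≤ 10 → g + h = ((k + m : ℕ) : ℤ) - 2 →
      ∀ A ∈ OddContact.cocycles K k g, ∀ B ∈ OddContact.cocycles K m h,
        ∃ W ∈ OddContact.coboundaries K (k + m) (((k + m : ℕ) : ℤ) - 2),
          OddContact.IsWedge A B W) ∧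
    -- `C(T X)` and the infinite family of its wedge powers, in all degrees
    (∃ P : (k : ℕ) → OddContact.Form K (k + 1),
      P 0 = OddContact.dualTX K ∧
      (∀ k, OddContact.IsWedge (P k) (OddContact.dualTX K) (P (k + 1))) ∧
      ∀ k : ℕ, P k ∈ OddContact.cocycles K (k + 1) (-((k + 1 : ℕ) : ℤ)) ∧
        P k ∉ OddContact.coboundaries K (k + 1) (-((k + 1 : ℕ) : ℤ)) ∧
        OddContact.IsCoordinate (K := K) (k + 1) (-((k + 1 : ℕ) : ℤ))
          (fun C => C (fun _ => OddContact.bTX))) ∧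
    -- the explicit expressions for `a^3_1`
    ((∀ r : Fin 3, OddContact.IsCoordinate (K := K) 3 1 (fun C => OddContact.a31 C r)) ∧
      ∀ C ∈ OddContact.cocycles K 3 1, ∀ r s : Fin 3,
        OddContact.a31 C r = OddContact.a31 C s) ∧
    -- the explicit expressions for `a^4_2`
    ((∀ r : Fin 3, OddContact.IsCoordinate (K := K) 4 2 (fun C => OddContact.a42 C r)) ∧
      ∀ C ∈ OddContact.cocycles K 4 2, ∀ r s : Fin 3,
        OddContact.a42 C r = OddContact.a42 C s) := by
  refine ⟨fun k g _ _ => SMWord.rank_coh k g,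
    fun k m g h hk hm _ hgh A hA B hB => SMWord.exists_isWedge_coboundary hk hm hgh hA hB,
    SMWord.exists_wedge_powers, ⟨SMWord.isCoordinate_a31, fun C hC r s => ?_⟩,
    ⟨SMWord.isCoordinate_a42, fun C hC r s => ?_⟩⟩
  · obtain ⟨hC, hd⟩ := SMWord.mem_cocycles_iff.mp hC
    have hs := (SMWord.isCoch_wf hC).skew
    rw [SMWord.a31_eq_zero hs hd r, SMWord.a31_eq_zero hs hd s]
  · obtain ⟨hC, hd⟩ := SMWord.mem_cocycles_iff.mp hC
    have hs := (SMWord.isCoch_wf hC).skew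
    rw [SMWord.a42_eq_zero hs hd r, SMWord.a42_eq_zero hs hd s]
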